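/- **Setting.** Let $n\in\{2,3\}$, $T\ge 0$. For $0\le t\le T$ let $\mathscr D_t\subset\mathbb R^n$ be a smoothly moving bounded open set with smooth boundary: there are a smooth function $\varphi$ on $\mathbb R\times\mathbb R^n$ with $\mathscr D_t=\{\varphi(t,\cdot)<0\}$ and $\partial\varphi(t,\cdot)\ne0$ on $\{\varphi(t,\cdot)=0\}=\partial\mathscr D_t$, and a ball containing all $\mathscr D_t$; $\mathscr D_0$ is nonempty and connected. Let $\mathcal N$ be the exterior unit normal to $\partial\mathscr D_t$ and $\kappa=-\partial_t\varphi/|\partial\varphi|$ the normal velocity of $\partial\mathscr D_t$. Let $v,B$ (vector fields) and $p$ (a function) be smooth up to the boundary of $\mathscr D=\bigcup_{0\le t\le T}\{t\}\times\mathscr D_t$ (that is, smoothly extendable), and put $P=p+\frac1{8\pi}|B|^2$, $D_t=\partial_t+v^k\partial_k$. Call this a *smooth solution* of the free boundary problem of incompressible ideal MHD, with constant $\varsigma\ge0$, if $$D_tv_j+\partial_jP=\tfrac1{4\pi}B^k\partial_kB_j,\qquad D_tB_j=B^k\partial_kv_j,\qquad \partial_jv^j=0\qquad\text{in }\mathscr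 D_t,\ 0\le t\le T,$$ $$v\cdot\mathcal N=\kappa,\qquad p=0,\qquad |B|=\varsigma\qquad\text{on }\partial\mathscr D_t,\ 0\le t\le T,$$ $$\partial_jB^j=0\ \text{ in }\mathscr D_0\ \text{ and }\ B\cdot\mathcal N=0\ \text{ on }\partial\mathscr D_0\quad\text{at }t=0.$$ Let $\theta_{ij}=(\delta_i^k-\mathcal N_i\mathcal N^k)\partial_k\mathcal N_j$ be the second fundamental form of $\partial\mathscr D_t$, and let $\iota_0=\iota_0(t)$ be the largest number such that $(\bar x,s)\mapsto\bar x+s\,\mathcal N(\bar x)$ is injective on $\partial\mathscr D_t\times(-\iota_0,\iota_0)$. Norms of tensors are Euclidean. **Energies.** Fix a smooth $\chi:\mathbb R\to[0,1]$ with $\chi=1$ on $(-\infty,\frac14)$ and $\chi=0$ on $(\frac12,\infty)$. For a fixed number $d_0>0$ with $d_0<\iota_0(t)$ for all $t\in[0,T]$ put $\eta(s)=\chi(s/d_0)$ and, with $d(x)=\mathrm{dist}(x,\partial\mathscr D_t)$ and $\mathcal N^i=-\partial_id$ inside $\mathscr D_t$, $$q^{ij}=\delta^{ij}-\eta(d)^2\mathcal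 N^i\mathcal N^j .$$ With $(\mathrm{curl}\,w)_{ij}=\partial_iw_j-\partial_jw_i$ and $|\mathrm{curl}\,w|^2=\sum_{i,j}(\mathrm{curl}\,w)_{ij}^2$ let $$E_0(t)=\int_{\mathscr D_t}\Big(\tfrac12|v|^2+\tfrac1{8\pi}|B|^2\Big)dx,$$ $$E_1(t)=\int_{\mathscr D_t}\delta^{ij}q^{kl}\Big(\partial_kv_i\,\partial_lv_j+\tfrac1{4\pi}\partial_kB_i\,\partial_lB_j\Big)dx+\int_{\mathscr D_t}\Big(|\mathrm{curl}\,v|^2+\tfrac1{4\pi}|\mathrm{curl}\,B|^2\Big)dx .$$ **Theorem.** For every $n\in\{2,3\}$, every $\chi$ as above and every $c_0>0$ there is a constant $C>0$, depending only on $n$, $\chi$ and $c_0$, such that the following holds. Let a smooth solution on $0\le t\le T$, numbers $M,K$, and $d_0$ as above be given with $d_0K\ge c_0$ and, for all $t\in[0,T]$, $$|\partial P|\le M,\quad |\partial v|\le M\quad\text{in }\mathscr D_t,\qquad\qquad |\theta|+|\partial v|+\frac1{\iota_0}\le K\quad\text{on }\partial\mathscr D_t .$$ Then for all $t\in[0,T]$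 $$E_1(t)\le 2e^{CMt}E_1(0)+CK^2\big(\mathrm{Vol}\,\mathscr D_t+E_0(0)\big)\big(e^{CMt}-1\big).$$ -/

import Mathlib

open scoped ContDiff ENNReal

namespace MHD

noncomputable section

/-- Euclidean space of dimension `n`. -/
abbrev Space (n : ℕ) := EuclideanSpace ℝ (Fin n)

/-- The spatial partial derivative `∂_i f`. -/
def pd {n : ℕ} (i : Fin n) (f : Space n → ℝ) (x : Space n) : ℝ :=
  fderiv ℝ f x (EuclideanSpace.single i 1)

/-- The time derivative at a fixed point of space. -/
def timeDeriv {n : ℕ} (f : ℝ → Space n → ℝ) (t : ℝ) (x : Space n) : ℝ :=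
  deriv (fun s => f s x) t

/-- The material derivative `D_t f = ∂_t f + v^k ∂_k f`. -/
def matDeriv {n : ℕ} (v : ℝ → Space n → Space n) (f : ℝ → Space n → ℝ) (t : ℝ) (x : Space n) : ℝ :=
  timeDeriv f t x + ∑ k, v t x k * pd k (f t) x

/-- The gradient tensor `(∂w)_{ij} = ∂_i w_j` of a vector field. -/
def gradTensor {n : ℕ} (w : Space n → Space n) (x : Space n) : Matrix (Fin n) (Fin n) ℝ :=
  fun i j => pd i (fun y => w y j) x

/-- The divergence `∂_j w^j`. -/
def divergence {n : ℕ} (w : Space n → Space n) (x : Space n) : ℝ :=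
  ∑ j, gradTensor w x j j

/-- The curl as an antisymmetric tensor, `(curl w)_{ij} = ∂_i w_j - ∂_j w_i`. -/
def curl {n : ℕ} (w : Space n → Space n) (x : Space n) : Matrix (Fin n) (Fin n) ℝ :=
  fun i j => gradTensor w x i j - gradTensor w x j i

/-- The squared Euclidean norm `δ^{ac} δ^{bd} A_{ab} A_{cd}` of a `(0,2)` tensor. -/
def tensorNormSq {n : ℕ} (A : Matrix (Fin n) (Fin n) ℝ) : ℝ := ∑ i, ∑ j, A i j ^ 2

/-- The Euclidean norm of a `(0,2)` tensor. -/
def tensorNorm {n : ℕ} (A : Matrix (Fin n) (Fin n) ℝ) : ℝ := √(tensorNormSq A)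

/-- The domain `D_t = {x : φ(t, x) < 0}` occupied by the fluid at time `t`, given by a level set
function `φ`. -/
def dom {n : ℕ} (φ : ℝ → Space n → ℝ) (t : ℝ) : Set (Space n) := {x | φ t x < 0}

/-- The exterior unit normal `∂φ / |∂φ|` of `D_t`, at the points of the boundary of `D_t`
(and the corresponding extension of it to a neighbourhood of the boundary). -/
def normal {n : ℕ} (φ : ℝ → Space n → ℝ) (t : ℝ) (x : Space n) : Space n :=
  ‖gradient (φ t) x‖⁻¹ • gradient (φ t) x

/-- The normal velocity of the moving boundary `{φ(t, ·) = 0}` in the direction of the exterior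
normal. -/
def normalVelocity {n : ℕ} (φ : ℝ → Space n → ℝ) (t : ℝ) (x : Space n) : ℝ :=
  -timeDeriv φ t x / ‖gradient (φ t) x‖

/-- The second fundamental form `θ_{ij} = Π_i^k ∂_k N_j`, where `Π_i^k = δ_i^k - N_i N^k`. -/
def secondFund {n : ℕ} (φ : ℝ → Space n → ℝ) (t : ℝ) (x : Space n) : Matrix (Fin n) (Fin n) ℝ :=
  fun i j => ∑ k, ((if i = k then 1 else 0) - normal φ t x i * normal φ t x k) *
    gradTensor (normal φ t) x k j

/-- The injectivity radius `ι₀` of the normal exponential map: the largest `r` for which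
`(x, s) ↦ x + s N(x)` is injective on `∂D_t × (-r, r)`. It is `0` if there is no such `r > 0`. -/
def injRadius {n : ℕ} (φ : ℝ → Space n → ℝ) (t : ℝ) : ℝ≥0∞ :=
  ⨆ (r : ℝ) (_ : Set.InjOn (fun z : Space n × ℝ => z.1 + z.2 • normal φ t z.1)
    (frontier (dom φ t) ×ˢ Set.Ioo (-r) r)), ENNReal.ofReal r

/-- The total pressure `P = p + |B|² / (8π)`. -/
def totalPressure {n : ℕ} (p : ℝ → Space n → ℝ) (B : ℝ → Space n → Space n) (t : ℝ)
    (x : Space n) : ℝ :=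
  p t x + ‖B t x‖ ^ 2 / (8 * Real.pi)

/-- `(D_t, v, B, p)`, `0 ≤ t ≤ T`, is a smooth solution of the free boundary problem of ideal
incompressible MHD, the moving domain being `D_t = {φ(t, ·) < 0}`. Smooth means smooth up to the
boundary and up to the times `0` and `T`, i.e. the fields extend smoothly across. -/
structure IsSmoothSolution {n : ℕ} (T ς : ℝ) (φ : ℝ → Space n → ℝ)
    (v B : ℝ → Space n → Space n) (p : ℝ → Space n → ℝ) : Prop where
  smooth_dom : ContDiff ℝ ∞ (fun z : ℝ × Space n => φ z.1 z.2)
  regular : ∀ t ∈ Set.Icc 0 T, ∀ x, φ t x = 0 → gradient (φ t) x ≠ 0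
  bounded : ∃ R : ℝ, ∀ t ∈ Set.Icc 0 T, dom φ t ⊆ Metric.ball 0 R
  connected : IsConnected (dom φ 0)
  smooth_v : ∀ t ∈ Set.Icc 0 T, ∀ x ∈ closure (dom φ t),
    ContDiffAt ℝ ∞ (fun z : ℝ × Space n => v z.1 z.2) (t, x)
  smooth_B : ∀ t ∈ Set.Icc 0 T, ∀ x ∈ closure (dom φ t),
    ContDiffAt ℝ ∞ (fun z : ℝ × Space n => B z.1 z.2) (t, x)
  smooth_p : ∀ t ∈ Set.Icc 0 T, ∀ x ∈ closure (dom φ t),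
    ContDiffAt ℝ ∞ (fun z : ℝ × Space n => p z.1 z.2) (t, x)
  momentum : ∀ t ∈ Set.Icc 0 T, ∀ x ∈ dom φ t, ∀ j,
    matDeriv v (fun s y => v s y j) t x + pd j (totalPressure p B t) x
      = 1 / (4 * Real.pi) * ∑ k, B t x k * gradTensor (B t) x k j
  induction : ∀ t ∈ Set.Icc 0 T, ∀ x ∈ dom φ t, ∀ j,
    matDeriv v (fun s y => B s y j) t x = ∑ k, B t x k * gradTensor (v t) x k j
  div_v : ∀ t ∈ Set.Icc 0 T, ∀ x ∈ dom φ t, divergence (v t) x = 0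
  div_B : ∀ x ∈ dom φ 0, divergence (B 0) x = 0
  kinematic : ∀ t ∈ Set.Icc 0 T, ∀ x ∈ frontier (dom φ t),
    inner ℝ (v t x) (normal φ t x) = normalVelocity φ t x
  ς_nonneg : 0 ≤ ς
  norm_B : ∀ t ∈ Set.Icc 0 T, ∀ x ∈ frontier (dom φ t), ‖B t x‖ = ς
  B_tangent : ∀ x ∈ frontier (dom φ 0), inner ℝ (B 0 x) (normal φ 0 x) = 0
  p_zero : ∀ t ∈ Set.Icc 0 T, ∀ x ∈ frontier (dom φ t), p t x = 0

/-- The profile `χ` of the cutoff function `η(d) = χ(d / d₀)`. -/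
structure IsCutoff (χ : ℝ → ℝ) : Prop where
  smooth : ContDiff ℝ ∞ χ
  nonneg : ∀ s, 0 ≤ χ s
  le_one : ∀ s, χ s ≤ 1
  eq_one : ∀ s, s < 1 / 4 → χ s = 1
  eq_zero : ∀ s, 1 / 2 < s → χ s = 0

/-- The distance `d(x) = dist(x, ∂D_t)`. -/
def bdryDist {n : ℕ} (φ : ℝ → Space n → ℝ) (t : ℝ) (x : Space n) : ℝ :=
  Metric.infDist x (frontier (dom φ t))

/-- The coefficients `q^{ij} = δ^{ij} - η(d)² N^i N^j` with `N^i = -∂_i d` and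
`η(d) = χ(d / d₀)`. -/
def projCoeff {n : ℕ} (χ : ℝ → ℝ) (d₀ : ℝ) (φ : ℝ → Space n → ℝ) (t : ℝ) (x : Space n)
    (i j : Fin n) : ℝ :=
  (if i = j then 1 else 0) - χ (bdryDist φ t x / d₀) ^ 2 *
    (-pd i (bdryDist φ t) x) * (-pd j (bdryDist φ t) x)

/-- The form `δ^{ij} Q(∂w_i, ∂w_j) = δ^{ij} q^{kl} ∂_k w_i ∂_l w_j`. -/
def projGradSq {n : ℕ} (χ : ℝ → ℝ) (d₀ : ℝ) (φ : ℝ → Space n → ℝ) (t : ℝ)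
    (w : Space n → Space n) (x : Space n) : ℝ :=
  ∑ i, ∑ k, ∑ l, projCoeff χ d₀ φ t x k l * gradTensor w x k i * gradTensor w x l i

/-- The zeroth-order energy, i.e. the total energy of the system. -/
def energy0 {n : ℕ} (φ : ℝ → Space n → ℝ) (v B : ℝ → Space n → Space n) (t : ℝ) : ℝ :=
  ∫ x in dom φ t, (1 / 2 * ‖v t x‖ ^ 2 + 1 / (8 * Real.pi) * ‖B t x‖ ^ 2)

/-- The first-order energy. -/
def energy1 {n : ℕ} (χ : ℝ → ℝ) (d₀ : ℝ) (φ : ℝ → Space n → ℝ)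
    (v B : ℝ → Space n → Space n) (t : ℝ) : ℝ :=
  (∫ x in dom φ t, (projGradSq χ d₀ φ t (v t) x
      + 1 / (4 * Real.pi) * projGradSq χ d₀ φ t (B t) x))
  + ∫ x in dom φ t, (tensorNormSq (curl (v t) x)
      + 1 / (4 * Real.pi) * tensorNormSq (curl (B t) x))

end

end MHD

open scoped ContDiff ENNReal

namespace MHD

open Set Filter Topology MeasureTheory

/-! Along the flow the gradients of `v` and `B` solve a symmetric system. With the commutator `[∂_k,
D_t] = (∂_k v^m) ∂_m`, the material derivative of `density1` splits into terms with second
derivatives of the fields and lower order terms. The magnetic second derivatives add up to `B · ∂`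
of the polarized energy form in `∂B` and `∂v`, which is a divergence because `div B = 0`. The
Hessian of `P` paired with `∂v` is, up to lower order, the divergence of the projected pressure
gradient contracted with `∂v`, since `div v = 0` and a symmetric Hessian has no curl. Both fluxes
are tangent to the boundary: `B · N = 0` there, and `P` is constant there, so `∂P` is normal and its
projection vanishes. This is `flowDeriv_density1` together with `isTangentField_flux1`.

The lower order terms (`abs_remainder_le`) are cubic in the gradients with a factor `∂v` bounded by
`M`, or contain derivatives of `m = η(d) ∂d`, where `q = δ - m ⊗ m`. Spatial derivatives of `m` are
`O(1/d₀)`, hence `O(K)` because `d₀ K ≥ c₀`. The material derivative of `m` is `O(M)`, because `D_t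
d = (v(x) - v(Y)) · ∂d` with `Y` the nearest boundary point. Full gradients are recovered by
`tensorNormSq_le_quadForm`: for a divergence free field, the tangential derivatives and the curl
determine the normal derivative. Hence `f = density1 + K² (1 + density0)` satisfies `D_t f ≤ div X +
C M f` with `X` tangent to the boundary. The transport inequality `integral_dom_le` bounds the
growth of `∫ f` by `exp (C M t)`, and since the volume and `E₀` are conserved, subtracting them
gives the estimate.

Three ingredients support this. The transport inequality avoids boundary integrals by cutting off
logarithmically near the boundary. The bound `d₀ < ι₀` gives touching balls of radius `d₀` on both
sides of the boundary; these control the Hessian of `d` for `d ≤ d₀/2` (`abs_hessian_distFun_le`),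
and through the inverse function theorem make the nearest point a smooth function of time and
position (`exists_smooth_foot`). Finally the initial constraints on `B` persist: `div B = 0` by the
transport inequality for `(div B)²` (`trace_gradMat_B`), and `B · N = 0` by a maximum argument on
the moving boundary (`normal_B_eq_zero`). -/

/-- The derivative at `z` of a function on spacetime in the spatial direction `w`. -/
noncomputable def spaceDeriv {n : ℕ} (w : Space n) (F : ℝ × Space n → ℝ) (z : ℝ × Space n) : ℝ :=
  fderiv ℝ F z (0, w)

/-- The derivative at `z` of a function on spacetime along `∂_t + w`. -/
noncomputable def flowDeriv {n : ℕ} (w : Space n) (F : ℝ × Space n → ℝ) (z : ℝ × Space n) : ℝ :=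
  fderiv ℝ F z (1, w)

/-- The standard basis vector `e_i`. -/
noncomputable abbrev basisVec {n : ℕ} (i : Fin n) : Space n := EuclideanSpace.single i 1

/-! ### Coordinate derivatives as derivatives on spacetime. -/

section conversions

variable {n : ℕ}

lemma sum_smul_basisVec (w : Space n) : ∑ i, w i • basisVec i = w := by
  ext j
  simp [Pi.single_apply]

lemma spaceDeriv_eq_sum (w : Space n) (F : ℝ × Space n → ℝ) (z : ℝ × Space n) :
    spaceDeriv w F z = ∑ i, w i * spaceDeriv (basisVec i) F z := by
  have h : ((0, w) : ℝ × Space n) = ∑ i, w i • ((0, basisVec i) : ℝ × Space n) := by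
    ext1
    · simp [Prod.fst_sum]
    · simp only [Prod.snd_sum, Prod.smul_snd]
      exact (sum_smul_basisVec w).symm
  unfold spaceDeriv
  rw [h, map_sum]
  exact Finset.sum_congr rfl fun i _ => by rw [map_smul, smul_eq_mul]

lemma flowDeriv_eq_add (w : Space n) (F : ℝ × Space n → ℝ) (z : ℝ × Space n) :
    flowDeriv w F z = fderiv ℝ F z (1, 0) + spaceDeriv w F z := by
  unfold flowDeriv spaceDeriv
  rw [← map_add]
  simp

lemma hasFDerivAt_slice {F : ℝ × Space n → ℝ} {t : ℝ} {x : Space n}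
    (h : DifferentiableAt ℝ F (t, x)) :
    HasFDerivAt (fun y => F (t, y))
      ((fderiv ℝ F (t, x)).comp (ContinuousLinearMap.inr ℝ ℝ (Space n))) x :=
  h.hasFDerivAt.comp x (hasFDerivAt_prodMk_right t x)

lemma fderiv_slice {F : ℝ × Space n → ℝ} {t : ℝ} {x : Space n}
    (h : DifferentiableAt ℝ F (t, x)) (w : Space n) :
    fderiv ℝ (fun y => F (t, y)) x w = spaceDeriv w F (t, x) := by
  rw [(hasFDerivAt_slice h).fderiv]
  simp [spaceDeriv]

lemma pd_slice {F : ℝ × Space n → ℝ} {t : ℝ} {x : Space n}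
    (h : DifferentiableAt ℝ F (t, x)) (i : Fin n) :
    pd i (fun y => F (t, y)) x = spaceDeriv (basisVec i) F (t, x) :=
  fderiv_slice h _

lemma hasDerivAt_slice_time {F : ℝ × Space n → ℝ} {t : ℝ} {x : Space n}
    (h : DifferentiableAt ℝ F (t, x)) :
    HasDerivAt (fun s => F (s, x)) (fderiv ℝ F (t, x) (1, 0)) t := by
  have h1 : HasDerivAt (fun s : ℝ => (s, x)) ((1 : ℝ), (0 : Space n)) t :=
    (hasDerivAt_id t).prodMk (hasDerivAt_const t x)
  exact h.hasFDerivAt.comp_hasDerivAt t h1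

lemma timeDeriv_slice {f : ℝ → Space n → ℝ} {t : ℝ} {x : Space n}
    (h : DifferentiableAt ℝ (fun z : ℝ × Space n => f z.1 z.2) (t, x)) :
    timeDeriv f t x = fderiv ℝ (fun z : ℝ × Space n => f z.1 z.2) (t, x) (1, 0) :=
  (hasDerivAt_slice_time h).deriv

lemma matDeriv_eq {v : ℝ → Space n → Space n} {f : ℝ → Space n → ℝ} {t : ℝ} {x : Space n}
    (h : DifferentiableAt ℝ (fun z : ℝ × Space n => f z.1 z.2) (t, x)) :
    matDeriv v f t x = flowDeriv (v t x) (fun z : ℝ × Space n => f z.1 z.2) (t, x) := by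
  rw [flowDeriv_eq_add, spaceDeriv_eq_sum, matDeriv, timeDeriv_slice h]
  congr 1
  refine Finset.sum_congr rfl fun k _ => ?_
  rw [← pd_slice h]

lemma inner_gradient {f : Space n → ℝ} {x : Space n} (h : DifferentiableAt ℝ f x) (w : Space n) :
    inner ℝ (gradient f x) w = fderiv ℝ f x w := by
  rw [h.hasGradientAt.hasFDerivAt.fderiv, InnerProductSpace.toDual_apply_apply]

end conversions

/-! ### Commutators of derivatives. -/

section smoothness

variable {n : ℕ}

lemma contDiffAt_spaceDeriv {F : ℝ × Space n → ℝ} {z : ℝ × Space n} {m k : WithTop ℕ∞}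
    (h : ContDiffAt ℝ k F z) (hk : m + 1 ≤ k) (w : Space n) :
    ContDiffAt ℝ m (spaceDeriv w F) z :=
  (h.fderiv_right hk).clm_apply contDiffAt_const

lemma fderiv_fderiv_apply {E : Type*} [NormedAddCommGroup E] [NormedSpace ℝ E]
    {F : E → ℝ} {w : E → E} {z : E} (h : ContDiffAt ℝ 2 F z) (hw : DifferentiableAt ℝ w z)
    (u : E) :
    fderiv ℝ (fun y => fderiv ℝ F y (w y)) z u
      = fderiv ℝ (fderiv ℝ F) z u (w z) + fderiv ℝ F z (fderiv ℝ w z u) := by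
  have h1 : DifferentiableAt ℝ (fderiv ℝ F) z :=
    (h.fderiv_right (m := 1) le_rfl).differentiableAt one_ne_zero
  rw [(h1.hasFDerivAt.clm_apply hw.hasFDerivAt).fderiv]
  simp [add_comm]

/-- The commutator of a derivative in a fixed direction and a derivative along a vector field. -/
lemma fderiv_fderiv_comm {E : Type*} [NormedAddCommGroup E] [NormedSpace ℝ E]
    {F : E → ℝ} {w : E → E} {z : E} (h : ContDiffAt ℝ 2 F z) (hw : DifferentiableAt ℝ w z)
    (u : E) :
    fderiv ℝ (fun y => fderiv ℝ F y (w y)) z u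
      = fderiv ℝ (fun y => fderiv ℝ F y u) z (w z) + fderiv ℝ F z (fderiv ℝ w z u) := by
  rw [fderiv_fderiv_apply h hw, fderiv_fderiv_apply h (differentiableAt_const u)]
  -- The symmetric second derivatives cancel, so only the derivative of the field `w` remains.
  have := (h.isSymmSndFDerivAt (by simp)).eq u (w z)
  simp [this]

lemma spaceDeriv_comm {F : ℝ × Space n → ℝ} {z : ℝ × Space n} (h : ContDiffAt ℝ 2 F z)
    (u w : Space n) :
    spaceDeriv u (spaceDeriv w F) z = spaceDeriv w (spaceDeriv u F) z := by
  have := fderiv_fderiv_comm h (differentiableAt_const ((0 : ℝ), w)) ((0 : ℝ), u)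
  simp only [fderiv_fun_const, Pi.zero_apply, _root_.zero_apply, map_zero,
    add_zero] at this
  exact this

/-- The commutator `[∂_u, D_t] = (∂_u w)^m ∂_m`. -/
lemma spaceDeriv_flowDeriv {F : ℝ × Space n → ℝ} {w : ℝ × Space n → Space n} {z : ℝ × Space n}
    (h : ContDiffAt ℝ 2 F z) (hw : ∀ i, DifferentiableAt ℝ (fun y => w y i) z) (u : Space n) :
    spaceDeriv u (fun y => flowDeriv (w y) F y) z
      = flowDeriv (w z) (spaceDeriv u F) z
        + ∑ m, spaceDeriv u (fun y => w y m) z * spaceDeriv (basisVec m) F z := by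
  have hw' : DifferentiableAt ℝ w z := (differentiableAt_euclidean).2 hw
  have := fderiv_fderiv_comm h ((differentiableAt_const (1 : ℝ)).prodMk hw') ((0 : ℝ), u)
  unfold flowDeriv
  rw [spaceDeriv, this]
  congr 1
  have h2 : fderiv ℝ (fun y => ((1 : ℝ), w y)) z (0, u) = (0, fderiv ℝ w z (0, u)) := by
    rw [((hasFDerivAt_const (1 : ℝ) z).prodMk hw'.hasFDerivAt).fderiv]
    simp
  rw [h2]
  change spaceDeriv (fderiv ℝ w z (0, u)) F z = _
  rw [spaceDeriv_eq_sum]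
  refine Finset.sum_congr rfl fun m _ => ?_
  congr 1
  have h3 := (((EuclideanSpace.proj (𝕜 := ℝ) m).hasFDerivAt).comp z hw'.hasFDerivAt).fderiv
  have h4 : (fun y => w y m) = (EuclideanSpace.proj (𝕜 := ℝ) m : Space n → ℝ) ∘ w := rfl
  rw [spaceDeriv, h4, h3]
  simp

/-- The commutator `[∂_u, w^k ∂_k] = (∂_u w)^m ∂_m`. -/
lemma spaceDeriv_spaceDeriv {F : ℝ × Space n → ℝ} {w : ℝ × Space n → Space n} {z : ℝ × Space n}
    (h : ContDiffAt ℝ 2 F z) (hw : ∀ i, DifferentiableAt ℝ (fun y => w y i) z) (u : Space n) :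
    spaceDeriv u (fun y => spaceDeriv (w y) F y) z
      = spaceDeriv (w z) (spaceDeriv u F) z
        + ∑ m, spaceDeriv u (fun y => w y m) z * spaceDeriv (basisVec m) F z := by
  have hw' : DifferentiableAt ℝ w z := (differentiableAt_euclidean).2 hw
  have := fderiv_fderiv_comm h ((differentiableAt_const (0 : ℝ)).prodMk hw') ((0 : ℝ), u)
  rw [spaceDeriv]
  unfold spaceDeriv
  rw [this]
  congr 1
  have h2 : fderiv ℝ (fun y => ((0 : ℝ), w y)) z (0, u) = (0, fderiv ℝ w z (0, u)) := by
    rw [((hasFDerivAt_const (0 : ℝ) z).prodMk hw'.hasFDerivAt).fderiv]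
    simp
  rw [h2]
  change spaceDeriv (fderiv ℝ w z (0, u)) F z = _
  rw [spaceDeriv_eq_sum]
  refine Finset.sum_congr rfl fun m _ => ?_
  congr 1
  have h3 := (((EuclideanSpace.proj (𝕜 := ℝ) m).hasFDerivAt).comp z hw'.hasFDerivAt).fderiv
  have h4 : (fun y => w y m) = (EuclideanSpace.proj (𝕜 := ℝ) m : Space n → ℝ) ∘ w := rfl
  rw [h4, h3]
  simp

end smoothness

/-! ### Logarithmic cutoff functions. -/

section logCutoff

/-- A smooth function of `s` vanishing for `s ≥ -exp (-2 / δ)` and equal to `1` for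
`s ≤ -exp (-1 / δ)`, whose logarithmic derivative is of size `δ`. -/
noncomputable def logCutoff (δ s : ℝ) : ℝ :=
  if s < 0 then Real.smoothTransition (2 + δ * Real.log (-s)) else 0

lemma logCutoff_nonneg (δ s : ℝ) : 0 ≤ logCutoff δ s := by
  unfold logCutoff
  split_ifs
  · exact Real.smoothTransition.nonneg _
  · exact le_rfl

lemma logCutoff_le_one (δ s : ℝ) : logCutoff δ s ≤ 1 := by
  unfold logCutoff
  split_ifs
  · exact Real.smoothTransition.le_one _
  · exact zero_le_one

lemma logCutoff_eq_zero {δ s : ℝ} (hδ : 0 < δ) (hs : -Real.exp (-2 / δ) ≤ s) :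
    logCutoff δ s = 0 := by
  unfold logCutoff
  split_ifs with h
  · apply Real.smoothTransition.zero_of_nonpos
    have h1 : Real.log (-s) ≤ -2 / δ := by
      rw [← Real.log_exp (-2 / δ)]
      exact Real.log_le_log (by linarith) (by linarith)
    have h2 : δ * Real.log (-s) ≤ δ * (-2 / δ) := mul_le_mul_of_nonneg_left h1 hδ.le
    have h3 : δ * (-2 / δ) = -2 := by field_simp
    linarith
  · rfl

lemma logCutoff_eventually_eq_zero {δ s : ℝ} (hδ : 0 < δ) (hs : 0 ≤ s) :
    ∀ᶠ r in 𝓝 s, logCutoff δ r = 0 := by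
  have : -Real.exp (-2 / δ) < s := lt_of_lt_of_le (by simpa using Real.exp_pos _) hs
  filter_upwards [lt_mem_nhds this] with r hr using logCutoff_eq_zero hδ hr.le

lemma logCutoff_eventually_eq {δ s : ℝ} (hs : s < 0) :
    logCutoff δ =ᶠ[𝓝 s] fun r => Real.smoothTransition (2 + δ * Real.log (-r)) := by
  filter_upwards [gt_mem_nhds hs] with r hr
  simp [logCutoff, hr]

lemma contDiff_logCutoff {δ : ℝ} (hδ : 0 < δ) : ContDiff ℝ 1 (logCutoff δ) := by
  rw [contDiff_iff_contDiffAt]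
  intro s
  rcases lt_or_ge s 0 with hs | hs
  · refine ContDiffAt.congr_of_eventuallyEq ?_ (logCutoff_eventually_eq hs)
    refine Real.smoothTransition.contDiff.contDiffAt.comp s ?_
    exact contDiffAt_const.add (contDiffAt_const.mul
      (contDiffAt_id.neg.log (by simpa using hs.ne)))
  · exact contDiffAt_const.congr_of_eventuallyEq (logCutoff_eventually_eq_zero hδ hs)

lemma exists_abs_deriv_smoothTransition_le :
    ∃ C : ℝ, 0 ≤ C ∧ ∀ s, |deriv Real.smoothTransition s| ≤ C := by
  have hc : Continuous (deriv Real.smoothTransition) :=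
    (Real.smoothTransition.contDiff (n := 1)).continuous_deriv le_rfl
  obtain ⟨C, hC⟩ := (isCompact_Icc (a := (0 : ℝ)) (b := 1)).exists_bound_of_continuousOn
    hc.continuousOn
  refine ⟨max C 0, le_max_right _ _, fun s => ?_⟩
  by_cases hs : s ∈ Icc (0 : ℝ) 1
  · exact (hC s hs).trans (le_max_left _ _)
  · have : deriv Real.smoothTransition s = 0 := by
      rw [mem_Icc, not_and_or, not_le, not_le] at hs
      rcases hs with hs | hs
      · have : Real.smoothTransition =ᶠ[𝓝 s] fun _ => 0 := by
          filter_upwards [gt_mem_nhds hs] with r hr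
            using Real.smoothTransition.zero_of_nonpos hr.le
        rw [this.deriv_eq, deriv_const]
      · have : Real.smoothTransition =ᶠ[𝓝 s] fun _ => 1 := by
          filter_upwards [lt_mem_nhds hs] with r hr
            using Real.smoothTransition.one_of_one_le hr.le
        rw [this.deriv_eq, deriv_const]
    rw [this, abs_zero]
    exact le_max_right _ _

/-- The chain rule produces `δ / s`, and the factor `|s|` cancels the singularity. The smallness is
pointwise and uniform in `s`, so boundary errors vanish with `δ` without any estimate for the volume
of a boundary layer. -/
lemma exists_abs_mul_deriv_logCutoff_le :
    ∃ C : ℝ, 0 ≤ C ∧ ∀ δ > 0, ∀ s, |deriv (logCutoff δ) s| * |s| ≤ C * δ := by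
  obtain ⟨C, hC0, hC⟩ := exists_abs_deriv_smoothTransition_le
  refine ⟨C, hC0, fun δ hδ s => ?_⟩
  rcases lt_or_ge s 0 with hs | hs
  · have h1 : HasDerivAt (fun r : ℝ => 2 + δ * Real.log (-r)) (δ * (-1 / (-s))) s :=
      (((hasDerivAt_id s).neg.log (by simpa using hs.ne)).const_mul δ).const_add 2
    have h2 : DifferentiableAt ℝ Real.smoothTransition (2 + δ * Real.log (-s)) :=
      (Real.smoothTransition.contDiff (n := 1)).differentiable one_ne_zero _
    have h3 := h2.hasDerivAt.comp s h1
    rw [(logCutoff_eventually_eq hs).deriv_eq]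
    have h4 : deriv (fun r => Real.smoothTransition (2 + δ * Real.log (-r))) s
      = deriv Real.smoothTransition (2 + δ * Real.log (-s)) * (δ * (-1 / (-s))) := h3.deriv
    rw [h4, ← abs_mul]
    have h5 : deriv Real.smoothTransition (2 + δ * Real.log (-s)) * (δ * (-1 / (-s))) * s
      = deriv Real.smoothTransition (2 + δ * Real.log (-s)) * δ := by
      field_simp [hs.ne]
    rw [h5, abs_mul, abs_of_pos hδ]
    exact mul_le_mul_of_nonneg_right (hC _) hδ.le
  · have h0 : logCutoff δ =ᶠ[𝓝 s] fun _ => 0 := logCutoff_eventually_eq_zero hδ hs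
    rw [h0.deriv_eq]
    simp only [deriv_const, abs_zero, zero_mul]
    positivity

/-- As `δ → 0` the argument `2 + δ log (-s)` tends to `2`, beyond the point where the transition
reaches `1`. The cutoffs thus converge pointwise to the indicator of the negative half line. -/
lemma tendsto_logCutoff {s : ℝ} (hs : s < 0) :
    Tendsto (fun δ => logCutoff δ s) (𝓝[>] 0) (𝓝 1) := by
  have h1 : Tendsto (fun δ : ℝ => 2 + δ * Real.log (-s)) (𝓝[>] 0) (𝓝 (2 + 0 * Real.log (-s))) :=
    ((continuous_const.add (continuous_id.mul continuous_const)).tendsto 0).mono_left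
      nhdsWithin_le_nhds
  have h2 : ∀ᶠ δ : ℝ in 𝓝[>] 0, 1 < 2 + δ * Real.log (-s) :=
    h1.eventually (lt_mem_nhds (by norm_num))
  refine Tendsto.congr' ?_ tendsto_const_nhds
  filter_upwards [h2] with δ hδ
  rw [logCutoff, if_pos hs, Real.smoothTransition.one_of_one_le hδ.le]

end logCutoff

/-! ### Spacetime regions and cut-off densities. -/

/-- The part of spacetime occupied by the fluid at the times `0 ≤ t ≤ T`. -/
def fluidRegion {n : ℕ} (T : ℝ) (φ : ℝ → Space n → ℝ) : Set (ℝ × Space n) :=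
  {z | z.1 ∈ Icc 0 T ∧ φ z.1 z.2 < 0}

/-- The part of spacetime occupied by the fluid at the times `0 < t < T`. -/
def openFluidRegion {n : ℕ} (T : ℝ) (φ : ℝ → Space n → ℝ) : Set (ℝ × Space n) :=
  {z | z.1 ∈ Ioo 0 T ∧ φ z.1 z.2 < 0}

lemma openFluidRegion_subset {n : ℕ} (T : ℝ) (φ : ℝ → Space n → ℝ) :
    openFluidRegion T φ ⊆ fluidRegion T φ := fun _ hz => ⟨Ioo_subset_Icc_self hz.1, hz.2⟩

lemma isOpen_openFluidRegion {n : ℕ} (T : ℝ) {φ : ℝ → Space n → ℝ}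
    (hφ : Continuous fun z : ℝ × Space n => φ z.1 z.2) : IsOpen (openFluidRegion T φ) :=
  (isOpen_Ioo.preimage continuous_fst).inter (isOpen_Iio.preimage hφ)

lemma isOpen_dom {n : ℕ} {φ : ℝ → Space n → ℝ}
    (hφ : Continuous fun z : ℝ × Space n => φ z.1 z.2) (t : ℝ) : IsOpen (dom φ t) :=
  isOpen_Iio.preimage (hφ.comp (Continuous.prodMk_right t))

section cutoff

variable {n : ℕ} {T δ : ℝ} {φ : ℝ → Space n → ℝ}

/-- No regularity of `f` is needed at or beyond the boundary: the cutoff vanishes on a whole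
neighbourhood of every point with `φ ≥ 0`. -/
lemma contDiffAt_logCutoff_mul (hδ : 0 < δ) (hφ : ContDiff ℝ 1 fun z : ℝ × Space n => φ z.1 z.2)
    {f : ℝ × Space n → ℝ} (hf : ∀ z ∈ openFluidRegion T φ, ContDiffAt ℝ 1 f z)
    {z : ℝ × Space n} (hz : z.1 ∈ Ioo 0 T) :
    ContDiffAt ℝ 1 (fun z => logCutoff δ (φ z.1 z.2) * f z) z := by
  rcases lt_or_ge (φ z.1 z.2) 0 with h | h
  · exact ((contDiff_logCutoff hδ).contDiffAt.comp z hφ.contDiffAt).mul (hf z ⟨hz, h⟩)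
  · refine (contDiffAt_const (c := (0 : ℝ))).congr_of_eventuallyEq ?_
    have := (hφ.continuous.continuousAt (x := z)).eventually (logCutoff_eventually_eq_zero hδ h)
    filter_upwards [this] with y hy
    simp [hy]

lemma continuousOn_logCutoff_mul (hδ : 0 < δ)
    (hφ : ContDiff ℝ 1 fun z : ℝ × Space n => φ z.1 z.2)
    {f : ℝ × Space n → ℝ} (hf : ContinuousOn f (fluidRegion T φ)) :
    ContinuousOn (fun z => logCutoff δ (φ z.1 z.2) * f z) (Icc 0 T ×ˢ univ) := by
  intro z hz
  rcases lt_or_ge (φ z.1 z.2) 0 with h | h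
  · have h1 : ContinuousWithinAt f (Icc 0 T ×ˢ univ) z := by
      refine (hf z ⟨hz.1, h⟩).mono_of_mem_nhdsWithin ?_
      have := hφ.continuous.continuousAt.eventually (gt_mem_nhds h)
      filter_upwards [mem_nhdsWithin_of_mem_nhds this, self_mem_nhdsWithin] with y hy hy'
        using ⟨hy'.1, hy⟩
    exact (((contDiff_logCutoff hδ).continuous.comp hφ.continuous).continuousWithinAt).mul h1
  · refine (continuousWithinAt_const (b := (0 : ℝ))).congr_of_eventuallyEq ?_ ?_
    · have := (hφ.continuous.continuousAt (x := z)).eventually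
        (logCutoff_eventually_eq_zero hδ h)
      filter_upwards [mem_nhdsWithin_of_mem_nhds this] with y hy
      simp [hy]
    · simp [(logCutoff_eventually_eq_zero hδ h).self_of_nhds]

end cutoff

/-! ### Integrals of compactly supported functions. -/

section integration

variable {n : ℕ}

/-- The integral of a partial derivative of a compactly supported function vanishes. -/
lemma integral_fderiv_apply_eq_zero {g : Space n → ℝ} (hg : ContDiff ℝ 1 g)
    (hs : HasCompactSupport g) (w : Space n) : ∫ x, fderiv ℝ g x w = 0 := by
  have hint : Integrable (fun x => fderiv ℝ g x w) :=
    ((hg.continuous_fderiv one_ne_zero).clm_apply continuous_const).integrable_of_hasCompactSupport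
      (hs.fderiv_apply ℝ w)
  -- Integration by parts against the constant function `1`.
  have := integral_mul_fderiv_eq_neg_fderiv_mul_of_integrable (μ := volume)
    (f := fun _ : Space n => (1 : ℝ)) (g := g) (v := w) (by simp) (by simpa using hint)
    (by simpa using hg.continuous.integrable_of_hasCompactSupport hs)
    (fun _ _ => differentiableAt_const _) (fun x _ => hg.differentiable one_ne_zero x)
  simpa using this

lemma contDiff_slice {F : ℝ × Space n → ℝ} {t : ℝ} (h : ∀ x, ContDiffAt ℝ 1 F (t, x)) :
    ContDiff ℝ 1 fun x => F (t, x) := by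
  rw [contDiff_iff_contDiffAt]
  intro x
  exact (h x).comp x (contDiffAt_const.prodMk contDiffAt_id)

lemma hasCompactSupport_of_ball {g : Space n → ℝ} {R : ℝ}
    (h : ∀ x, x ∉ Metric.closedBall (0 : Space n) R → g x = 0) : HasCompactSupport g :=
  HasCompactSupport.intro (isCompact_closedBall 0 R) h

/-- Differentiation under the integral sign for functions on spacetime which are compactly
supported in space. -/
lemma hasDerivAt_integral_slice {U : ℝ × Space n → ℝ} {T R : ℝ}
    (hU : ∀ z : ℝ × Space n, z.1 ∈ Ioo 0 T → ContDiffAt ℝ 1 U z)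
    (hR : ∀ z : ℝ × Space n, z.1 ∈ Ioo 0 T → z.2 ∉ Metric.closedBall (0 : Space n) R → U z = 0)
    {t : ℝ} (ht : t ∈ Ioo 0 T) :
    HasDerivAt (fun s => ∫ x, U (s, x)) (∫ x, fderiv ℝ U (t, x) (1, 0)) t := by
  obtain ⟨a, b, hab, hnhds, hsub⟩ : ∃ a b : ℝ, t ∈ Ioo a b ∧ Icc a b ∈ 𝓝 t ∧ Icc a b ⊆ Ioo 0 T := by
    refine ⟨t / 2, (t + T) / 2, ⟨?_, ?_⟩, Icc_mem_nhds ?_ ?_, fun s hs => ⟨?_, ?_⟩⟩ <;>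
      first
      | linarith [ht.1, ht.2]
      | linarith [ht.1, ht.2, hs.1, hs.2]
  have hcont : ContinuousOn (fun z => fderiv ℝ U z (1, 0))
      (Icc a b ×ˢ Metric.closedBall (0 : Space n) R) := by
    intro z hz
    have h1 : ContinuousAt (fderiv ℝ U) z :=
      ((hU z (hsub hz.1)).fderiv_right (m := 0) (by simp)).continuousAt
    exact (h1.clm_apply continuousAt_const).continuousWithinAt
  obtain ⟨C, hC⟩ := (isCompact_Icc.prod (isCompact_closedBall (0 : Space n) R)).exists_bound_of_continuousOn hcont
  have hz0 : ∀ s ∈ Ioo 0 T, ∀ x, x ∉ Metric.closedBall (0 : Space n) R →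
      fderiv ℝ U (s, x) (1, 0) = 0 := by
    intro s hs x hx
    have : U =ᶠ[𝓝 (s, x)] fun _ => 0 := by
      have h1 : {z : ℝ × Space n | z.1 ∈ Ioo 0 T ∧ z.2 ∉ Metric.closedBall (0 : Space n) R}
          ∈ 𝓝 (s, x) :=
        ((isOpen_Ioo.preimage continuous_fst).inter
          (Metric.isClosed_closedBall.isOpen_compl.preimage continuous_snd)).mem_nhds ⟨hs, hx⟩
      filter_upwards [h1] with z hz using hR z hz.1 hz.2
    rw [this.fderiv_eq]
    simp
  have hslice : ∀ s ∈ Ioo 0 T, Continuous fun x => U (s, x) := fun s hs =>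
    (contDiff_slice fun x => hU (s, x) hs).continuous
  refine (hasDerivAt_integral_of_dominated_loc_of_deriv_le (s := Icc a b)
    (F := fun s x => U (s, x)) (F' := fun s x => fderiv ℝ U (s, x) (1, 0))
    (bound := (Metric.closedBall (0 : Space n) R).indicator fun _ => C)
    hnhds ?_ ?_ ?_ ?_ ?_ ?_).2
  · filter_upwards [isOpen_Ioo.mem_nhds ht] with s hs using (hslice s hs).aestronglyMeasurable
  · exact (hslice t ht).integrable_of_hasCompactSupport
      (hasCompactSupport_of_ball fun x hx => hR (t, x) ht hx)
  · refine Continuous.aestronglyMeasurable (continuous_iff_continuousAt.2 fun x => ?_)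
    have h1 : ContinuousAt (fderiv ℝ U) (t, x) :=
      ((hU (t, x) ht).fderiv_right (m := 0) (by simp)).continuousAt
    have h2 : ContinuousAt (fun z => fderiv ℝ U z (1, 0)) (t, x) := h1.clm_apply continuousAt_const
    exact h2.comp (f := fun y => (t, y)) (Continuous.prodMk_right t).continuousAt
  · refine Eventually.of_forall fun x s hs => ?_
    by_cases hx : x ∈ Metric.closedBall (0 : Space n) R
    · rw [indicator_of_mem hx]
      exact hC (s, x) ⟨hs, hx⟩
    · rw [indicator_of_notMem hx, hz0 s (hsub hs) x hx, norm_zero]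
  · exact (integrable_indicator_iff Metric.isClosed_closedBall.measurableSet).2
      (integrableOn_const (isCompact_closedBall _ _).measure_lt_top.ne)
  · refine Eventually.of_forall fun x s hs => ?_
    exact hasDerivAt_slice_time ((hU (s, x) (hsub hs)).differentiableAt one_ne_zero)

end integration

/-! ### The transport inequality on the moving domain. -/

section transport

variable {n : ℕ} {T δ : ℝ} {φ : ℝ → Space n → ℝ}

lemma fderiv_logCutoff_mul (hδ : 0 < δ) (hφ : ContDiff ℝ 1 fun z : ℝ × Space n => φ z.1 z.2)
    {f : ℝ × Space n → ℝ} {z : ℝ × Space n} (hf : DifferentiableAt ℝ f z) (u : ℝ × Space n) :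
    fderiv ℝ (fun z => logCutoff δ (φ z.1 z.2) * f z) z u
      = deriv (logCutoff δ) (φ z.1 z.2) * fderiv ℝ (fun z : ℝ × Space n => φ z.1 z.2) z u * f z
        + logCutoff δ (φ z.1 z.2) * fderiv ℝ f z u := by
  have h1 : HasDerivAt (logCutoff δ) (deriv (logCutoff δ) (φ z.1 z.2)) (φ z.1 z.2) :=
    ((contDiff_logCutoff hδ).differentiable one_ne_zero _).hasDerivAt
  have h2 := (hφ.differentiable one_ne_zero z).hasFDerivAt
  have h3 := (h1.comp_hasFDerivAt z h2).mul hf.hasFDerivAt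
  have h4 : fderiv ℝ (fun z => logCutoff δ (φ z.1 z.2) * f z) z = _ := h3.fderiv
  rw [h4]
  simp
  ring

lemma fderiv_logCutoff_mul_of_nonneg (hδ : 0 < δ)
    (hφ : ContDiff ℝ 1 fun z : ℝ × Space n => φ z.1 z.2)
    {f : ℝ × Space n → ℝ} {z : ℝ × Space n} (h : 0 ≤ φ z.1 z.2) :
    fderiv ℝ (fun z => logCutoff δ (φ z.1 z.2) * f z) z = 0 := by
  have h1 : (fun z => logCutoff δ (φ z.1 z.2) * f z) =ᶠ[𝓝 z] fun _ => 0 := by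
    have := (hφ.continuous.continuousAt (x := z)).eventually (logCutoff_eventually_eq_zero hδ h)
    filter_upwards [this] with y hy
    simp [hy]
  rw [h1.fderiv_eq]
  simp

/-- With `Ψ` the cutoff composed with `φ` and `Ψ'` its derivative there, the left side equals `Ψ' (f
D_tφ - X · ∂φ) + Ψ (D_t f + f div V - div X)`. Kinematic condition and tangency bound the first
bracket by `(A² + A) |φ|`, which the logarithmic cutoff turns into `O(δ)`; the second is governed by
`hineq` and `div V = 0`. -/
lemma logCutoff_flux_le {f : ℝ × Space n → ℝ} {V X : ℝ × Space n → Space n} {a A C : ℝ}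
    (hC : ∀ s, |deriv (logCutoff δ) s| * |s| ≤ C * δ) (hδ : 0 < δ) (hC0 : 0 ≤ C) (hA : 0 ≤ A)
    (hφ : ContDiff ℝ 1 fun z : ℝ × Space n => φ z.1 z.2) {z : ℝ × Space n}
    (hf : DifferentiableAt ℝ f z)
    (hV : ∀ i, DifferentiableAt ℝ (fun y => V y i) z)
    (hX : ∀ i, DifferentiableAt ℝ (fun y => X y i) z)
    (hdiv : ∑ i, spaceDeriv (basisVec i) (fun y => V y i) z = 0)
    (hkin : |flowDeriv (V z) (fun z : ℝ × Space n => φ z.1 z.2) z| ≤ A * |φ z.1 z.2|)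
    (htan : |spaceDeriv (X z) (fun z : ℝ × Space n => φ z.1 z.2) z| ≤ A * |φ z.1 z.2|)
    (hfA : |f z| ≤ A)
    (hineq : flowDeriv (V z) f z ≤ ∑ i, spaceDeriv (basisVec i) (fun y => X y i) z + a * f z) :
    fderiv ℝ (fun z => logCutoff δ (φ z.1 z.2) * f z) z (1, 0)
      + ∑ i, spaceDeriv (basisVec i)
          (fun z => logCutoff δ (φ z.1 z.2) * (f z * V z i - X z i)) z
      ≤ a * (logCutoff δ (φ z.1 z.2) * f z) + C * δ * (A * A + A) := by
  set Φ : ℝ × Space n → ℝ := fun z => φ z.1 z.2 with hΦ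
  set Ψ := logCutoff δ (φ z.1 z.2) with hΨ
  set Ψ' := deriv (logCutoff δ) (φ z.1 z.2) with hΨ'
  have hW : ∀ i, spaceDeriv (basisVec i)
        (fun z => logCutoff δ (φ z.1 z.2) * (f z * V z i - X z i)) z
      = Ψ' * (f z * (V z i * spaceDeriv (basisVec i) Φ z) - X z i * spaceDeriv (basisVec i) Φ z)
        + Ψ * (V z i * spaceDeriv (basisVec i) f z
          + f z * spaceDeriv (basisVec i) (fun y => V y i) z
          - spaceDeriv (basisVec i) (fun y => X y i) z) := by
    intro i
    have h1 : HasFDerivAt (fun z => f z * V z i - X z i) _ z :=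
      (hf.hasFDerivAt.mul (hV i).hasFDerivAt).sub (hX i).hasFDerivAt
    rw [spaceDeriv, fderiv_logCutoff_mul hδ hφ h1.differentiableAt]
    have h2 : fderiv ℝ (fun z => f z * V z i - X z i) z = _ := h1.fderiv
    rw [h2]
    simp only [sub_apply, add_apply, smul_apply, smul_eq_mul, spaceDeriv]
    ring
  have hsum : ∑ i, spaceDeriv (basisVec i)
        (fun z => logCutoff δ (φ z.1 z.2) * (f z * V z i - X z i)) z
      = Ψ' * (f z * spaceDeriv (V z) Φ z - spaceDeriv (X z) Φ z)
        + Ψ * (spaceDeriv (V z) f z + f z * ∑ i, spaceDeriv (basisVec i) (fun y => V y i) z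
          - ∑ i, spaceDeriv (basisVec i) (fun y => X y i) z) := by
    rw [Finset.sum_congr rfl fun i _ => hW i, spaceDeriv_eq_sum (V z) Φ,
      spaceDeriv_eq_sum (X z) Φ, spaceDeriv_eq_sum (V z) f]
    simp only [Finset.sum_add_distrib, Finset.sum_sub_distrib, ← Finset.mul_sum]
  rw [hsum, hdiv, fderiv_logCutoff_mul hδ hφ hf]
  rw [flowDeriv_eq_add] at hineq hkin
  have hΨ0 : 0 ≤ Ψ := logCutoff_nonneg _ _
  have h1 := mul_le_mul_of_nonneg_left hineq hΨ0
  have h2 : |Ψ' * ((fderiv ℝ Φ z (1, 0) + spaceDeriv (V z) Φ z) * f z - spaceDeriv (X z) Φ z)|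
      ≤ C * δ * (A * A + A) := by
    rw [abs_mul]
    have h3 : |(fderiv ℝ Φ z (1, 0) + spaceDeriv (V z) Φ z) * f z - spaceDeriv (X z) Φ z|
        ≤ |φ z.1 z.2| * (A * A + A) := by
      refine (abs_sub _ _).trans ?_
      rw [abs_mul]
      have := mul_le_mul hkin hfA (abs_nonneg _) (by positivity)
      nlinarith
    calc |Ψ'| * _ ≤ |Ψ'| * (|φ z.1 z.2| * (A * A + A)) :=
          mul_le_mul_of_nonneg_left h3 (abs_nonneg _)
      _ = |Ψ'| * |φ z.1 z.2| * (A * A + A) := by ring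
      _ ≤ _ := mul_le_mul_of_nonneg_right (hC _) (by positivity)
  have h4 := (le_abs_self _).trans h2
  nlinarith

/-- The integral over the moving domain, cut off near the boundary. -/
lemma hasDerivAt_cutoff_integral_le {f : ℝ × Space n → ℝ} {V X : ℝ × Space n → Space n}
    {a A C R : ℝ}
    (hC : ∀ s, |deriv (logCutoff δ) s| * |s| ≤ C * δ) (hδ : 0 < δ) (hC0 : 0 ≤ C) (hA : 0 ≤ A)
    (hφ : ContDiff ℝ 1 fun z : ℝ × Space n => φ z.1 z.2)
    (hR : ∀ z ∈ fluidRegion T φ, z.2 ∈ Metric.closedBall (0 : Space n) R)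
    (hf : ∀ z ∈ openFluidRegion T φ, ContDiffAt ℝ 1 f z)
    (hV : ∀ z ∈ openFluidRegion T φ, ∀ i, ContDiffAt ℝ 1 (fun y => V y i) z)
    (hX : ∀ z ∈ openFluidRegion T φ, ∀ i, ContDiffAt ℝ 1 (fun y => X y i) z)
    (hdiv : ∀ z ∈ openFluidRegion T φ, ∑ i, spaceDeriv (basisVec i) (fun y => V y i) z = 0)
    (hkin : ∀ z ∈ openFluidRegion T φ,
      |flowDeriv (V z) (fun z : ℝ × Space n => φ z.1 z.2) z| ≤ A * |φ z.1 z.2|)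
    (htan : ∀ z ∈ openFluidRegion T φ,
      |spaceDeriv (X z) (fun z : ℝ × Space n => φ z.1 z.2) z| ≤ A * |φ z.1 z.2|)
    (hfA : ∀ z ∈ fluidRegion T φ, |f z| ≤ A)
    (hineq : ∀ z ∈ openFluidRegion T φ,
      flowDeriv (V z) f z ≤ ∑ i, spaceDeriv (basisVec i) (fun y => X y i) z + a * f z)
    {t : ℝ} (ht : t ∈ Ioo 0 T) :
    ∃ F' : ℝ, HasDerivAt (fun s => ∫ x, logCutoff δ (φ s x) * f (s, x)) F' t ∧
      F' ≤ a * (∫ x, logCutoff δ (φ t x) * f (t, x))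
        + C * δ * (A * A + A) * volume.real (Metric.closedBall (0 : Space n) R) := by
  set U : ℝ × Space n → ℝ := fun z => logCutoff δ (φ z.1 z.2) * f z with hUdef
  set W : Fin n → ℝ × Space n → ℝ :=
    fun i z => logCutoff δ (φ z.1 z.2) * (f z * V z i - X z i) with hWdef
  have hcut : ∀ g : ℝ × Space n → ℝ, ∀ z : ℝ × Space n, z.1 ∈ Ioo 0 T →
      z.2 ∉ Metric.closedBall (0 : Space n) R → logCutoff δ (φ z.1 z.2) * g z = 0 := by
    intro g z hz hzR
    have : 0 ≤ φ z.1 z.2 := by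
      by_contra h
      exact hzR (hR z ⟨Ioo_subset_Icc_self hz, not_le.1 h⟩)
    rw [(logCutoff_eventually_eq_zero hδ this).self_of_nhds, zero_mul]
  have hU : ∀ z : ℝ × Space n, z.1 ∈ Ioo 0 T → ContDiffAt ℝ 1 U z := fun z hz =>
    contDiffAt_logCutoff_mul hδ hφ hf hz
  have hW : ∀ i, ∀ z : ℝ × Space n, z.1 ∈ Ioo 0 T → ContDiffAt ℝ 1 (W i) z := fun i z hz =>
    contDiffAt_logCutoff_mul hδ hφ (f := fun z => f z * V z i - X z i)
      (fun y hy => ((hf y hy).mul (hV y hy i)).sub (hX y hy i)) hz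
  refine ⟨_, hasDerivAt_integral_slice hU (hcut f) ht, ?_⟩
  have hWs : ∀ i, ContDiff ℝ 1 fun x => W i (t, x) := fun i => contDiff_slice fun x => hW i (t, x) ht
  have hWc : ∀ i, HasCompactSupport fun x => W i (t, x) := fun i =>
    hasCompactSupport_of_ball fun x hx => hcut (fun z => f z * V z i - X z i) (t, x) ht hx
  have hWd : ∀ i x, fderiv ℝ (fun x => W i (t, x)) x (basisVec i)
      = spaceDeriv (basisVec i) (W i) (t, x) := fun i x =>
    fderiv_slice ((hW i (t, x) ht).differentiableAt one_ne_zero) _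
  have hWint : ∀ i, Integrable fun x => spaceDeriv (basisVec i) (W i) (t, x) := fun i => by
    simp_rw [← hWd]
    exact (((hWs i).continuous_fderiv one_ne_zero).clm_apply
      continuous_const).integrable_of_hasCompactSupport ((hWc i).fderiv_apply ℝ _)
  have hW0 : ∀ i, ∫ x, spaceDeriv (basisVec i) (W i) (t, x) = 0 := fun i => by
    simp_rw [← hWd]
    exact integral_fderiv_apply_eq_zero (hWs i) (hWc i) _
  have hUs : ContDiff ℝ 1 fun x => U (t, x) := contDiff_slice fun x => hU (t, x) ht
  have hUint : Integrable fun x => U (t, x) := hUs.continuous.integrable_of_hasCompactSupport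
    (hasCompactSupport_of_ball fun x hx => hcut f (t, x) ht hx)
  have hz0 : ∀ (g : ℝ × Space n → ℝ), (∀ z : ℝ × Space n, z.1 ∈ Ioo 0 T →
      z.2 ∉ Metric.closedBall (0 : Space n) R → g z = 0) →
      ∀ x, x ∉ Metric.closedBall (0 : Space n) R → fderiv ℝ g (t, x) = 0 := by
    intro g hg x hx
    have : g =ᶠ[𝓝 (t, x)] fun _ => 0 := by
      have h1 : {z : ℝ × Space n | z.1 ∈ Ioo 0 T ∧ z.2 ∉ Metric.closedBall (0 : Space n) R}
          ∈ 𝓝 (t, x) :=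
        ((isOpen_Ioo.preimage continuous_fst).inter
          (Metric.isClosed_closedBall.isOpen_compl.preimage continuous_snd)).mem_nhds ⟨ht, hx⟩
      filter_upwards [h1] with z hz using hg z hz.1 hz.2
    rw [this.fderiv_eq]
    simp
  have hUt : Integrable fun x => fderiv ℝ U (t, x) (1, 0) := by
    refine Continuous.integrable_of_hasCompactSupport
      (continuous_iff_continuousAt.2 fun x => ?_) (hasCompactSupport_of_ball (R := R) fun x hx => ?_)
    · have h1 : ContinuousAt (fderiv ℝ U) (t, x) :=
        ((hU (t, x) ht).fderiv_right (m := 0) (by simp)).continuousAt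
      have h2 : ContinuousAt (fun z => fderiv ℝ U z (1, 0)) (t, x) :=
        h1.clm_apply continuousAt_const
      exact h2.comp (f := fun y => (t, y)) (Continuous.prodMk_right t).continuousAt
    · rw [hz0 U (hcut f) x hx]
      rfl
  have hball : Integrable ((Metric.closedBall (0 : Space n) R).indicator
      fun _ => C * δ * (A * A + A)) :=
    (integrable_indicator_iff Metric.isClosed_closedBall.measurableSet).2
      (integrableOn_const (isCompact_closedBall _ _).measure_lt_top.ne)
  have hsumint : Integrable fun x => ∑ i, spaceDeriv (basisVec i) (W i) (t, x) :=
    integrable_finsetSum _ fun i _ => hWint i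
  have hle : ∀ x, fderiv ℝ U (t, x) (1, 0) + ∑ i, spaceDeriv (basisVec i) (W i) (t, x)
      ≤ a * U (t, x) + (Metric.closedBall (0 : Space n) R).indicator
        (fun _ => C * δ * (A * A + A)) x := by
    intro x
    rcases lt_or_ge (φ t x) 0 with h | h
    · have hz : ((t, x) : ℝ × Space n) ∈ openFluidRegion T φ := ⟨ht, h⟩
      have hzc := openFluidRegion_subset _ _ hz
      rw [indicator_of_mem (hR _ hzc)]
      exact logCutoff_flux_le hC hδ hC0 hA hφ ((hf _ hz).differentiableAt one_ne_zero)
        (fun i => (hV _ hz i).differentiableAt one_ne_zero)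
        (fun i => (hX _ hz i).differentiableAt one_ne_zero)
        (hdiv _ hz) (hkin _ hz) (htan _ hz) (hfA _ hzc) (hineq _ hz)
    · have h1 : fderiv ℝ U (t, x) = 0 := fderiv_logCutoff_mul_of_nonneg hδ hφ h
      have h2 : ∀ i, spaceDeriv (basisVec i) (W i) (t, x) = 0 := fun i => by
        have : fderiv ℝ (W i) (t, x) = 0 :=
          fderiv_logCutoff_mul_of_nonneg (f := fun z => f z * V z i - X z i) hδ hφ h
        rw [spaceDeriv, this]
        rfl
      have h3 : U (t, x) = 0 := by
        simp [hUdef, (logCutoff_eventually_eq_zero hδ h).self_of_nhds]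
      rw [h1, h3]
      simp only [h2, Finset.sum_const_zero, _root_.zero_apply, mul_zero, zero_add]
      exact indicator_nonneg (fun _ _ => by positivity) _
  -- The added divergence is that of a compactly supported field, so it does not change the integral
  -- but makes the pointwise bound applicable.
  calc ∫ x, fderiv ℝ U (t, x) (1, 0)
      = ∫ x, (fderiv ℝ U (t, x) (1, 0) + ∑ i, spaceDeriv (basisVec i) (W i) (t, x)) := by
        rw [integral_add hUt hsumint, integral_finsetSum _ fun i _ => hWint i]
        simp [hW0]
    _ ≤ ∫ x, (a * U (t, x) + (Metric.closedBall (0 : Space n) R).indicator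
        (fun _ => C * δ * (A * A + A)) x) :=
        integral_mono (hUt.add hsumint) ((hUint.const_mul a).add hball) hle
    _ = _ := by
        rw [integral_add (hUint.const_mul a) hball, integral_const_mul,
          integral_indicator Metric.isClosed_closedBall.measurableSet]
        simp only [integral_const, measureReal_restrict_apply_univ, smul_eq_mul, hUdef]
        ring

lemma cutoff_slice_bound {f : ℝ × Space n → ℝ} {A R : ℝ} (hδ : 0 < δ) (hA : 0 ≤ A)
    (hφ : ContDiff ℝ 1 fun z : ℝ × Space n => φ z.1 z.2)
    (hR : ∀ z ∈ fluidRegion T φ, z.2 ∈ Metric.closedBall (0 : Space n) R)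
    (hfc : ContinuousOn f (fluidRegion T φ)) (hfA : ∀ z ∈ fluidRegion T φ, |f z| ≤ A)
    {t : ℝ} (ht : t ∈ Icc 0 T) :
    AEStronglyMeasurable (fun x => logCutoff δ (φ t x) * f (t, x)) ∧
      ∀ x, ‖logCutoff δ (φ t x) * f (t, x)‖
        ≤ (Metric.closedBall (0 : Space n) R).indicator (fun _ => A) x := by
  constructor
  · refine Continuous.aestronglyMeasurable ?_
    have h1 := continuousOn_logCutoff_mul (T := T) hδ hφ hfc
    have h2 : ContinuousOn (fun x : Space n => ((t, x) : ℝ × Space n)) univ :=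
      (Continuous.prodMk_right t).continuousOn
    exact continuousOn_univ.1 (h1.comp h2 fun x _ => ⟨ht, mem_univ _⟩)
  · intro x
    rcases lt_or_ge (φ t x) 0 with h | h
    · have hz : ((t, x) : ℝ × Space n) ∈ fluidRegion T φ := ⟨ht, h⟩
      rw [indicator_of_mem (hR _ hz), norm_mul, Real.norm_eq_abs, Real.norm_eq_abs,
        abs_of_nonneg (logCutoff_nonneg _ _)]
      calc _ ≤ 1 * |f (t, x)| :=
            mul_le_mul_of_nonneg_right (logCutoff_le_one _ _) (abs_nonneg _)
        _ ≤ A := by rw [one_mul]; exact hfA _ hz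
    · rw [(logCutoff_eventually_eq_zero hδ h).self_of_nhds, zero_mul, norm_zero]
      exact indicator_nonneg (fun _ _ => hA) _

/-- Transport theorem in inequality form: if `D_t f ≤ div X + a f` in the moving domain, where `D_t`
is the derivative along a divergence free field `V` that moves the domain, and `X` is tangential
to the boundary, then `∫ f` grows at most like `exp (a t)`. -/
theorem integral_dom_le {f : ℝ × Space n → ℝ} {V X : ℝ × Space n → Space n} {a A R : ℝ}
    (ha : 0 ≤ a) (hA : 0 ≤ A)
    (hφ : ContDiff ℝ 1 fun z : ℝ × Space n => φ z.1 z.2)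
    (hR : ∀ z ∈ fluidRegion T φ, z.2 ∈ Metric.closedBall (0 : Space n) R)
    (hfc : ContinuousOn f (fluidRegion T φ))
    (hf : ∀ z ∈ openFluidRegion T φ, ContDiffAt ℝ 1 f z)
    (hV : ∀ z ∈ openFluidRegion T φ, ∀ i, ContDiffAt ℝ 1 (fun y => V y i) z)
    (hX : ∀ z ∈ openFluidRegion T φ, ∀ i, ContDiffAt ℝ 1 (fun y => X y i) z)
    (hdiv : ∀ z ∈ openFluidRegion T φ, ∑ i, spaceDeriv (basisVec i) (fun y => V y i) z = 0)
    (hkin : ∀ z ∈ openFluidRegion T φ,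
      |flowDeriv (V z) (fun z : ℝ × Space n => φ z.1 z.2) z| ≤ A * |φ z.1 z.2|)
    (htan : ∀ z ∈ openFluidRegion T φ,
      |spaceDeriv (X z) (fun z : ℝ × Space n => φ z.1 z.2) z| ≤ A * |φ z.1 z.2|)
    (hfA : ∀ z ∈ fluidRegion T φ, |f z| ≤ A)
    (hineq : ∀ z ∈ openFluidRegion T φ,
      flowDeriv (V z) f z ≤ ∑ i, spaceDeriv (basisVec i) (fun y => X y i) z + a * f z)
    {t : ℝ} (ht : t ∈ Icc 0 T) :
    ∫ x in dom φ t, f (t, x) ≤ Real.exp (a * t) * ∫ x in dom φ 0, f (0, x) := by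
  obtain ⟨C, hC0, hC⟩ := exists_abs_mul_deriv_logCutoff_le
  have hT : (0 : ℝ) ∈ Icc 0 T := ⟨le_rfl, ht.1.trans ht.2⟩
  have hball : Integrable ((Metric.closedBall (0 : Space n) R).indicator fun _ => A) :=
    (integrable_indicator_iff Metric.isClosed_closedBall.measurableSet).2
      (integrableOn_const (isCompact_closedBall _ _).measure_lt_top.ne)
  set F : ℝ → ℝ → ℝ := fun δ s => ∫ x, logCutoff δ (φ s x) * f (s, x) with hF
  set E := C * (A * A + A) * volume.real (Metric.closedBall (0 : Space n) R) with hE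
  have hE0 : 0 ≤ E := by positivity
  have hmono : ∀ δ > 0, F δ t ≤ Real.exp (a * t) * (F δ 0 + E * δ * t) := by
    intro δ hδ
    have hcont : ContinuousOn (F δ) (Icc 0 T) := by
      intro s hs
      refine continuousWithinAt_of_dominated
        (bound := (Metric.closedBall (0 : Space n) R).indicator fun _ => A) ?_ ?_ hball ?_
      · filter_upwards [self_mem_nhdsWithin] with r hr
          using (cutoff_slice_bound hδ hA hφ hR hfc hfA hr).1
      · filter_upwards [self_mem_nhdsWithin] with r hr
          using Eventually.of_forall (cutoff_slice_bound hδ hA hφ hR hfc hfA hr).2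
      · refine Eventually.of_forall fun x => ?_
        have h1 := continuousOn_logCutoff_mul (T := T) hδ hφ hfc
        have h2 : ContinuousOn (fun s : ℝ => ((s, x) : ℝ × Space n)) (Icc 0 T) :=
          (Continuous.prodMk_left x).continuousOn
        exact (h1.comp h2 fun r hr => ⟨hr, mem_univ _⟩) s hs
    have hderiv : ∀ s ∈ Ioo 0 T, ∃ F' : ℝ, HasDerivAt (F δ) F' s ∧ F' ≤ a * F δ s + E * δ := by
      intro s hs
      obtain ⟨F', h1, h2⟩ := hasDerivAt_cutoff_integral_le (hC δ hδ) hδ hC0 hA hφ hR hf hV hX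
        hdiv hkin htan hfA hineq hs
      refine ⟨F', h1, h2.trans_eq ?_⟩
      rw [hE]
      ring
    -- Gronwall with an integrating factor; since `exp (-a s) ≤ 1`, the inhomogeneous term is
    -- absorbed by subtracting the linear function `E δ s`.
    have hG : ∀ s ∈ Ioo 0 T, ∃ G' : ℝ,
        HasDerivAt (fun s => Real.exp (-(a * s)) * F δ s - E * δ * s) G' s ∧ G' ≤ 0 := by
      intro s hs
      obtain ⟨F', h1, h2⟩ := hderiv s hs
      have h3 : HasDerivAt (fun s => Real.exp (-(a * s))) (Real.exp (-(a * s)) * (-(a * 1))) s :=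
        (((hasDerivAt_id s).const_mul a).neg).exp
      refine ⟨_, (h3.mul h1).sub ((hasDerivAt_id s).const_mul (E * δ)), ?_⟩
      have h4 : Real.exp (-(a * s)) ≤ 1 :=
        Real.exp_le_one_iff.2 (by have := mul_nonneg ha hs.1.le; linarith)
      have h5 := mul_le_mul_of_nonneg_left h2 (Real.exp_pos (-(a * s))).le
      have h6 := mul_le_mul_of_nonneg_right h4 (mul_nonneg hE0 hδ.le)
      nlinarith
    have hanti : AntitoneOn (fun s => Real.exp (-(a * s)) * F δ s - E * δ * s) (Icc 0 T) := by
      refine antitoneOn_of_deriv_nonpos (convex_Icc 0 T) ?_ ?_ ?_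
      · exact ((by fun_prop : Continuous fun s : ℝ => Real.exp (-(a * s))).continuousOn.mul
          hcont).sub (by fun_prop)
      · intro s hs
        rw [interior_Icc] at hs
        obtain ⟨G', h1, -⟩ := hG s hs
        exact h1.differentiableAt.differentiableWithinAt
      · intro s hs
        rw [interior_Icc] at hs
        obtain ⟨G', h1, h2⟩ := hG s hs
        rwa [h1.deriv]
    have h1 := hanti hT ht ht.1
    simp only [mul_zero, neg_zero, Real.exp_zero, one_mul, sub_zero] at h1
    have h2 : Real.exp (-(a * t)) * F δ t ≤ F δ 0 + E * δ * t := by linarith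
    have h3 := mul_le_mul_of_nonneg_left h2 (Real.exp_pos (a * t)).le
    rwa [← mul_assoc, ← Real.exp_add, add_neg_cancel, Real.exp_zero, one_mul] at h3
  -- Removal of the cutoff by dominated convergence, with the bound `A` on a fixed ball as majorant.
  have hlim : ∀ s ∈ Icc 0 T, Tendsto (fun δ => F δ s) (𝓝[>] 0) (𝓝 (∫ x in dom φ s, f (s, x))) := by
    intro s hs
    have hm : MeasurableSet (dom φ s) := (isOpen_dom hφ.continuous s).measurableSet
    rw [← integral_indicator hm]
    refine tendsto_integral_filter_of_dominated_convergence
      ((Metric.closedBall (0 : Space n) R).indicator fun _ => A) ?_ ?_ hball ?_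
    · filter_upwards [self_mem_nhdsWithin] with δ hδ
        using (cutoff_slice_bound hδ hA hφ hR hfc hfA hs).1
    · filter_upwards [self_mem_nhdsWithin] with δ hδ
        using Eventually.of_forall (cutoff_slice_bound hδ hA hφ hR hfc hfA hs).2
    · refine Eventually.of_forall fun x => ?_
      by_cases hx : x ∈ dom φ s
      · rw [indicator_of_mem hx]
        simpa using (tendsto_logCutoff hx).mul_const (f (s, x))
      · rw [indicator_of_notMem hx]
        refine Tendsto.congr' ?_ tendsto_const_nhds
        filter_upwards [self_mem_nhdsWithin] with δ hδ
        rw [(logCutoff_eventually_eq_zero hδ (not_lt.1 hx)).self_of_nhds, zero_mul]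
  have hrhs : Tendsto (fun δ => Real.exp (a * t) * (F δ 0 + E * δ * t)) (𝓝[>] 0)
      (𝓝 (Real.exp (a * t) * ((∫ x in dom φ 0, f (0, x)) + E * 0 * t))) := by
    refine ((hlim 0 hT).add ?_).const_mul _
    exact ((by fun_prop : Continuous fun δ : ℝ => E * δ * t).tendsto 0).mono_left
      nhdsWithin_le_nhds
  have := le_of_tendsto_of_tendsto (hlim t ht) hrhs (by
    filter_upwards [self_mem_nhdsWithin] with δ hδ using hmono δ hδ)
  simpa using this

end transport

/-! ### Distance to the frontier of an open set. -/

section distance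

/-- Off the frontier the space is the disjoint union of the open sets `s` and `(closure s)ᶜ`, so a
connected set lies in one of them. -/
lemma isPreconnected_subset_of_disjoint_frontier {E : Type*} [TopologicalSpace E] {s v : Set E}
    (hv : IsPreconnected v) (hs : IsOpen s)
    (hd : Disjoint v (frontier s)) (hne : (v ∩ s).Nonempty) : v ⊆ s := by
  refine hv.subset_left_of_subset_union hs (isClosed_closure (s := s)).isOpen_compl
    (disjoint_compl_right.mono_left subset_closure) (fun z hz => ?_) hne
  by_cases h : z ∈ closure s
  · left
    by_contra h'
    exact disjoint_left.1 hd hz (by rw [hs.frontier_eq]; exact ⟨h, h'⟩)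
  · exact Or.inr h

variable {E : Type*} [NormedAddCommGroup E] [NormedSpace ℝ E] {s : Set E} {x y : E}

lemma ball_infDist_frontier_subset (hs : IsOpen s) (hx : x ∈ s) :
    Metric.ball x (Metric.infDist x (frontier s)) ⊆ s := by
  rcases (Metric.infDist_nonneg (x := x) (s := frontier s)).eq_or_lt with h | h
  · rw [← h, Metric.ball_zero]
    exact empty_subset _
  · exact isPreconnected_subset_of_disjoint_frontier (convex_ball _ _).isPreconnected hs
      (Metric.disjoint_ball_infDist (s := frontier s)) ⟨x, Metric.mem_ball_self h, hx⟩

lemma infDist_frontier_le (hs : IsOpen s) (hx : x ∈ s) (hy : y ∉ s) :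
    Metric.infDist x (frontier s) ≤ dist x y := by
  by_contra! h
  exact hy (ball_infDist_frontier_subset hs hx (by rwa [Metric.mem_ball, dist_comm]))

lemma closedBall_infDist_frontier_subset (hs : IsOpen s) (hx : x ∈ s) :
    Metric.closedBall x (Metric.infDist x (frontier s)) ⊆ closure s := by
  rcases (Metric.infDist_nonneg (x := x) (s := frontier s)).eq_or_lt with h | h
  · rw [← h, Metric.closedBall_zero]
    exact singleton_subset_iff.2 (subset_closure hx)
  · rw [← closure_ball _ h.ne']
    exact closure_mono (ball_infDist_frontier_subset hs hx)

end distance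

lemma eventually_lt_line {E : Type*} [NormedAddCommGroup E] [NormedSpace ℝ E] {f : E → ℝ} {x w : E}
    (hf : DifferentiableAt ℝ f x) (hw : 0 < fderiv ℝ f x w) :
    ∀ᶠ s : ℝ in 𝓝[>] 0, f x < f (x + s • w) := by
  have h1 : HasDerivAt (fun s : ℝ => f (x + s • w)) (fderiv ℝ f x w) 0 :=
    hf.hasFDerivAt.hasLineDerivAt w
  have h2 := (hasDerivAt_iff_tendsto_slope.1 h1).eventually (lt_mem_nhds hw)
  have h3 : 𝓝[>] (0 : ℝ) ≤ 𝓝[≠] 0 := nhdsWithin_mono _ fun s hs => ne_of_gt hs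
  filter_upwards [h3 h2, self_mem_nhdsWithin] with s hs hs0
  rw [slope_def_field] at hs
  simp only [zero_smul, add_zero, sub_zero] at hs
  have := (div_pos_iff_of_pos_right (mem_Ioi.1 hs0)).1 hs
  linarith

lemma eventually_line_lt {E : Type*} [NormedAddCommGroup E] [NormedSpace ℝ E] {f : E → ℝ} {x w : E}
    (hf : DifferentiableAt ℝ f x) (hw : fderiv ℝ f x w < 0) :
    ∀ᶠ s : ℝ in 𝓝[>] 0, f (x + s • w) < f x := by
  have := eventually_lt_line hf.neg (w := w) (by rw [fderiv_neg]; simpa using hw)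
  filter_upwards [this] with s hs
  simpa using hs

/-! ### The regular level set: closure, compactness and comparison of `d` with `|φ|`. -/

/-- The closure of the region occupied by the fluid. -/
def closedRegion {n : ℕ} (T : ℝ) (φ : ℝ → Space n → ℝ) : Set (ℝ × Space n) :=
  {z | z.1 ∈ Icc 0 T ∧ φ z.1 z.2 ≤ 0}

lemma fluidRegion_subset {n : ℕ} (T : ℝ) (φ : ℝ → Space n → ℝ) :
    fluidRegion T φ ⊆ closedRegion T φ := fun _ hz => ⟨hz.1, hz.2.le⟩

namespace IsSmoothSolution

variable {n : ℕ} {T ς : ℝ} {φ : ℝ → Space n → ℝ} {v B : ℝ → Space n → Space n}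
  {p : ℝ → Space n → ℝ} {t : ℝ}

lemma continuous_phi (h : IsSmoothSolution T ς φ v B p) :
    Continuous fun z : ℝ × Space n => φ z.1 z.2 := h.smooth_dom.continuous

lemma contDiff_slice_phi (h : IsSmoothSolution T ς φ v B p) (t : ℝ) : ContDiff ℝ ∞ (φ t) :=
  h.smooth_dom.comp (contDiff_prodMk_right t)

lemma differentiable_slice_phi (h : IsSmoothSolution T ς φ v B p) (t : ℝ) :
    Differentiable ℝ (φ t) := (h.contDiff_slice_phi t).differentiable (by simp)

lemma isOpen_dom (h : IsSmoothSolution T ς φ v B p) (t : ℝ) : IsOpen (dom φ t) :=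
  MHD.isOpen_dom h.continuous_phi t

/-- Since `∂φ ≠ 0` where `φ = 0`, moving from such a point against the gradient enters `φ < 0`, so
every zero of `φ` is a limit of points of the domain. -/
lemma closure_dom (h : IsSmoothSolution T ς φ v B p) (ht : t ∈ Icc 0 T) :
    closure (dom φ t) = {x | φ t x ≤ 0} := by
  have hc : Continuous (φ t) := (h.contDiff_slice_phi t).continuous
  refine subset_antisymm (closure_minimal (fun x hx => show φ t x ≤ 0 from (show φ t x < 0 from hx).le)
    (isClosed_le hc continuous_const)) fun x hx => ?_
  rcases (show φ t x ≤ 0 from hx).lt_or_eq with h0 | h0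
  · exact subset_closure h0
  · have hg := h.regular t ht x h0
    have h1 : fderiv ℝ (φ t) x (-gradient (φ t) x) < 0 := by
      rw [map_neg, ← inner_gradient (h.differentiable_slice_phi t x), real_inner_self_eq_norm_sq]
      have := norm_pos_iff.2 hg
      simp only [Left.neg_neg_iff]
      positivity
    have h2 := eventually_line_lt (h.differentiable_slice_phi t x) h1
    have h3 : Tendsto (fun s : ℝ => x + s • (-gradient (φ t) x)) (𝓝[>] 0) (𝓝 x) := by
      have : Continuous fun s : ℝ => x + s • (-gradient (φ t) x) := by fun_prop
      simpa using (this.tendsto 0).mono_left (nhdsWithin_le_nhds (s := Ioi 0))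
    refine mem_closure_of_tendsto h3 ?_
    filter_upwards [h2] with s hs
    rwa [h0] at hs

lemma frontier_dom (h : IsSmoothSolution T ς φ v B p) (ht : t ∈ Icc 0 T) :
    frontier (dom φ t) = {x | φ t x = 0} := by
  rw [(h.isOpen_dom t).frontier_eq, h.closure_dom ht]
  ext x
  simp only [dom, Set.mem_sdiff, mem_ofPred_eq, not_lt]
  exact ⟨fun hx => le_antisymm hx.1 hx.2, fun hx => ⟨hx.le, hx.ge⟩⟩

lemma isCompact_frontier (h : IsSmoothSolution T ς φ v B p) (ht : t ∈ Icc 0 T) :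
    IsCompact (frontier (dom φ t)) := by
  obtain ⟨R, hR⟩ := h.bounded
  exact (Metric.isBounded_ball.subset (hR t ht)).isCompact_closure.of_isClosed_subset
    isClosed_frontier frontier_subset_closure

lemma frontier_nonempty [NeZero n] (h : IsSmoothSolution T ς φ v B p) (ht : t ∈ Icc 0 T)
    (hne : (dom φ t).Nonempty) : (frontier (dom φ t)).Nonempty := by
  obtain ⟨R, hR⟩ := h.bounded
  refine nonempty_frontier_iff.2 ⟨hne, fun hu => ?_⟩
  have h1 := Metric.isBounded_ball.subset (hR t ht)
  rw [hu] at h1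
  exact NormedSpace.unbounded_univ ℝ (Space n) h1

lemma exists_closedBall (h : IsSmoothSolution T ς φ v B p) :
    ∃ R : ℝ, ∀ z ∈ closedRegion T φ, z.2 ∈ Metric.closedBall (0 : Space n) R := by
  obtain ⟨R, hR⟩ := h.bounded
  refine ⟨R, fun z hz => ?_⟩
  have h1 : z.2 ∈ closure (dom φ z.1) := by
    rw [h.closure_dom hz.1]
    exact hz.2
  exact Metric.closure_ball_subset_closedBall (closure_mono (hR z.1 hz.1) h1)

lemma isCompact_closedRegion (h : IsSmoothSolution T ς φ v B p) :
    IsCompact (closedRegion T φ) := by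
  obtain ⟨R, hR⟩ := h.exists_closedBall
  refine (isCompact_Icc.prod (isCompact_closedBall (0 : Space n) R)).of_isClosed_subset ?_
    fun z hz => ⟨hz.1, hR z hz⟩
  exact (isClosed_Icc.preimage continuous_fst).inter (isClosed_le h.continuous_phi continuous_const)

lemma exists_bound (h : IsSmoothSolution T ς φ v B p) {g : ℝ × Space n → ℝ}
    (hg : ∀ z ∈ closedRegion T φ, ContinuousAt g z) :
    ∃ A : ℝ, 0 ≤ A ∧ ∀ z ∈ closedRegion T φ, |g z| ≤ A := by
  obtain ⟨A, hA⟩ := h.isCompact_closedRegion.exists_bound_of_continuousOn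
    fun z hz => (hg z hz).continuousWithinAt
  exact ⟨max A 0, le_max_right _ _, fun z hz => (hA z hz).trans (le_max_left _ _)⟩

/-- The point of the boundary nearest to a point of the fluid. -/
lemma exists_nearest [NeZero n] (h : IsSmoothSolution T ς φ v B p) (ht : t ∈ Icc 0 T)
    {x : Space n} (hx : x ∈ dom φ t) :
    ∃ y ∈ frontier (dom φ t), bdryDist φ t x = dist x y ∧
      Metric.closedBall x (dist x y) ⊆ closure (dom φ t) := by
  obtain ⟨y, hy, hxy⟩ := (h.isCompact_frontier ht).exists_infDist_eq_dist
    (h.frontier_nonempty ht ⟨x, hx⟩) x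
  exact ⟨y, hy, hxy, hxy ▸ closedBall_infDist_frontier_subset (h.isOpen_dom t) hx⟩

/-- Along the fixed direction `w = ∂φ(z₀)` the function `φ` increases near `z₀` at a rate at least
`c > 0`, for all nearby times. Starting at `z`, one has therefore left the domain after the
parameter `|φ| / c`, that is, after the length `‖w‖ |φ| / c`. -/
lemma eventually_bdryDist_le (h : IsSmoothSolution T ς φ v B p) {z₀ : ℝ × Space n}
    (hz₀ : z₀.1 ∈ Icc 0 T) (h0 : φ z₀.1 z₀.2 = 0) :
    ∃ A : ℝ, ∀ᶠ z in 𝓝 z₀, z ∈ fluidRegion T φ → bdryDist φ z.1 z.2 ≤ A * |φ z.1 z.2| := by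
  set Φ : ℝ × Space n → ℝ := fun z => φ z.1 z.2 with hΦ
  have hg := h.regular _ hz₀ _ h0
  set w := gradient (φ z₀.1) z₀.2 with hw
  have hd : ∀ z, DifferentiableAt ℝ Φ z := fun z => (h.smooth_dom.differentiable (by simp)) z
  have hc : Continuous fun z => spaceDeriv w Φ z :=
    (h.smooth_dom.continuous_fderiv (by simp)).clm_apply continuous_const
  have hpos : 0 < spaceDeriv w Φ z₀ := by
    have h1 : spaceDeriv w Φ (z₀.1, z₀.2) = fderiv ℝ (φ z₀.1) z₀.2 w :=
      (fderiv_slice (hd _) w).symm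
    rw [Prod.mk.eta] at h1
    rw [h1, ← inner_gradient (h.differentiable_slice_phi _ _), real_inner_self_eq_norm_sq]
    have := norm_pos_iff.2 hg
    positivity
  set c := spaceDeriv w Φ z₀ / 2 with hcdef
  have hcpos : 0 < c := by positivity
  have hev : ∀ᶠ z in 𝓝 z₀, c < spaceDeriv w Φ z :=
    hc.continuousAt.eventually (lt_mem_nhds (by linarith))
  obtain ⟨ρ, hρ, hball⟩ := Metric.eventually_nhds_iff.1 hev
  have hsmall : ∀ᶠ z in 𝓝 z₀, |Φ z| / c * ‖w‖ < ρ / 2 := by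
    have h1 : Continuous fun z => |Φ z| / c * ‖w‖ :=
      ((h.continuous_phi.abs).div_const c).mul continuous_const
    refine h1.continuousAt.eventually (gt_mem_nhds ?_)
    have : Φ z₀ = 0 := h0
    simp only [this]
    simpa using half_pos hρ
  refine ⟨‖w‖ / c, ?_⟩
  filter_upwards [hsmall, Metric.ball_mem_nhds z₀ (half_pos hρ)] with z hz1 hz2 hz
  obtain ⟨t, x⟩ := z
  have hneg : φ t x < 0 := hz.2
  set s := |φ t x| / c with hs
  have hs0 : 0 ≤ s := by positivity
  have hmem : ∀ τ ∈ Icc 0 s, c < spaceDeriv w Φ (t, x + τ • w) := by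
    intro τ hτ
    apply hball
    have h1 : dist ((t, x + τ • w) : ℝ × Space n) (t, x) < ρ / 2 := by
      rw [Prod.dist_eq]
      simp only [dist_self, dist_self_add_left, norm_smul, Real.norm_eq_abs]
      refine max_lt (by linarith) (lt_of_le_of_lt ?_ hz1)
      rw [abs_of_nonneg hτ.1]
      exact mul_le_mul_of_nonneg_right hτ.2 (norm_nonneg _)
    have h2 : dist ((t, x) : ℝ × Space n) z₀ < ρ / 2 := hz2
    linarith [dist_triangle ((t, x + τ • w) : ℝ × Space n) (t, x) z₀]
  have hder : ∀ τ : ℝ, HasDerivAt (fun τ : ℝ => φ t (x + τ • w)) (spaceDeriv w Φ (t, x + τ • w)) τ := by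
    intro τ
    have h1 := (hasFDerivAt_slice (hd (t, x + τ • w))).comp_hasDerivAt τ
      (((hasDerivAt_id τ).smul_const w).const_add x)
    simp only [id_eq, one_smul, ContinuousLinearMap.comp_apply, ContinuousLinearMap.inr_apply] at h1
    exact h1
  have hge : c * (s - 0) ≤ φ t (x + s • w) - φ t (x + (0 : ℝ) • w) := by
    refine (convex_Icc 0 s).mul_sub_le_image_sub_of_le_deriv (f := fun τ : ℝ => φ t (x + τ • w))
      (fun τ _ => (hder τ).continuousAt.continuousWithinAt)
      (fun τ _ => (hder τ).differentiableAt.differentiableWithinAt) (fun τ hτ => ?_) 0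
      (left_mem_Icc.2 hs0) s (right_mem_Icc.2 hs0) hs0
    rw [(hder τ).deriv]
    exact (hmem τ (interior_subset hτ)).le
  have hcs : c * s = -φ t x := by
    rw [hs, mul_div_cancel₀ _ hcpos.ne', abs_of_neg hneg]
  have hout : x + s • w ∉ dom φ t := by
    simp only [dom, mem_ofPred_eq, not_lt]
    simp only [zero_smul, add_zero, sub_zero, hcs] at hge
    linarith
  calc bdryDist φ t x ≤ dist x (x + s • w) := infDist_frontier_le (h.isOpen_dom t) hneg hout
    _ = ‖w‖ / c * |φ t x| := by
      rw [dist_self_add_right, norm_smul, Real.norm_eq_abs, abs_of_nonneg hs0, hs]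
      ring

/-- The distance to the boundary is controlled by the level set function. -/
lemma exists_bdryDist_le [NeZero n] (h : IsSmoothSolution T ς φ v B p) :
    ∃ A : ℝ, 0 ≤ A ∧ ∀ z ∈ fluidRegion T φ, bdryDist φ z.1 z.2 ≤ A * |φ z.1 z.2| := by
  obtain ⟨R, hR⟩ := h.exists_closedBall
  suffices H : ∃ A : ℝ, ∀ z ∈ closedRegion T φ, z ∈ fluidRegion T φ →
      bdryDist φ z.1 z.2 ≤ A * |φ z.1 z.2| by
    obtain ⟨A, hA⟩ := H
    refine ⟨max A 0, le_max_right _ _, fun z hz =>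
      (hA z (fluidRegion_subset _ _ hz) hz).trans ?_⟩
    exact mul_le_mul_of_nonneg_right (le_max_left _ _) (abs_nonneg _)
  -- Local constants are patched by compactness. Near interior points `|φ|` is bounded below and the
  -- distance is at most `2 R`; near boundary points the preceding local estimate applies.
  refine h.isCompact_closedRegion.induction_on (p := fun s => ∃ A : ℝ, ∀ z ∈ s,
    z ∈ fluidRegion T φ → bdryDist φ z.1 z.2 ≤ A * |φ z.1 z.2|) ⟨0, by simp⟩ ?_ ?_ ?_
  · rintro s u hsu ⟨A, hA⟩
    exact ⟨A, fun z hz => hA z (hsu hz)⟩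
  · rintro s u ⟨A, hA⟩ ⟨A', hA'⟩
    refine ⟨max A A', fun z hz hz' => ?_⟩
    rcases hz with hz | hz
    · exact (hA z hz hz').trans (mul_le_mul_of_nonneg_right (le_max_left _ _) (abs_nonneg _))
    · exact (hA' z hz hz').trans (mul_le_mul_of_nonneg_right (le_max_right _ _) (abs_nonneg _))
  · intro z₀ hz₀
    rcases hz₀.2.lt_or_eq with h0 | h0
    · have h1 : ∀ᶠ z : ℝ × Space n in 𝓝 z₀, φ z.1 z.2 < φ z₀.1 z₀.2 / 2 :=
        h.continuous_phi.continuousAt.eventually (gt_mem_nhds (by linarith))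
      refine ⟨{z | φ z.1 z.2 < φ z₀.1 z₀.2 / 2}, mem_nhdsWithin_of_mem_nhds h1,
        2 * R / (-φ z₀.1 z₀.2 / 2), fun z hz hzf => ?_⟩
      simp only [mem_ofPred_eq] at hz
      obtain ⟨y, hy, hxy, -⟩ := h.exists_nearest hzf.1 hzf.2
      have hyR : y ∈ Metric.closedBall (0 : Space n) R := hR (z.1, y) ⟨hzf.1, by
        rw [h.frontier_dom hzf.1] at hy
        exact le_of_eq hy⟩
      have hxR := hR z (fluidRegion_subset _ _ hzf)
      rw [mem_closedBall_zero_iff] at hyR hxR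
      have hd : bdryDist φ z.1 z.2 ≤ 2 * R := by
        rw [hxy, dist_eq_norm]
        linarith [norm_sub_le z.2 y]
      refine hd.trans ?_
      rw [div_mul_eq_mul_div, le_div_iff₀ (by linarith), abs_of_neg hzf.2]
      exact mul_le_mul_of_nonneg_left (by linarith) (by linarith [norm_nonneg y])
    · obtain ⟨A, hA⟩ := h.eventually_bdryDist_le hz₀.1 h0
      exact ⟨_, mem_nhdsWithin_of_mem_nhds hA, A, fun z hz => hz⟩

/-- Smooth functions are Lipschitz between points and their nearest boundary points. -/
lemma exists_lipschitz_nearest (h : IsSmoothSolution T ς φ v B p)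
    {g : ℝ × Space n → ℝ} (hg : ∀ z ∈ closedRegion T φ, ContDiffAt ℝ 1 g z) :
    ∃ L : ℝ, 0 ≤ L ∧ ∀ t ∈ Icc 0 T, ∀ x y : Space n,
      Metric.closedBall x (dist x y) ⊆ closure (dom φ t) → |g (t, x) - g (t, y)| ≤ L * dist x y := by
  have hb : ∃ L : ℝ, 0 ≤ L ∧ ∀ z ∈ closedRegion T φ, ‖fderiv ℝ g z‖ ≤ L := by
    obtain ⟨A, hA0, hA⟩ := h.exists_bound (g := fun z => ‖fderiv ℝ g z‖) fun z hz =>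
      (((hg z hz).fderiv_right (m := 0) (by simp)).continuousAt).norm
    exact ⟨A, hA0, fun z hz => (le_abs_self _).trans (hA z hz)⟩
  obtain ⟨L, hL0, hL⟩ := hb
  refine ⟨L, hL0, fun t ht x y hsub => ?_⟩
  -- The ball is convex and stays in the closed region, where the derivative of `g` is bounded; the
  -- mean value inequality needs no further information about the domain.
  have hmem : ∀ u ∈ Metric.closedBall x (dist x y), ((t, u) : ℝ × Space n) ∈ closedRegion T φ := by
    intro u hu
    have := hsub hu
    rw [h.closure_dom ht] at this
    exact ⟨ht, this⟩
  have hder : ∀ u ∈ Metric.closedBall x (dist x y), HasFDerivWithinAt (fun u => g (t, u))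
      ((fderiv ℝ g (t, u)).comp (ContinuousLinearMap.inr ℝ ℝ (Space n)))
      (Metric.closedBall x (dist x y)) u := fun u hu =>
    (hasFDerivAt_slice ((hg _ (hmem u hu)).differentiableAt one_ne_zero)).hasFDerivWithinAt
  have hnorm : ∀ u ∈ Metric.closedBall x (dist x y),
      ‖(fderiv ℝ g (t, u)).comp (ContinuousLinearMap.inr ℝ ℝ (Space n))‖ ≤ L := by
    intro u hu
    refine ContinuousLinearMap.opNorm_le_bound _ hL0 fun w => ?_
    calc ‖fderiv ℝ g (t, u) ((0 : ℝ), w)‖ ≤ ‖fderiv ℝ g (t, u)‖ * ‖((0 : ℝ), w)‖ :=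
          ContinuousLinearMap.le_opNorm _ _
      _ ≤ L * ‖w‖ := by
          have : ‖((0 : ℝ), w)‖ = ‖w‖ := by simp [Prod.norm_def]
          rw [this]
          exact mul_le_mul_of_nonneg_right (hL _ (hmem u hu)) (norm_nonneg _)
  have := (convex_closedBall x (dist x y)).norm_image_sub_le_of_norm_hasFDerivWithin_le hder hnorm
    (show y ∈ Metric.closedBall x (dist x y) by rw [Metric.mem_closedBall, dist_comm])
    (Metric.mem_closedBall_self dist_nonneg)
  rwa [Real.norm_eq_abs, ← dist_eq_norm x y] at this

/-- A smooth function vanishing on the boundary is controlled by the level set function. -/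
lemma exists_abs_le_of_vanish [NeZero n] (h : IsSmoothSolution T ς φ v B p)
    {g : ℝ × Space n → ℝ} {S : Set (ℝ × Space n)} (hS : S ⊆ fluidRegion T φ)
    (hg : ∀ z ∈ closedRegion T φ, ContDiffAt ℝ 1 g z)
    (h0 : ∀ z ∈ S, ∀ y ∈ frontier (dom φ z.1), g (z.1, y) = 0) :
    ∃ A : ℝ, 0 ≤ A ∧ ∀ z ∈ S, |g z| ≤ A * |φ z.1 z.2| := by
  obtain ⟨L, hL0, hL⟩ := h.exists_lipschitz_nearest hg
  obtain ⟨A, hA0, hA⟩ := h.exists_bdryDist_le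
  refine ⟨L * A, by positivity, fun z hz => ?_⟩
  obtain ⟨y, hy, hd, hsub⟩ := h.exists_nearest (hS hz).1 (hS hz).2
  have h1 := hL z.1 (hS hz).1 z.2 y hsub
  rw [h0 z hz y hy, sub_zero, ← hd] at h1
  exact h1.trans ((mul_le_mul_of_nonneg_left (hA z (hS hz)) hL0).trans_eq (by ring))

end IsSmoothSolution

/-! ### Lagrange multipliers and the second derivative test. -/

/-- Lagrange multipliers with a nondegenerate constraint. -/
lemma exists_eq_smul_of_isLocalExtrOn {E : Type*} [NormedAddCommGroup E] [NormedSpace ℝ E]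
    [CompleteSpace E] {f F : E → ℝ} {f' F' : E →L[ℝ] ℝ} {y : E}
    (hextr : IsLocalExtrOn F {x | f x = f y} y) (hf : HasStrictFDerivAt f f' y) (hf0 : f' ≠ 0)
    (hF : HasStrictFDerivAt F F' y) : ∃ c : ℝ, F' = c • f' := by
  obtain ⟨a, b, hab, hsum⟩ := hextr.exists_multipliers_of_hasStrictFDerivAt_1d hf hF
  have hb : b ≠ 0 := by
    rintro rfl
    have ha : a ≠ 0 := fun h => hab (by simp [h])
    rw [zero_smul, add_zero] at hsum
    exact hf0 ((smul_eq_zero.1 hsum).resolve_left ha)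
  refine ⟨-(a / b), ?_⟩
  have h1 : b • F' = -(a • f') := eq_neg_of_add_eq_zero_right hsum
  calc F' = b⁻¹ • b • F' := by rw [smul_smul, inv_mul_cancel₀ hb, one_smul]
    _ = _ := by
      rw [h1, smul_neg, smul_smul, inv_mul_eq_div]
      exact (neg_smul _ _).symm

/-- The second derivative at a local maximum is nonpositive. -/
lemma second_deriv_nonpos_of_isLocalMax {k k' : ℝ → ℝ} {k'' : ℝ} (hk : ∀ᶠ s in 𝓝 0, HasDerivAt k (k' s) s)
    (hk' : HasDerivAt k' k'' 0) (hmax : IsLocalMax k 0) : k'' ≤ 0 := by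
  by_contra! hpos
  have hd : deriv k =ᶠ[𝓝 0] k' := hk.mono fun s hs => hs.deriv
  have h0 : deriv k 0 = 0 := hmax.deriv_eq_zero
  have h2 : deriv (deriv k) 0 = k'' := by rw [hd.deriv_eq, hk'.deriv]
  -- A positive second derivative would make the maximum also a minimum; then `k` is locally
  -- constant and its second derivative is zero.
  have hmin : IsLocalMin k 0 :=
    isLocalMin_of_deriv_deriv_pos (h2 ▸ hpos) h0 hk.self_of_nhds.continuousAt
  have hconst : k =ᶠ[𝓝 0] fun _ => k 0 := by
    filter_upwards [hmax, hmin] with s h1 h2 using le_antisymm h1 h2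
  have h3 : deriv k =ᶠ[𝓝 0] fun _ => 0 := by
    filter_upwards [hconst.eventuallyEq_nhds] with s hs
    rw [hs.deriv_eq, deriv_const]
  rw [h3.deriv_eq, deriv_const] at h2
  exact hpos.ne h2

/-! ### Normals and touching balls of radius `d₀`. -/

namespace IsSmoothSolution

variable {n : ℕ} {T ς : ℝ} {φ : ℝ → Space n → ℝ} {v B : ℝ → Space n → Space n}
  {p : ℝ → Space n → ℝ} {t : ℝ} {x y : Space n}

lemma phi_eq_zero (h : IsSmoothSolution T ς φ v B p) (ht : t ∈ Icc 0 T)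
    (hy : y ∈ frontier (dom φ t)) : φ t y = 0 := by
  rw [h.frontier_dom ht] at hy
  exact hy

lemma gradient_ne_zero (h : IsSmoothSolution T ς φ v B p) (ht : t ∈ Icc 0 T)
    (hy : y ∈ frontier (dom φ t)) : gradient (φ t) y ≠ 0 :=
  h.regular t ht y (h.phi_eq_zero ht hy)

lemma norm_normal (h : IsSmoothSolution T ς φ v B p) (ht : t ∈ Icc 0 T)
    (hy : y ∈ frontier (dom φ t)) : ‖normal φ t y‖ = 1 := by
  have := norm_pos_iff.2 (h.gradient_ne_zero ht hy)
  rw [normal, norm_smul, norm_inv, norm_norm, inv_mul_cancel₀ this.ne']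

lemma gradient_eq (h : IsSmoothSolution T ς φ v B p) (ht : t ∈ Icc 0 T)
    (hy : y ∈ frontier (dom φ t)) :
    gradient (φ t) y = ‖gradient (φ t) y‖ • normal φ t y := by
  have := norm_pos_iff.2 (h.gradient_ne_zero ht hy)
  rw [normal, smul_smul, mul_inv_cancel₀ this.ne', one_smul]

lemma fderiv_normal_pos (h : IsSmoothSolution T ς φ v B p) (ht : t ∈ Icc 0 T)
    (hy : y ∈ frontier (dom φ t)) : 0 < fderiv ℝ (φ t) y (normal φ t y) := by
  rw [← inner_gradient (h.differentiable_slice_phi t y), h.gradient_eq ht hy, inner_smul_left,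
    real_inner_self_eq_norm_sq, h.norm_normal ht hy]
  have := norm_pos_iff.2 (h.gradient_ne_zero ht hy)
  simpa using this

lemma eventually_phi_pos (h : IsSmoothSolution T ς φ v B p) (ht : t ∈ Icc 0 T)
    (hy : y ∈ frontier (dom φ t)) : ∀ᶠ s : ℝ in 𝓝[>] 0, 0 < φ t (y + s • normal φ t y) := by
  have := eventually_lt_line (h.differentiable_slice_phi t y) (h.fderiv_normal_pos ht hy)
  rwa [h.phi_eq_zero ht hy] at this

lemma eventually_phi_neg (h : IsSmoothSolution T ς φ v B p) (ht : t ∈ Icc 0 T)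
    (hy : y ∈ frontier (dom φ t)) : ∀ᶠ s : ℝ in 𝓝[>] 0, φ t (y - s • normal φ t y) < 0 := by
  have := eventually_line_lt (w := -normal φ t y) (h.differentiable_slice_phi t y)
    (by rw [map_neg]; simpa using h.fderiv_normal_pos ht hy)
  rw [h.phi_eq_zero ht hy] at this
  simpa [sub_eq_add_neg] using this

lemma strict_slice (h : IsSmoothSolution T ς φ v B p) (t : ℝ) (y : Space n) :
    HasStrictFDerivAt (φ t) (fderiv ℝ (φ t) y) y :=
  (h.contDiff_slice_phi t).contDiffAt.hasStrictFDerivAt (by simp)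

lemma fderiv_slice_ne_zero (h : IsSmoothSolution T ς φ v B p) (ht : t ∈ Icc 0 T)
    (hy : y ∈ frontier (dom φ t)) : fderiv ℝ (φ t) y ≠ 0 := by
  intro h0
  have := h.fderiv_normal_pos ht hy
  rw [h0] at this
  exact lt_irrefl _ this

/-- The segment from a point to its nearest boundary point is normal to the boundary. -/
lemma exists_eq_add_normal (h : IsSmoothSolution T ς φ v B p) (ht : t ∈ Icc 0 T)
    (hy : y ∈ frontier (dom φ t)) (hxy : Metric.infDist x (frontier (dom φ t)) = dist x y) :
    ∃ s : ℝ, |s| = dist x y ∧ x = y + s • normal φ t y := by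
  have hextr : IsLocalExtrOn (fun z => ‖z - x‖ ^ 2) {z | φ t z = φ t y} y := by
    refine Or.inl ?_
    filter_upwards [self_mem_nhdsWithin] with z hz
    have hz' : z ∈ frontier (dom φ t) := by
      rw [h.frontier_dom ht]
      exact (show φ t z = φ t y from hz).trans (h.phi_eq_zero ht hy)
    have h1 := Metric.infDist_le_dist_of_mem (x := x) hz'
    rw [hxy, dist_eq_norm', dist_eq_norm'] at h1
    gcongr
  have hF : HasStrictFDerivAt (fun z => ‖z - x‖ ^ 2) ((2 • innerSL ℝ (y - x)).comp
      (ContinuousLinearMap.id ℝ (Space n))) y :=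
    (hasStrictFDerivAt_norm_sq (y - x)).comp y ((hasStrictFDerivAt_id y).sub_const x)
  obtain ⟨c, hc⟩ := exists_eq_smul_of_isLocalExtrOn hextr (h.strict_slice t y)
    (h.fderiv_slice_ne_zero ht hy) hF
  have h2 : y - x = (c / 2) • gradient (φ t) y := by
    refine ext_inner_right ℝ fun w => ?_
    have := congrArg (fun L => L w) hc
    simp only [smul_apply, ContinuousLinearMap.comp_apply,
      ContinuousLinearMap.id_apply, innerSL_apply_apply, smul_eq_mul, nsmul_eq_mul] at this
    rw [inner_smul_left, inner_gradient (h.differentiable_slice_phi t y)]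
    simp only [conj_trivial]
    push_cast at this
    linarith
  set s := -(c / 2 * ‖gradient (φ t) y‖) with hs
  have h3 : x = y + s • normal φ t y := by
    rw [hs, neg_smul, mul_smul, ← h.gradient_eq ht hy, ← h2]
    abel
  refine ⟨s, ?_, h3⟩
  conv_rhs => rw [h3]
  rw [dist_self_add_left, norm_smul, h.norm_normal ht hy, mul_one, Real.norm_eq_abs]

/-- The normal map is injective up to the distance `ρ` from the boundary. -/
def NormalInjOn (φ : ℝ → Space n → ℝ) (t ρ : ℝ) : Prop :=
  InjOn (fun z : Space n × ℝ => z.1 + z.2 • normal φ t z.1) (frontier (dom φ t) ×ˢ Ioo (-ρ) ρ)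

lemma exists_normalInjOn {d₀ : ℝ} (hd : ENNReal.ofReal d₀ < injRadius φ t) :
    ∃ ρ, d₀ < ρ ∧ NormalInjOn φ t ρ := by
  obtain ⟨ρ, hρ⟩ := lt_iSup_iff.1 hd
  obtain ⟨hinj, hρ⟩ := lt_iSup_iff.1 hρ
  exact ⟨ρ, (ENNReal.ofReal_lt_ofReal_iff'.1 hρ).1, hinj⟩

/-- A nearest boundary point `y'` represents the same point as `y' + s' N(y')` with `|s'| ≤ |s| <
ρ`. Injectivity of the normal map forces `s' = s`. -/
lemma infDist_add_normal [NeZero n] (h : IsSmoothSolution T ς φ v B p) (ht : t ∈ Icc 0 T)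
    {ρ : ℝ} (hinj : NormalInjOn φ t ρ) (hy : y ∈ frontier (dom φ t)) {s : ℝ} (hs : |s| < ρ) :
    Metric.infDist (y + s • normal φ t y) (frontier (dom φ t)) = |s| := by
  obtain ⟨y', hy', hd⟩ := (h.isCompact_frontier ht).exists_infDist_eq_dist ⟨y, hy⟩
    (y + s • normal φ t y)
  obtain ⟨s', hs', heq⟩ := h.exists_eq_add_normal ht hy' hd
  have hle : |s'| ≤ |s| := by
    rw [hs', ← hd]
    refine (Metric.infDist_le_dist_of_mem hy).trans_eq ?_
    rw [dist_self_add_left, norm_smul, h.norm_normal ht hy, mul_one, Real.norm_eq_abs]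
  have h1 : ((y, s) : Space n × ℝ) ∈ frontier (dom φ t) ×ˢ Ioo (-ρ) ρ := ⟨hy, abs_lt.1 hs⟩
  have h2 : ((y', s') : Space n × ℝ) ∈ frontier (dom φ t) ×ˢ Ioo (-ρ) ρ :=
    ⟨hy', abs_lt.1 (hle.trans_lt hs)⟩
  have h3 := hinj h1 h2 heq
  rw [hd, ← hs', ← (Prod.mk.inj h3).2]

/-- Only the sign of the normal coordinate is in question. If it were positive, the ball about `x`
inside the domain would contain points `y + r N` with small `r > 0`, where `φ > 0`. -/
lemma eq_sub_normal (h : IsSmoothSolution T ς φ v B p) (ht : t ∈ Icc 0 T)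
    (hx : x ∈ dom φ t) (hy : y ∈ frontier (dom φ t)) (hxy : bdryDist φ t x = dist x y) :
    x = y - bdryDist φ t x • normal φ t y := by
  obtain ⟨s, hs, heq⟩ := h.exists_eq_add_normal ht hy hxy
  have hball := ball_infDist_frontier_subset (h.isOpen_dom t) hx
  have hd0 : Metric.infDist x (frontier (dom φ t)) = |s| := hxy.trans hs.symm
  rw [hd0] at hball
  have hle : s ≤ 0 := by
    by_contra! hpos
    have h1 := h.eventually_phi_pos ht hy
    have h2 : ∀ᶠ r : ℝ in 𝓝[>] 0, r < s := nhdsWithin_le_nhds (gt_mem_nhds hpos)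
    obtain ⟨r, hr1, hr2, hr0⟩ := (h1.and (h2.and self_mem_nhdsWithin)).exists
    have hr0 : 0 < r := hr0
    have h3 : y + r • normal φ t y ∈ dom φ t := by
      apply hball
      rw [Metric.mem_ball, dist_eq_norm]
      have : y + r • normal φ t y - x = (r - s) • normal φ t y := by
        conv_lhs => rw [heq]
        rw [sub_smul]
        abel
      rw [this, norm_smul, h.norm_normal ht hy, mul_one, Real.norm_eq_abs, abs_of_pos hpos,
        abs_of_neg (by linarith)]
      linarith
    exact lt_asymm hr1 h3
  rw [bdryDist, hd0, abs_of_nonpos hle, neg_smul, sub_neg_eq_add]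
  exact heq

section balls

variable {ρ d₀ : ℝ}

/-- The interior touching ball. -/
lemma inner_ball_subset [NeZero n] (h : IsSmoothSolution T ς φ v B p) (ht : t ∈ Icc 0 T)
    (hinj : NormalInjOn φ t ρ) (hd₀ : 0 < d₀) (hρ : d₀ < ρ) (hy : y ∈ frontier (dom φ t)) :
    Metric.ball (y - d₀ • normal φ t y) d₀ ⊆ dom φ t := by
  have hd : Metric.infDist (y - d₀ • normal φ t y) (frontier (dom φ t)) = d₀ := by
    have := h.infDist_add_normal ht hinj hy (s := -d₀) (by rw [abs_neg, abs_of_pos hd₀]; exact hρ)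
    rwa [neg_smul, ← sub_eq_add_neg, abs_neg, abs_of_pos hd₀] at this
  have hdisj : Disjoint (Metric.ball (y - d₀ • normal φ t y) d₀) (frontier (dom φ t)) := by
    have := Metric.disjoint_ball_infDist (x := y - d₀ • normal φ t y) (s := frontier (dom φ t))
    rwa [hd] at this
  refine isPreconnected_subset_of_disjoint_frontier (convex_ball _ _).isPreconnected
    (h.isOpen_dom t) hdisj ?_
  have h2 : ∀ᶠ r : ℝ in 𝓝[>] 0, r < d₀ := nhdsWithin_le_nhds (gt_mem_nhds hd₀)
  obtain ⟨r, hr1, hr2, hr0⟩ := ((h.eventually_phi_neg ht hy).and (h2.and self_mem_nhdsWithin)).exists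
  have hr0 : 0 < r := hr0
  refine ⟨y - r • normal φ t y, ?_, hr1⟩
  rw [Metric.mem_ball, dist_eq_norm]
  have : y - r • normal φ t y - (y - d₀ • normal φ t y) = (d₀ - r) • normal φ t y := by
    rw [sub_smul]
    abel
  rw [this, norm_smul, h.norm_normal ht hy, mul_one, Real.norm_eq_abs, abs_of_pos (by linarith)]
  linarith

/-- The exterior touching ball. -/
lemma outer_ball_subset [NeZero n] (h : IsSmoothSolution T ς φ v B p) (ht : t ∈ Icc 0 T)
    (hinj : NormalInjOn φ t ρ) (hd₀ : 0 < d₀) (hρ : d₀ < ρ) (hy : y ∈ frontier (dom φ t)) :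
    Metric.closedBall (y + d₀ • normal φ t y) d₀ ⊆ (dom φ t)ᶜ := by
  have hd : Metric.infDist (y + d₀ • normal φ t y) (frontier (dom φ t)) = d₀ := by
    have := h.infDist_add_normal ht hinj hy (s := d₀) (by rw [abs_of_pos hd₀]; exact hρ)
    rwa [abs_of_pos hd₀] at this
  have hdisj : Disjoint (Metric.ball (y + d₀ • normal φ t y) d₀) (frontier (dom φ t)) := by
    have := Metric.disjoint_ball_infDist (x := y + d₀ • normal φ t y) (s := frontier (dom φ t))
    rwa [hd] at this
  rw [← closure_ball _ hd₀.ne']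
  refine closure_minimal ?_ (h.isOpen_dom t).isClosed_compl
  -- An open ball missing the frontier and meeting the domain would lie entirely in it, yet it
  -- contains `y + r N` for small `r > 0`, which is outside.
  intro z hz hzd
  have hsub := isPreconnected_subset_of_disjoint_frontier (convex_ball _ _).isPreconnected
    (h.isOpen_dom t) hdisj ⟨z, hz, hzd⟩
  have h2 : ∀ᶠ r : ℝ in 𝓝[>] 0, r < d₀ := nhdsWithin_le_nhds (gt_mem_nhds hd₀)
  obtain ⟨r, hr1, hr2, hr0⟩ := ((h.eventually_phi_pos ht hy).and (h2.and self_mem_nhdsWithin)).exists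
  have hr0 : 0 < r := hr0
  refine lt_asymm hr1 (hsub (a := y + r • normal φ t y) ?_)
  rw [Metric.mem_ball, dist_eq_norm]
  have : y + r • normal φ t y - (y + d₀ • normal φ t y) = (r - d₀) • normal φ t y := by
    rw [sub_smul]
    abel
  rw [this, norm_smul, h.norm_normal ht hy, mul_one, Real.norm_eq_abs, abs_of_neg (by linarith)]
  linarith

/-- The point `w` of the exterior ball closest to `x` is outside the domain, so `d(x)` is at most
the distance from `x` to that ball. With `le_bdryDist_inner` this traps `d` between two explicit
functions, both equal to `d` at points whose nearest boundary point is `y`. -/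
lemma bdryDist_le_dist_outer [NeZero n] (h : IsSmoothSolution T ς φ v B p) (ht : t ∈ Icc 0 T)
    (hinj : NormalInjOn φ t ρ) (hd₀ : 0 < d₀) (hρ : d₀ < ρ) (hy : y ∈ frontier (dom φ t))
    (hx : x ∈ dom φ t) :
    bdryDist φ t x ≤ ‖x - (y + d₀ • normal φ t y)‖ - d₀ := by
  set c := y + d₀ • normal φ t y with hc
  have hout := h.outer_ball_subset ht hinj hd₀ hρ hy
  have hlt : d₀ < ‖x - c‖ := by
    by_contra! hle
    exact hout (a := x) (by rwa [Metric.mem_closedBall, dist_eq_norm]) hx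
  have hpos : 0 < ‖x - c‖ := hd₀.trans hlt
  set w := c + (d₀ / ‖x - c‖) • (x - c) with hw
  have hwout : w ∉ dom φ t := by
    apply hout
    rw [Metric.mem_closedBall, hw, dist_self_add_left, norm_smul, norm_div, norm_norm,
      Real.norm_eq_abs, abs_of_pos hd₀, div_mul_cancel₀ _ hpos.ne']
  refine (infDist_frontier_le (h.isOpen_dom t) hx hwout).trans_eq ?_
  have : x - w = (1 - d₀ / ‖x - c‖) • (x - c) := by
    rw [hw, sub_smul, one_smul]
    abel
  rw [dist_eq_norm, this, norm_smul, Real.norm_eq_abs, abs_of_nonneg, sub_mul, one_mul,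
    div_mul_cancel₀ _ hpos.ne']
  rw [sub_nonneg, div_le_one hpos]
  exact hlt.le

lemma le_bdryDist_inner [NeZero n] (h : IsSmoothSolution T ς φ v B p) (ht : t ∈ Icc 0 T)
    (hinj : NormalInjOn φ t ρ) (hd₀ : 0 < d₀) (hρ : d₀ < ρ) (hy : y ∈ frontier (dom φ t))
    (x : Space n) :
    d₀ - ‖x - (y - d₀ • normal φ t y)‖ ≤ bdryDist φ t x := by
  have hd : Metric.infDist (y - d₀ • normal φ t y) (frontier (dom φ t)) = d₀ := by
    have := h.infDist_add_normal ht hinj hy (s := -d₀) (by rw [abs_neg, abs_of_pos hd₀]; exact hρ)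
    rwa [neg_smul, ← sub_eq_add_neg, abs_neg, abs_of_pos hd₀] at this
  have h1 := Metric.infDist_le_infDist_add_dist (s := frontier (dom φ t))
    (x := y - d₀ • normal φ t y) (y := x)
  rw [hd, dist_eq_norm'] at h1
  rw [bdryDist]
  linarith

/-- The curvature bound coming from the interior touching ball. -/
lemma hessian_phi_le [NeZero n] (h : IsSmoothSolution T ς φ v B p) (ht : t ∈ Icc 0 T)
    (hinj : NormalInjOn φ t ρ) (hd₀ : 0 < d₀) (hρ : d₀ < ρ) (hy : y ∈ frontier (dom φ t))
    {τ : Space n} (hτ : fderiv ℝ (φ t) y τ = 0) :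
    d₀ * fderiv ℝ (fun z => fderiv ℝ (φ t) z τ) y τ ≤ ‖gradient (φ t) y‖ * ‖τ‖ ^ 2 := by
  set N := normal φ t y with hN
  have hN1 : ‖N‖ = 1 := h.norm_normal ht hy
  set H := fderiv ℝ (fun z => fderiv ℝ (φ t) z τ) y τ with hH
  set g := ‖gradient (φ t) y‖ with hg
  have hτN : inner ℝ τ N = 0 := by
    rw [← inner_gradient (h.differentiable_slice_phi t y), h.gradient_eq ht hy, inner_smul_left] at hτ
    have := norm_pos_iff.2 (h.gradient_ne_zero ht hy)
    rw [real_inner_comm]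
    exact (mul_eq_zero.1 hτ).resolve_left (by simpa using this.ne')
  have hφN : fderiv ℝ (φ t) y N = g := by
    rw [← inner_gradient (h.differentiable_slice_phi t y), h.gradient_eq ht hy, inner_smul_left,
      real_inner_self_eq_norm_sq, hN1]
    simp [hg]
  rcases eq_or_ne τ 0 with rfl | hτ0
  · simp [hH]
  have hτpos : 0 < ‖τ‖ ^ 2 := by have := norm_pos_iff.2 hτ0; positivity
  -- A parabola strictly more curved than the touching sphere stays inside the ball; the borderline
  -- curvature follows as a limit.
  suffices hκ : ∀ κ, ‖τ‖ ^ 2 / (2 * d₀) < κ → H ≤ 2 * κ * g by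
    have h1 : H ≤ 2 * (‖τ‖ ^ 2 / (2 * d₀)) * g := by
      refine le_of_forall_gt_imp_ge_of_dense fun r hr => ?_
      have hgpos : 0 < g := norm_pos_iff.2 (h.gradient_ne_zero ht hy)
      have := hκ (r / (2 * g)) (by rw [lt_div_iff₀ (by positivity)]; linarith)
      refine this.trans_eq ?_
      field_simp
    calc d₀ * H ≤ d₀ * (2 * (‖τ‖ ^ 2 / (2 * d₀)) * g) := mul_le_mul_of_nonneg_left h1 hd₀.le
      _ = g * ‖τ‖ ^ 2 := by field_simp
  intro κ hκ
  have hκ' : ‖τ‖ ^ 2 < 2 * d₀ * κ := by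
    rw [div_lt_iff₀ (by positivity)] at hκ
    linarith
  have hsm := h.contDiff_slice_phi t
  -- The parabola has velocity `τ` and acceleration `-2κ N` at `y` and runs inside the touching ball
  -- for small `s ≠ 0`. So `φ ∘ c` has a local maximum at `0`, with second derivative `H - 2κ g ≤
  -- 0`.
  set c : ℝ → Space n := fun s => y + s • τ - (κ * s ^ 2) • N with hc
  set c' : ℝ → Space n := fun s => τ - (2 * κ * s) • N with hc'
  have hcd : ∀ s, HasDerivAt c (c' s) s := by
    intro s
    have h1 : HasDerivAt (fun s : ℝ => κ * s ^ 2) (2 * κ * s) s := by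
      have := (hasDerivAt_pow 2 s).const_mul κ
      have h0 : 2 * κ * s = κ * ((2 : ℕ) * s ^ (2 - 1)) := by
        push_cast
        ring
      rw [h0]
      exact this
    have h2 := (((hasDerivAt_id s).smul_const τ).const_add y).sub (h1.smul_const N)
    simp only [one_smul] at h2
    exact h2
  have hc'd : HasDerivAt c' (-((2 * κ) • N)) 0 := by
    have := (((hasDerivAt_id (0 : ℝ)).const_mul (2 * κ)).smul_const N).const_sub τ
    simp only [mul_one] at this
    exact this
  have hc0 : c 0 = y := by simp [hc]
  have hc'0 : c' 0 = τ := by simp [hc']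
  have hk : ∀ s, HasDerivAt (fun s => φ t (c s)) (fderiv ℝ (φ t) (c s) (c' s)) s := fun s =>
    ((h.differentiable_slice_phi t _).hasFDerivAt.comp_hasDerivAt s (hcd s))
  have hfd : DifferentiableAt ℝ (fderiv ℝ (φ t)) y :=
    ((hsm.fderiv_right (m := 1) (by norm_cast)).differentiable one_ne_zero) y
  have hHeq : H = fderiv ℝ (fderiv ℝ (φ t)) y τ τ := by
    rw [hH, fderiv_fderiv_apply (hsm.contDiffAt.of_le (by norm_cast)) (differentiableAt_const τ)]
    simp
  have hk' : HasDerivAt (fun s => fderiv ℝ (φ t) (c s) (c' s)) (H - 2 * κ * g) 0 := by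
    have h1 : HasDerivAt (fun s => fderiv ℝ (φ t) (c s)) (fderiv ℝ (fderiv ℝ (φ t)) y τ) 0 := by
      have h2 : HasFDerivAt (fderiv ℝ (φ t)) (fderiv ℝ (fderiv ℝ (φ t)) y) (c 0) := by
        rw [hc0]
        exact hfd.hasFDerivAt
      have := h2.comp_hasDerivAt 0 (hcd 0)
      rwa [hc'0] at this
    have h3 := h1.clm_apply hc'd
    rw [hc0, hc'0] at h3
    have h4 : H - 2 * κ * g = fderiv ℝ (fderiv ℝ (φ t)) y τ τ
        + fderiv ℝ (φ t) y (-((2 * κ) • N)) := by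
      rw [map_neg, map_smul, hφN, hHeq, smul_eq_mul]
      ring
    rw [h4]
    exact h3
  have hmax : IsLocalMax (fun s => φ t (c s)) 0 := by
    have hsmall : ∀ᶠ s : ℝ in 𝓝 0, ‖τ‖ ^ 2 + κ ^ 2 * s ^ 2 < 2 * d₀ * κ := by
      have : Continuous fun s : ℝ => ‖τ‖ ^ 2 + κ ^ 2 * s ^ 2 := by fun_prop
      exact this.continuousAt.eventually (gt_mem_nhds (by simpa using hκ'))
    filter_upwards [hsmall] with s hs
    rw [hc0, h.phi_eq_zero ht hy]
    rcases eq_or_ne s 0 with rfl | hs0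
    · rw [hc0, h.phi_eq_zero ht hy]
    refine le_of_lt (h.inner_ball_subset ht hinj hd₀ hρ hy (a := c s) ?_)
    rw [Metric.mem_ball, dist_eq_norm]
    have h1 : c s - (y - d₀ • N) = s • τ + (d₀ - κ * s ^ 2) • N := by
      simp only [hc, sub_smul]
      abel
    have h2 : ‖c s - (y - d₀ • N)‖ ^ 2 = s ^ 2 * ‖τ‖ ^ 2 + (d₀ - κ * s ^ 2) ^ 2 := by
      rw [h1, norm_add_sq_real, norm_smul, norm_smul, inner_smul_left, inner_smul_right, hτN, hN1]
      simp only [Real.norm_eq_abs, mul_pow, sq_abs]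
      ring
    have hs2 : 0 < s ^ 2 := by positivity
    refine lt_of_pow_lt_pow_left₀ 2 hd₀.le ?_
    rw [h2]
    nlinarith
  have := second_deriv_nonpos_of_isLocalMax (Eventually.of_forall hk) hk' hmax
  linarith

end balls

end IsSmoothSolution

/-! ### The nearest boundary point as a smooth function of time and position. -/

/-- The spatial gradient of the level set function, as a vector field on spacetime. -/
noncomputable def gradField {n : ℕ} (φ : ℝ → Space n → ℝ) (z : ℝ × Space n) : Space n :=
  WithLp.toLp 2 fun i => spaceDeriv (basisVec i) (fun z : ℝ × Space n => φ z.1 z.2) z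

lemma inner_gradField {n : ℕ} (φ : ℝ → Space n → ℝ) (z : ℝ × Space n) (w : Space n) :
    inner ℝ (gradField φ z) w = spaceDeriv w (fun z : ℝ × Space n => φ z.1 z.2) z := by
  rw [spaceDeriv_eq_sum, PiLp.inner_apply]
  exact Finset.sum_congr rfl fun i _ => by simp [gradField]

/-- The map whose inverse gives the nearest boundary point, in terms of the level set function. -/
noncomputable def footMap {n : ℕ} (φ : ℝ → Space n → ℝ) (q : ℝ × Space n × ℝ) :
    ℝ × Space n × ℝ :=
  (q.1, q.2.1 - q.2.2 • gradField φ (q.1, q.2.1), φ q.1 q.2.1)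

namespace IsSmoothSolution

variable {n : ℕ} {T ς : ℝ} {φ : ℝ → Space n → ℝ} {v B : ℝ → Space n → Space n}
  {p : ℝ → Space n → ℝ} {t : ℝ} {x y : Space n}

lemma differentiableAt_phi (h : IsSmoothSolution T ς φ v B p) (z : ℝ × Space n) :
    DifferentiableAt ℝ (fun z : ℝ × Space n => φ z.1 z.2) z :=
  h.smooth_dom.differentiable (by simp) z

lemma gradField_eq (h : IsSmoothSolution T ς φ v B p) (t : ℝ) (x : Space n) :
    gradField φ (t, x) = gradient (φ t) x := by
  refine ext_inner_right ℝ fun w => ?_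
  rw [inner_gradField, inner_gradient (h.differentiable_slice_phi t x),
    ← fderiv_slice (h.differentiableAt_phi _)]

lemma contDiff_gradField (h : IsSmoothSolution T ς φ v B p) :
    ContDiff ℝ ∞ (gradField φ) := by
  rw [contDiff_euclidean]
  intro i
  exact (h.smooth_dom.fderiv_right (m := ∞) (by simp)).clm_apply contDiff_const

lemma contDiff_footMap (h : IsSmoothSolution T ς φ v B p) : ContDiff ℝ ∞ (footMap φ) := by
  have h1 : ContDiff ℝ ∞ fun q : ℝ × Space n × ℝ => (q.1, q.2.1) :=
    contDiff_fst.prodMk (contDiff_fst.comp contDiff_snd)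
  refine contDiff_fst.prodMk (ContDiff.prodMk ?_ (h.smooth_dom.comp h1))
  exact (contDiff_fst.comp contDiff_snd).sub
    ((contDiff_snd.comp contDiff_snd).smul (h.contDiff_gradField.comp h1))

lemma fderiv_footMap (h : IsSmoothSolution T ς φ v B p) (t : ℝ) (y : Space n) (s : ℝ)
    (a : ℝ) (u : Space n) (r : ℝ) :
    fderiv ℝ (footMap φ) (t, y, s) (a, u, r)
      = (a, u - (s • fderiv ℝ (gradField φ) (t, y) (a, u) + r • gradField φ (t, y)),
        fderiv ℝ (fun z : ℝ × Space n => φ z.1 z.2) (t, y) (a, u)) := by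
  set q : ℝ × Space n × ℝ := (t, y, s) with hq
  have hG : HasFDerivAt (gradField φ) (fderiv ℝ (gradField φ) (t, y)) (q.1, q.2.1) :=
    (h.contDiff_gradField.differentiable (by simp) _).hasFDerivAt
  have hΦ : HasFDerivAt (fun z : ℝ × Space n => φ z.1 z.2)
      (fderiv ℝ (fun z : ℝ × Space n => φ z.1 z.2) (t, y)) (q.1, q.2.1) :=
    (h.differentiableAt_phi _).hasFDerivAt
  have h2 : HasFDerivAt (fun q : ℝ × Space n × ℝ => q.2.1)
      ((ContinuousLinearMap.fst ℝ (Space n) ℝ).comp (ContinuousLinearMap.snd ℝ ℝ (Space n × ℝ))) q :=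
    hasFDerivAt_fst.comp q hasFDerivAt_snd
  have h3 : HasFDerivAt (fun q : ℝ × Space n × ℝ => q.2.2)
      ((ContinuousLinearMap.snd ℝ (Space n) ℝ).comp (ContinuousLinearMap.snd ℝ ℝ (Space n × ℝ))) q :=
    hasFDerivAt_snd.comp q hasFDerivAt_snd
  have h1 : HasFDerivAt (fun q : ℝ × Space n × ℝ => (q.1, q.2.1)) _ q := hasFDerivAt_fst.prodMk h2
  have h4 : HasFDerivAt (fun q : ℝ × Space n × ℝ => gradField φ (q.1, q.2.1)) _ q :=
    HasFDerivAt.comp (g := gradField φ) (f := fun q : ℝ × Space n × ℝ => (q.1, q.2.1)) q hG h1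
  have h5 : HasFDerivAt (fun q : ℝ × Space n × ℝ => φ q.1 q.2.1) _ q :=
    HasFDerivAt.comp (g := fun z : ℝ × Space n => φ z.1 z.2)
      (f := fun q : ℝ × Space n × ℝ => (q.1, q.2.1)) q hΦ h1
  have h6 : HasFDerivAt (footMap φ) _ q := hasFDerivAt_fst.prodMk ((h2.sub (h3.smul h4)).prodMk h5)
  rw [h6.fderiv]
  simp [hq]

/-- For a kernel vector `(a, u, r)` one finds `a = 0`, `u` tangent to the boundary, and `u = s Hess
φ u + r ∂φ`. Pairing with `u` removes the last term, and the curvature bound `hessian_phi_le` gives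
`‖u‖² ≤ (s ‖∂φ‖ / d₀) ‖u‖²` with a factor less than `1`. Hence `u = 0`, and then `r = 0` since `∂φ ≠
0`. -/
lemma injective_fderiv_footMap [NeZero n] (h : IsSmoothSolution T ς φ v B p) (ht : t ∈ Icc 0 T)
    {ρ d₀ s : ℝ} (hinj : NormalInjOn φ t ρ) (hd₀ : 0 < d₀) (hρ : d₀ < ρ)
    (hy : y ∈ frontier (dom φ t)) (hs0 : 0 ≤ s) (hs : s * ‖gradient (φ t) y‖ < d₀) :
    Function.Injective (fderiv ℝ (footMap φ) (t, y, s)) := by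
  rw [injective_iff_map_eq_zero]
  rintro ⟨a, u, r⟩ hq
  rw [h.fderiv_footMap] at hq
  obtain ⟨rfl, h2, h3⟩ : a = 0 ∧ _ ∧ _ := by simpa only [Prod.mk_eq_zero] using hq
  have hu0 : fderiv ℝ (φ t) y u = 0 := by
    have := fderiv_slice (h.differentiableAt_phi (t, y)) u
    rw [this]
    exact h3
  have hGu : inner ℝ (gradField φ (t, y)) u = 0 := by
    rw [inner_gradField]
    exact h3
  have hH : inner ℝ (fderiv ℝ (gradField φ) (t, y) (0, u)) u
      = fderiv ℝ (fun z => fderiv ℝ (φ t) z u) y u := by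
    have h4 : HasFDerivAt (gradField φ) (fderiv ℝ (gradField φ) (t, y)) (t, y) :=
      (h.contDiff_gradField.differentiable (by simp) _).hasFDerivAt
    have h5 := h4.inner ℝ (hasFDerivAt_const u (t, y))
    have h6 : (fun z => inner ℝ (gradField φ z) u)
        = spaceDeriv u (fun z : ℝ × Space n => φ z.1 z.2) := by
      funext z
      exact inner_gradField φ z u
    rw [h6] at h5
    have h7 : (fun z => fderiv ℝ (φ t) z u)
        = fun z => spaceDeriv u (fun z : ℝ × Space n => φ z.1 z.2) (t, z) := by
      funext z
      exact fderiv_slice (h.differentiableAt_phi (t, z)) u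
    rw [h7, fderiv_slice h5.differentiableAt, spaceDeriv, h5.fderiv]
    simp
  have hess := h.hessian_phi_le ht hinj hd₀ hρ hy hu0
  rw [← hH] at hess
  have hnorm : ‖u‖ ^ 2 = s * inner ℝ (fderiv ℝ (gradField φ) (t, y) (0, u)) u := by
    have h4 := congrArg (fun w => inner ℝ w u) h2
    simp only [inner_sub_left, inner_add_left, inner_smul_left, hGu, inner_zero_left,
      conj_trivial, mul_zero, add_zero, real_inner_self_eq_norm_sq] at h4
    linarith
  have hu : u = 0 := by
    by_contra hu
    have hpos : 0 < ‖u‖ ^ 2 := by have := norm_pos_iff.2 hu; positivity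
    have h4 := mul_le_mul_of_nonneg_left hess hs0
    have h5 : d₀ * ‖u‖ ^ 2 ≤ (s * ‖gradient (φ t) y‖) * ‖u‖ ^ 2 := by
      calc d₀ * ‖u‖ ^ 2 = s * (d₀ * inner ℝ (fderiv ℝ (gradField φ) (t, y) (0, u)) u) := by
            rw [hnorm]; ring
        _ ≤ _ := h4.trans_eq (by ring)
    nlinarith
  subst hu
  have hr : r = 0 := by
    have h6 : ((0 : ℝ), (0 : Space n)) = 0 := rfl
    rw [h6, map_zero, smul_zero, zero_add, zero_sub, neg_eq_zero] at h2
    refine (smul_eq_zero.1 h2).resolve_right ?_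
    rw [h.gradField_eq]
    exact h.gradient_ne_zero ht hy
  simp [hr]

lemma bdryDist_pos [NeZero n] (h : IsSmoothSolution T ς φ v B p) (ht : t ∈ Icc 0 T)
    (hx : x ∈ dom φ t) : 0 < bdryDist φ t x := by
  refine (isClosed_frontier.notMem_iff_infDist_pos (h.frontier_nonempty ht ⟨x, hx⟩)).1 fun hx' => ?_
  exact (h.phi_eq_zero ht hx').not_lt hx

/-- The nearest boundary point depends smoothly on time and position. -/
lemma exists_smooth_foot [NeZero n] (h : IsSmoothSolution T ς φ v B p) {d₀ : ℝ} (hd₀ : 0 < d₀)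
    (hι : ∀ t ∈ Icc 0 T, ENNReal.ofReal d₀ < injRadius φ t) {z₀ : ℝ × Space n}
    (hz₀ : z₀ ∈ fluidRegion T φ) (hd : bdryDist φ z₀.1 z₀.2 < d₀) :
    ∃ Y : ℝ × Space n → Space n, ContDiffAt ℝ ∞ Y z₀ ∧ ∀ᶠ z in 𝓝 z₀, z.1 ∈ Icc 0 T →
      Y z ∈ frontier (dom φ z.1) ∧ bdryDist φ z.1 z.2 = ‖z.2 - Y z‖ ∧ 0 < bdryDist φ z.1 z.2 ∧
      bdryDist φ z.1 z.2 < d₀ := by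
  obtain ⟨t₀, x₀⟩ := z₀
  have ht₀ : t₀ ∈ Icc 0 T := hz₀.1
  have hx₀ : x₀ ∈ dom φ t₀ := hz₀.2
  change bdryDist φ t₀ x₀ < d₀ at hd
  obtain ⟨ρ, hρ, hinj⟩ := exists_normalInjOn (hι t₀ ht₀)
  obtain ⟨y₀, hy₀, hxy, -⟩ := h.exists_nearest ht₀ hx₀
  -- In `footMap` the unnormalized gradient replaces the unit normal, so the parameter of `x₀` is
  -- the distance divided by `‖∂φ(y₀)‖`.
  have hg := norm_pos_iff.2 (h.gradient_ne_zero ht₀ hy₀)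
  have hdpos := h.bdryDist_pos ht₀ hx₀
  set s₀ := bdryDist φ t₀ x₀ / ‖gradient (φ t₀) y₀‖ with hs₀
  have hs₀pos : 0 < s₀ := by positivity
  have hsg : s₀ * ‖gradient (φ t₀) y₀‖ = bdryDist φ t₀ x₀ := div_mul_cancel₀ _ hg.ne'
  have hinjL := h.injective_fderiv_footMap ht₀ hinj hd₀ hρ hy₀ hs₀pos.le (hsg ▸ hd)
  have himage : footMap φ (t₀, y₀, s₀) = (t₀, x₀, 0) := by
    have h1 := h.eq_sub_normal ht₀ hx₀ hy₀ hxy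
    have h2 : s₀ • gradField φ (t₀, y₀) = bdryDist φ t₀ x₀ • normal φ t₀ y₀ := by
      rw [h.gradField_eq, h.gradient_eq ht₀ hy₀, smul_smul, hsg]
    simp only [footMap, h2, h.phi_eq_zero ht₀ hy₀, ← h1]
  set L := (LinearEquiv.ofInjectiveEndo
    (fderiv ℝ (footMap φ) (t₀, y₀, s₀)).toLinearMap hinjL).toContinuousLinearEquiv with hL
  have hcd : ContDiffAt ℝ ∞ (footMap φ) (t₀, y₀, s₀) := h.contDiff_footMap.contDiffAt
  have hfd : HasFDerivAt (footMap φ) (L : ℝ × Space n × ℝ →L[ℝ] ℝ × Space n × ℝ) (t₀, y₀, s₀) := by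
    have h1 := (h.contDiff_footMap.differentiable (by simp) (t₀, y₀, s₀)).hasFDerivAt
    have h2 : (L : ℝ × Space n × ℝ →L[ℝ] ℝ × Space n × ℝ) = fderiv ℝ (footMap φ) (t₀, y₀, s₀) := by
      ext q <;> rfl
    rwa [h2]
  set e := hcd.toOpenPartialHomeomorph (footMap φ) hfd (by simp) with he
  have hsymm : ContDiffAt ℝ ∞ e.symm (t₀, x₀, 0) := by
    have := hcd.to_localInverse hfd (by simp)
    rw [himage] at this
    exact this
  have htarget : ((t₀, x₀, 0) : ℝ × Space n × ℝ) ∈ e.target := by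
    have := hcd.image_mem_toOpenPartialHomeomorph_target hfd (by simp)
    rwa [himage] at this
  have hsymm0 : e.symm (t₀, x₀, 0) = (t₀, y₀, s₀) := by
    have h1 := e.left_inv (hcd.mem_toOpenPartialHomeomorph_source hfd (by simp))
    rw [← himage]
    exact h1
  -- The last component `0` demands that the foot lie on `φ = 0`.
  set ι : ℝ × Space n → ℝ × Space n × ℝ := fun z => (z.1, z.2, 0) with hιdef
  have hιs : ContDiff ℝ ∞ ι := contDiff_fst.prodMk (contDiff_snd.prodMk contDiff_const)
  have hE : ContDiffAt ℝ ∞ (fun z => e.symm (ι z)) (t₀, x₀) :=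
    ContDiffAt.comp (t₀, x₀) (g := e.symm) (f := ι) hsymm hιs.contDiffAt
  have hEc := hE.continuousAt
  set Y : ℝ × Space n → Space n := fun z => (e.symm (ι z)).2.1 with hY
  set S : ℝ × Space n → ℝ := fun z => (e.symm (ι z)).2.2 with hS
  have hYd : ContDiffAt ℝ ∞ Y (t₀, x₀) := (contDiff_fst.comp contDiff_snd).contDiffAt.comp _ hE
  have hSd : ContDiffAt ℝ ∞ S (t₀, x₀) := (contDiff_snd.comp contDiff_snd).contDiffAt.comp _ hE
  have hY0 : Y (t₀, x₀) = y₀ := by simp [hY, hιdef, hsymm0]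
  have hS0 : S (t₀, x₀) = s₀ := by simp [hS, hιdef, hsymm0]
  refine ⟨Y, hYd, ?_⟩
  have hev1 : ∀ᶠ z in 𝓝 ((t₀, x₀) : ℝ × Space n), ι z ∈ e.target :=
    hιs.continuous.continuousAt.eventually (e.open_target.mem_nhds htarget)
  have hev2 : ∀ᶠ z in 𝓝 ((t₀, x₀) : ℝ × Space n), 0 < S z :=
    hSd.continuousAt.eventually (lt_mem_nhds (hS0 ▸ hs₀pos))
  -- This keeps the normal coordinate below `d₀`, which is less than the radius of injectivity at
  -- the nearby times; hence the local inverse really yields the globally nearest boundary point.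
  have hev3 : ∀ᶠ z in 𝓝 ((t₀, x₀) : ℝ × Space n), S z * ‖gradField φ (z.1, Y z)‖ < d₀ := by
    have hc : ContinuousAt (fun z : ℝ × Space n => S z * ‖gradField φ (z.1, Y z)‖) (t₀, x₀) := by
      refine hSd.continuousAt.mul (ContinuousAt.norm ?_)
      exact h.contDiff_gradField.continuous.continuousAt.comp
        (continuousAt_fst.prodMk hYd.continuousAt)
    refine hc.eventually (gt_mem_nhds ?_)
    simp only [hS0, hY0, h.gradField_eq]
    exact hsg ▸ hd
  filter_upwards [hev1, hev2, hev3] with z hz1 hz2 hz3 hzT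
  have hright : footMap φ (e.symm (ι z)) = ι z := e.right_inv hz1
  have h1 : (e.symm (ι z)).1 = z.1 := congrArg Prod.fst hright
  have h2 : Y z - S z • gradField φ (z.1, Y z) = z.2 := by
    have := congrArg (fun q => q.2.1) hright
    simp only [footMap, h1] at this
    exact this
  have h3 : φ z.1 (Y z) = 0 := by
    have := congrArg (fun q => q.2.2) hright
    simp only [footMap, h1] at this
    exact this
  have hYf : Y z ∈ frontier (dom φ z.1) := by
    rw [h.frontier_dom hzT]
    exact h3
  obtain ⟨ρ', hρ', hinj'⟩ := exists_normalInjOn (hι z.1 hzT)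
  set s := S z * ‖gradField φ (z.1, Y z)‖ with hs
  have hgpos := norm_pos_iff.2 (h.gradient_ne_zero hzT hYf)
  have hspos : 0 < s := by
    rw [hs, h.gradField_eq]
    positivity
  have h4 : S z • gradField φ (z.1, Y z) = s • normal φ z.1 (Y z) := by
    rw [hs, mul_smul, h.gradField_eq, ← h.gradient_eq hzT hYf]
  have h5 : z.2 = Y z + (-s) • normal φ z.1 (Y z) := by
    rw [neg_smul, ← h4, ← sub_eq_add_neg, h2]
  have h6 := h.infDist_add_normal hzT hinj' hYf (s := -s) (by
    rw [abs_neg, abs_of_pos hspos]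
    exact hz3.trans hρ')
  rw [← h5, abs_neg, abs_of_pos hspos] at h6
  have h7 : bdryDist φ z.1 z.2 = s := h6
  refine ⟨hYf, ?_, h7 ▸ hspos, h7 ▸ hz3⟩
  have h8 : z.2 - Y z = (-s) • normal φ z.1 (Y z) := by
    conv_lhs => rw [h5]
    abel
  rw [h7, h8, norm_smul, h.norm_normal hzT hYf, norm_neg, mul_one, Real.norm_eq_abs,
    abs_of_pos hspos]

end IsSmoothSolution

/-! ### First and second derivatives of the distance function. -/

/-- The distance to the boundary as a function on spacetime. -/
noncomputable def distFun {n : ℕ} (φ : ℝ → Space n → ℝ) (z : ℝ × Space n) : ℝ :=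
  bdryDist φ z.1 z.2

section hessian

variable {n : ℕ}

lemma hasDerivAt_space_line {F : ℝ × Space n → ℝ} {t s : ℝ} {x e : Space n}
    (hF : DifferentiableAt ℝ F (t, x + s • e)) :
    HasDerivAt (fun s : ℝ => F (t, x + s • e)) (spaceDeriv e F (t, x + s • e)) s := by
  have h1 := (hasFDerivAt_slice hF).comp_hasDerivAt s
    (((hasDerivAt_id s).smul_const e).const_add x)
  simp only [id_eq, one_smul, ContinuousLinearMap.comp_apply, ContinuousLinearMap.inr_apply] at h1
  exact h1

lemma continuous_space_line (t : ℝ) (x e : Space n) :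
    Continuous fun s : ℝ => ((t, x + s • e) : ℝ × Space n) := by fun_prop

/-- A function touched from above by a quadratic polynomial along a line. -/
lemma spaceDeriv_spaceDeriv_le {F : ℝ × Space n → ℝ} {t : ℝ} {x e : Space n} {a b : ℝ}
    (hF : ContDiffAt ℝ 2 F (t, x))
    (hle : ∀ᶠ s : ℝ in 𝓝 0, F (t, x + s • e) ≤ F (t, x) + a * s + b * s ^ 2) :
    spaceDeriv e (spaceDeriv e F) (t, x) ≤ 2 * b := by
  have hc : Tendsto (fun s : ℝ => ((t, x + s • e) : ℝ × Space n)) (𝓝 0) (𝓝 (t, x)) := by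
    simpa using (continuous_space_line t x e).tendsto 0
  have h1 : ∀ᶠ z in 𝓝 (t, x), DifferentiableAt ℝ F z :=
    (hF.eventually (by simp)).mono fun z hz => hz.differentiableAt two_ne_zero
  have h2 := hc.eventually h1
  have hk : ∀ᶠ s : ℝ in 𝓝 0, HasDerivAt (fun s => F (t, x + s • e) - (a * s + b * s ^ 2))
      (spaceDeriv e F (t, x + s • e) - (a + 2 * b * s)) s := by
    filter_upwards [h2] with s hs
    have h3 : HasDerivAt (fun s : ℝ => a * s + b * s ^ 2) (a * 1 + b * ((2 : ℕ) * s ^ (2 - 1))) s :=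
      ((hasDerivAt_id s).const_mul a).add ((hasDerivAt_pow 2 s).const_mul b)
    have h4 := (hasDerivAt_space_line hs).sub h3
    have h5 : a + 2 * b * s = a * 1 + b * ((2 : ℕ) * s ^ (2 - 1)) := by push_cast; ring
    rw [h5]
    exact h4
  have hk' : HasDerivAt (fun s => spaceDeriv e F (t, x + s • e) - (a + 2 * b * s))
      (spaceDeriv e (spaceDeriv e F) (t, x) - 2 * b) 0 := by
    have h3 : DifferentiableAt ℝ (spaceDeriv e F) (t, x + (0 : ℝ) • e) := by
      have := (contDiffAt_spaceDeriv hF (m := 1) (by norm_cast) e).differentiableAt one_ne_zero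
      simpa using this
    have h4 := hasDerivAt_space_line h3
    have h5 : HasDerivAt (fun s : ℝ => a + 2 * b * s) (2 * b * 1) 0 :=
      ((hasDerivAt_id (0 : ℝ)).const_mul (2 * b)).const_add a
    have h6 := h4.sub h5
    rw [zero_smul, add_zero, mul_one] at h6
    exact h6
  have hmax : IsLocalMax (fun s => F (t, x + s • e) - (a * s + b * s ^ 2)) 0 := by
    filter_upwards [hle] with s hs
    simp only [zero_smul, add_zero, mul_zero, ne_eq, OfNat.ofNat_ne_zero, not_false_eq_true,
      zero_pow, sub_zero]
    linarith
  have := second_deriv_nonpos_of_isLocalMax hk hk' hmax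
  linarith

lemma spaceDeriv_neg (F : ℝ × Space n → ℝ) (w : Space n) (z : ℝ × Space n) :
    spaceDeriv w (fun z => -F z) z = -spaceDeriv w F z := by
  unfold spaceDeriv
  have : (fun z => -F z) = -F := rfl
  rw [this, fderiv_neg]
  simp

lemma le_spaceDeriv_spaceDeriv {F : ℝ × Space n → ℝ} {t : ℝ} {x e : Space n} {a b : ℝ}
    (hF : ContDiffAt ℝ 2 F (t, x))
    (hle : ∀ᶠ s : ℝ in 𝓝 0, F (t, x) + a * s - b * s ^ 2 ≤ F (t, x + s • e)) :
    -(2 * b) ≤ spaceDeriv e (spaceDeriv e F) (t, x) := by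
  have h1 := spaceDeriv_spaceDeriv_le (F := fun z => -F z) (a := -a) (b := b) (e := e) hF.neg (by
    filter_upwards [hle] with s hs
    linarith)
  have h2 : spaceDeriv e (fun z => -F z) = fun z => -spaceDeriv e F z := by
    funext z
    exact spaceDeriv_neg F e z
  rw [h2, spaceDeriv_neg] at h1
  linarith

lemma spaceDeriv_spaceDeriv_eq {F : ℝ × Space n → ℝ} {z : ℝ × Space n} (hF : ContDiffAt ℝ 2 F z)
    (u w : Space n) :
    spaceDeriv u (spaceDeriv w F) z = fderiv ℝ (fderiv ℝ F) z (0, u) (0, w) := by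
  have := fderiv_fderiv_apply hF (differentiableAt_const ((0 : ℝ), w)) (0, u)
  simp only [fderiv_fun_const, Pi.zero_apply, _root_.zero_apply, map_zero, add_zero] at this
  exact this

/-- A bound for the quadratic form of the Hessian bounds its entries. -/
lemma abs_hessian_le {F : ℝ × Space n → ℝ} {z : ℝ × Space n} {c : ℝ} (hF : ContDiffAt ℝ 2 F z)
    (hc0 : 0 ≤ c) (hc : ∀ e, |spaceDeriv e (spaceDeriv e F) z| ≤ c * ‖e‖ ^ 2) (i j : Fin n) :
    |spaceDeriv (basisVec i) (spaceDeriv (basisVec j) F) z| ≤ 2 * c := by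
  -- Polarization: four times the entry is the difference of the values at `e_i + e_j` and `e_i -
  -- e_j`, each at most `4 c` because these vectors have norm at most `2`.
  have h1 := hc (basisVec i + basisVec j)
  have h2 := hc (basisVec i - basisVec j)
  have hcomm := spaceDeriv_comm hF (basisVec i) (basisVec j)
  rw [spaceDeriv_spaceDeriv_eq hF] at h1 h2
  rw [spaceDeriv_spaceDeriv_eq hF, spaceDeriv_spaceDeriv_eq hF] at hcomm
  rw [spaceDeriv_spaceDeriv_eq hF]
  set D := fderiv ℝ (fderiv ℝ F) z
  have ha : ((0 : ℝ), basisVec i + basisVec j) = (0, basisVec i) + (0, basisVec j) := by simp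
  have hs : ((0 : ℝ), basisVec i - basisVec j) = (0, basisVec i) - (0, basisVec j) := by simp
  rw [ha] at h1
  rw [hs] at h2
  simp only [map_add, map_sub, add_apply, sub_apply] at h1 h2
  have hn : ∀ k : Fin n, ‖(basisVec k : Space n)‖ = 1 := fun k => by simp
  have hn1 : ‖basisVec i + basisVec j‖ ^ 2 ≤ 2 ^ 2 := by
    gcongr
    exact (norm_add_le _ _).trans (by rw [hn, hn]; norm_num)
  have hn2 : ‖basisVec i - basisVec j‖ ^ 2 ≤ 2 ^ 2 := by
    gcongr
    exact (norm_sub_le _ _).trans (by rw [hn, hn]; norm_num)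
  have h3 := mul_le_mul_of_nonneg_left hn1 hc0
  have h4 := mul_le_mul_of_nonneg_left hn2 hc0
  rw [abs_le] at h1 h2 ⊢
  constructor <;> nlinarith

end hessian

namespace IsSmoothSolution

variable {n : ℕ} {T ς : ℝ} {φ : ℝ → Space n → ℝ} {v B : ℝ → Space n → Space n}
  {p : ℝ → Space n → ℝ} {t : ℝ} {x y : Space n} {d₀ : ℝ}

/-- The gradient of the distance function at a point with nearest boundary point `y`. -/
lemma distFun_mul_spaceDeriv (hd : DifferentiableAt ℝ (distFun φ) (t, x))
    (hy : y ∈ frontier (dom φ t)) (hxy : bdryDist φ t x = ‖x - y‖) (w : Space n) :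
    bdryDist φ t x * spaceDeriv w (distFun φ) (t, x) = inner ℝ (x - y) w := by
  have h1 : HasFDerivAt (fun u => distFun φ (t, u)) _ x := hasFDerivAt_slice hd
  have h2 : HasFDerivAt (fun u => ‖u - y‖ ^ 2) ((2 • innerSL ℝ (x - y)).comp
      (ContinuousLinearMap.id ℝ (Space n))) x :=
    HasFDerivAt.comp (g := fun u : Space n => ‖u‖ ^ 2) (f := fun u => u - y) x
      (hasStrictFDerivAt_norm_sq (x - y)).hasFDerivAt ((hasFDerivAt_id x).sub_const y)
  have h3 := h2.sub (h1.pow 2)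
  -- The function `‖u - y‖² - d(u)²` is nonnegative and vanishes at `x`, so its gradient there is
  -- zero.
  have hmin : IsLocalMin (fun u => ‖u - y‖ ^ 2 - distFun φ (t, u) ^ 2) x := by
    refine Eventually.of_forall fun u => ?_
    have h4 : distFun φ (t, u) ≤ ‖u - y‖ := by
      have := Metric.infDist_le_dist_of_mem (x := u) hy
      rwa [dist_eq_norm] at this
    have h5 : 0 ≤ distFun φ (t, u) := Metric.infDist_nonneg
    have h6 : distFun φ (t, x) = ‖x - y‖ := hxy
    simp only [h6, sub_self]
    have := pow_le_pow_left₀ h5 h4 2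
    linarith
  have h7 := congrArg (fun L => L w) (hmin.hasFDerivAt_eq_zero h3)
  simp only [sub_apply, smul_apply, ContinuousLinearMap.comp_apply, ContinuousLinearMap.id_apply,
    innerSL_apply_apply, ContinuousLinearMap.inr_apply, _root_.zero_apply, smul_eq_mul,
    nsmul_eq_mul] at h7
  change bdryDist φ t x * fderiv ℝ (distFun φ) (t, x) (0, w) = _
  have h8 : distFun φ (t, x) = bdryDist φ t x := rfl
  rw [h8] at h7
  push_cast at h7
  simp only [pow_one] at h7
  linarith

/-- Near `x` one has `d₀ - ‖· - c‖ ≤ d` for the centre of the interior touching ball and `d ≤ ‖· -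
c‖ - d₀` for that of the exterior one, with equality at `x`. The norms are replaced by quadratics
through `r ≤ (r² + R²) / (2R)`, with `R = d₀ - d` or `R = d₀ + d`, both at least `d₀ / 2`. This
bounds the quadratic form by `2 / d₀`, and polarization doubles the constant for the entries. -/
lemma abs_hessian_distFun_le [NeZero n] (h : IsSmoothSolution T ς φ v B p) (ht : t ∈ Icc 0 T)
    (hd₀ : 0 < d₀) (hι : ENNReal.ofReal d₀ < injRadius φ t)
    (hx : x ∈ dom φ t) (hd : bdryDist φ t x ≤ d₀ / 2)
    (hc : ContDiffAt ℝ 2 (distFun φ) (t, x)) (i j : Fin n) :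
    |spaceDeriv (basisVec i) (spaceDeriv (basisVec j) (distFun φ)) (t, x)| ≤ 4 / d₀ := by
  obtain ⟨ρ, hρ, hinj⟩ := exists_normalInjOn hι
  obtain ⟨y, hy, hxy, -⟩ := h.exists_nearest ht hx
  have heq := h.eq_sub_normal ht hx hy hxy
  have hN1 := h.norm_normal ht hy
  set N := normal φ t y
  set d := bdryDist φ t x with hdd
  have hd0 : 0 < d := h.bdryDist_pos ht hx
  have hexp : ∀ (c e : Space n) (s : ℝ),
      ‖x + s • e - c‖ ^ 2 = ‖x - c‖ ^ 2 + 2 * s * inner ℝ (x - c) e + s ^ 2 * ‖e‖ ^ 2 := by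
    intro c e s
    have : x + s • e - c = (x - c) + s • e := by abel
    rw [this, norm_add_sq_real, inner_smul_right, norm_smul, mul_pow, Real.norm_eq_abs, sq_abs]
    ring
  have key : ∀ e, |spaceDeriv e (spaceDeriv e (distFun φ)) (t, x)| ≤ 2 / d₀ * ‖e‖ ^ 2 := by
    intro e
    rw [abs_le]
    constructor
    · set c := y - d₀ • N with hcdef
      have hR : ‖x - c‖ = d₀ - d := by
        have : x - c = (d₀ - d) • N := by
          rw [hcdef, sub_smul]
          nth_rewrite 1 [heq]
          abel
        rw [this, norm_smul, hN1, mul_one, Real.norm_eq_abs, abs_of_pos (by linarith)]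
      have hRpos : 0 < d₀ - d := by linarith
      have h1 := le_spaceDeriv_spaceDeriv (e := e) (a := -(inner ℝ (x - c) e / (d₀ - d)))
        (b := ‖e‖ ^ 2 / (2 * (d₀ - d))) hc (by
          refine Eventually.of_forall fun s => ?_
          have h2 := h.le_bdryDist_inner ht hinj hd₀ hρ hy (x + s • e)
          have h3 : ‖x + s • e - c‖ ≤ (‖x + s • e - c‖ ^ 2 + (d₀ - d) ^ 2) / (2 * (d₀ - d)) := by
            rw [le_div_iff₀ (by positivity)]
            nlinarith [sq_nonneg (‖x + s • e - c‖ - (d₀ - d))]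
          rw [hexp, hR] at h3
          change d + _ - _ ≤ bdryDist φ t (x + s • e)
          refine le_trans (le_of_eq ?_) ((sub_le_sub_left h3 d₀).trans h2)
          field_simp
          ring)
      refine le_trans ?_ h1
      have h4 : ‖e‖ ^ 2 / (d₀ - d) ≤ ‖e‖ ^ 2 / (d₀ / 2) := by
        gcongr
        linarith
      have h5 : 2 * (‖e‖ ^ 2 / (2 * (d₀ - d))) = ‖e‖ ^ 2 / (d₀ - d) := by field_simp
      have h6 : ‖e‖ ^ 2 / (d₀ / 2) = 2 / d₀ * ‖e‖ ^ 2 := by field_simp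
      linarith
    · set c := y + d₀ • N with hcdef
      have hR : ‖x - c‖ = d₀ + d := by
        have : x - c = (-(d₀ + d)) • N := by
          rw [hcdef, neg_smul, add_smul]
          nth_rewrite 1 [heq]
          abel
        rw [this, norm_smul, hN1, mul_one, Real.norm_eq_abs, abs_neg, abs_of_pos (by linarith)]
      have hRpos : 0 < d₀ + d := by linarith
      have h1 := spaceDeriv_spaceDeriv_le (e := e) (a := inner ℝ (x - c) e / (d₀ + d))
        (b := ‖e‖ ^ 2 / (2 * (d₀ + d))) hc (by
          have hcont : Tendsto (fun s : ℝ => x + s • e) (𝓝 0) (𝓝 x) := by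
            have : Continuous fun s : ℝ => x + s • e := by fun_prop
            simpa using this.tendsto 0
          filter_upwards [hcont.eventually ((h.isOpen_dom t).mem_nhds hx)] with s hs
          have h2 := h.bdryDist_le_dist_outer ht hinj hd₀ hρ hy hs
          have h3 : ‖x + s • e - c‖ ≤ (‖x + s • e - c‖ ^ 2 + (d₀ + d) ^ 2) / (2 * (d₀ + d)) := by
            rw [le_div_iff₀ (by positivity)]
            nlinarith [sq_nonneg (‖x + s • e - c‖ - (d₀ + d))]
          rw [hexp, hR] at h3
          change bdryDist φ t (x + s • e) ≤ d + _ + _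
          refine (h2.trans (sub_le_sub_right h3 d₀)).trans (le_of_eq ?_)
          field_simp
          ring)
      refine h1.trans ?_
      have h4 : ‖e‖ ^ 2 / (d₀ + d) ≤ ‖e‖ ^ 2 / (d₀ / 2) := by
        gcongr
        linarith
      have h5 : 2 * (‖e‖ ^ 2 / (2 * (d₀ + d))) = ‖e‖ ^ 2 / (d₀ + d) := by field_simp
      have h6 : ‖e‖ ^ 2 / (d₀ / 2) = 2 / d₀ * ‖e‖ ^ 2 := by field_simp
      linarith
  refine (abs_hessian_le hc (by positivity) key i j).trans_eq ?_
  ring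

/-- The level set function is transported at the boundary. -/
lemma flowDeriv_phi_eq_zero (h : IsSmoothSolution T ς φ v B p) (ht : t ∈ Icc 0 T)
    (hy : y ∈ frontier (dom φ t)) :
    flowDeriv (v t y) (fun z : ℝ × Space n => φ z.1 z.2) (t, y) = 0 := by
  have h1 := h.kinematic t ht y hy
  have hg := norm_pos_iff.2 (h.gradient_ne_zero ht hy)
  rw [normalVelocity, normal, inner_smul_right, real_inner_comm,
    inner_gradient (h.differentiable_slice_phi t y), timeDeriv_slice (h.differentiableAt_phi _)] at h1
  have h2 := fderiv_slice (h.differentiableAt_phi (t, y)) (v t y)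
  change fderiv ℝ (φ t) y (v t y) = _ at h2
  rw [flowDeriv_eq_add, ← h2]
  field_simp at h1
  linarith

/-- The time derivative of the distance function is the normal velocity at the nearest point. -/
lemma flowDeriv_distFun [NeZero n] (h : IsSmoothSolution T ς φ v B p)
    {Y : ℝ × Space n → Space n} {z : ℝ × Space n} (hz : z ∈ openFluidRegion T φ)
    (hd : DifferentiableAt ℝ (distFun φ) z) (hY : DifferentiableAt ℝ Y z)
    (hev : ∀ᶠ z in 𝓝 z, Y z ∈ frontier (dom φ z.1) ∧ bdryDist φ z.1 z.2 = ‖z.2 - Y z‖)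
    (w : Space n) :
    flowDeriv w (distFun φ) z = spaceDeriv (w - v z.1 (Y z)) (distFun φ) z := by
  have hzT : z.1 ∈ Icc 0 T := Ioo_subset_Icc_self hz.1
  have hevT : ∀ᶠ z : ℝ × Space n in 𝓝 z, z.1 ∈ Icc 0 T :=
    continuousAt_fst.eventually (Icc_mem_nhds hz.1.1 hz.1.2)
  set Φ : ℝ × Space n → ℝ := fun z => φ z.1 z.2 with hΦ
  set Y' := fderiv ℝ Y z (1, 0) with hY'
  obtain ⟨hYf, hYd⟩ := hev.self_of_nhds
  -- Time derivative of `φ(t, Y) = 0` at a fixed position.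
  have h1 : fderiv ℝ Φ (z.1, Y z) (1, Y') = 0 := by
    have hc : HasFDerivAt (fun z => Φ (z.1, Y z)) _ z :=
      HasFDerivAt.comp (g := Φ) (f := fun z : ℝ × Space n => (z.1, Y z)) z
        (h.differentiableAt_phi _).hasFDerivAt (hasFDerivAt_fst.prodMk hY.hasFDerivAt)
    have h0 : (fun z : ℝ × Space n => Φ (z.1, Y z)) =ᶠ[𝓝 z] fun _ => 0 := by
      filter_upwards [hev, hevT] with q hq hqT using h.phi_eq_zero hqT hq.1
    have h2 := hc.fderiv
    rw [h0.fderiv_eq] at h2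
    have h3 := congrArg (fun L => L (1, 0)) h2
    simpa [hY'] using h3.symm
  have h2 : bdryDist φ z.1 z.2 * fderiv ℝ (distFun φ) z (1, 0) = -inner ℝ (z.2 - Y z) Y' := by
    have hl : HasFDerivAt (fun z => distFun φ z ^ 2) _ z := hd.hasFDerivAt.pow 2
    have hr : HasFDerivAt (fun z : ℝ × Space n => ‖z.2 - Y z‖ ^ 2) _ z :=
      HasFDerivAt.comp (g := fun u : Space n => ‖u‖ ^ 2) (f := fun z : ℝ × Space n => z.2 - Y z) z
        (hasStrictFDerivAt_norm_sq (z.2 - Y z)).hasFDerivAt (hasFDerivAt_snd.sub hY.hasFDerivAt)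
    have h0 : (fun z => distFun φ z ^ 2) =ᶠ[𝓝 z] fun z : ℝ × Space n => ‖z.2 - Y z‖ ^ 2 := by
      filter_upwards [hev] with q hq
      rw [distFun, hq.2]
    have h3 := hl.fderiv
    rw [h0.fderiv_eq, hr.fderiv] at h3
    have h4 := congrArg (fun L => L (1, 0)) h3
    simp only [smul_apply, ContinuousLinearMap.comp_apply, sub_apply, ContinuousLinearMap.coe_snd',
      innerSL_apply_apply, smul_eq_mul, nsmul_eq_mul, zero_sub, inner_neg_right] at h4
    push_cast at h4
    simp only [pow_one] at h4
    change distFun φ z * _ = _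
    linarith
  -- Both `(1, Y')` and `(1, v(Y))` annihilate `dφ` at the foot, so `Y' - v(Y)` is tangent to the
  -- boundary, while `x - Y` is normal to it.
  have h3 : inner ℝ (z.2 - Y z) Y' = inner ℝ (z.2 - Y z) (v z.1 (Y z)) := by
    have h4 := h.flowDeriv_phi_eq_zero hzT hYf
    have h5 : spaceDeriv (Y' - v z.1 (Y z)) Φ (z.1, Y z) = 0 := by
      have h6 : ((0 : ℝ), Y' - v z.1 (Y z)) = (1, Y') - (1, v z.1 (Y z)) := by simp
      rw [spaceDeriv, h6, map_sub, h1]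
      rw [flowDeriv] at h4
      rw [h4, sub_zero]
    rw [← inner_gradField, h.gradField_eq] at h5
    have h6 := h.eq_sub_normal hzT hz.2 hYf (by rw [hYd, dist_eq_norm])
    have h7 : z.2 - Y z = (-(bdryDist φ z.1 z.2 * ‖gradient (φ z.1) (Y z)‖⁻¹)) •
        gradient (φ z.1) (Y z) := by
      nth_rewrite 1 [h6]
      rw [normal, smul_smul, neg_smul]
      abel
    rw [← sub_eq_zero, ← inner_sub_right, h7, inner_smul_left, h5, mul_zero]
  have hdpos := h.bdryDist_pos hzT hz.2
  have h4 : ∀ u : Space n, bdryDist φ z.1 z.2 * spaceDeriv u (distFun φ) z = inner ℝ (z.2 - Y z) u :=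
    fun u => distFun_mul_spaceDeriv (t := z.1) (x := z.2) hd hYf hYd u
  refine mul_left_cancel₀ hdpos.ne' ?_
  rw [flowDeriv_eq_add, mul_add, h2, h4, h4, h3, inner_sub_right]
  ring

end IsSmoothSolution

/-! ### The projection field `η(d) ∂d` and its regularity. -/

lemma eventually_differentiableAt {E F : Type*} [NormedAddCommGroup E] [NormedSpace ℝ E]
    [NormedAddCommGroup F] [NormedSpace ℝ F] {f : E → F} {z : E} (hf : ContDiffAt ℝ ∞ f z) :
    ∀ᶠ y in 𝓝 z, DifferentiableAt ℝ f y := by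
  have h1 : ContDiffAt ℝ 1 f z := hf.of_le (by norm_cast)
  exact (h1.eventually (by simp)).mono fun y hy => hy.differentiableAt one_ne_zero

/-- The field `η(d) ∂d`, so that `q = δ - m ⊗ m`. -/
noncomputable def projField {n : ℕ} (χ : ℝ → ℝ) (d₀ : ℝ) (φ : ℝ → Space n → ℝ) (i : Fin n)
    (z : ℝ × Space n) : ℝ :=
  χ (distFun φ z / d₀) * pd i (bdryDist φ z.1) z.2

lemma projCoeff_eq {n : ℕ} (χ : ℝ → ℝ) (d₀ : ℝ) (φ : ℝ → Space n → ℝ) (t : ℝ) (x : Space n)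
    (i j : Fin n) :
    projCoeff χ d₀ φ t x i j
      = (if i = j then 1 else 0) - projField χ d₀ φ i (t, x) * projField χ d₀ φ j (t, x) := by
  simp only [projCoeff, projField, distFun]
  ring

lemma norm_le_sum_abs {n : ℕ} (w : Space n) : ‖w‖ ≤ ∑ i, |w i| := by
  conv_lhs => rw [← sum_smul_basisVec w]
  refine (norm_sum_le _ _).trans (Finset.sum_le_sum fun i _ => ?_)
  rw [norm_smul]
  simp

lemma sum_sq_apply_basisVec_le {n : ℕ} (L : Space n →L[ℝ] ℝ) :
    ∑ i, L (basisVec i) ^ 2 ≤ ‖L‖ ^ 2 := by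
  set w : Space n := WithLp.toLp 2 fun i => L (basisVec i) with hw
  have h1 : L w = ∑ i, L (basisVec i) ^ 2 := by
    conv_lhs => rw [← sum_smul_basisVec w, map_sum]
    exact Finset.sum_congr rfl fun i _ => by rw [map_smul, smul_eq_mul, hw, sq]
  have h2 : ‖w‖ ^ 2 = ∑ i, L (basisVec i) ^ 2 := by
    rw [EuclideanSpace.norm_sq_eq]
    exact Finset.sum_congr rfl fun i _ => by rw [Real.norm_eq_abs, sq_abs]
  have h3 : L w ≤ ‖L‖ * ‖w‖ := (le_abs_self _).trans (L.le_opNorm w)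
  rw [← h2]
  rw [h1, ← h2] at h3
  rcases (norm_nonneg w).eq_or_lt with h0 | h0
  · rw [← h0]
    nlinarith [sq_nonneg ‖L‖]
  · have : ‖w‖ ≤ ‖L‖ := by nlinarith
    gcongr

namespace IsCutoff

variable {χ : ℝ → ℝ}

lemma exists_abs_deriv_le (hχ : IsCutoff χ) : ∃ C : ℝ, 0 ≤ C ∧ ∀ s, |deriv χ s| ≤ C := by
  have hc : Continuous (deriv χ) := hχ.smooth.continuous_deriv (by simp)
  obtain ⟨C, hC⟩ := (isCompact_Icc (a := (1 / 4 : ℝ)) (b := 1 / 2)).exists_bound_of_continuousOn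
    hc.continuousOn
  refine ⟨max C 0, le_max_right _ _, fun s => ?_⟩
  by_cases hs : s ∈ Icc (1 / 4 : ℝ) (1 / 2)
  · exact (hC s hs).trans (le_max_left _ _)
  · have : deriv χ s = 0 := by
      rw [mem_Icc, not_and_or, not_le, not_le] at hs
      rcases hs with hs | hs
      · have : χ =ᶠ[𝓝 s] fun _ => 1 := by
          filter_upwards [gt_mem_nhds hs] with r hr using hχ.eq_one r hr
        rw [this.deriv_eq, deriv_const]
      · have : χ =ᶠ[𝓝 s] fun _ => 0 := by
          filter_upwards [lt_mem_nhds hs] with r hr using hχ.eq_zero r hr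
        rw [this.deriv_eq, deriv_const]
    rw [this, abs_zero]
    exact le_max_right _ _

lemma abs_le_one (hχ : IsCutoff χ) (s : ℝ) : |χ s| ≤ 1 :=
  abs_le.2 ⟨by linarith [hχ.nonneg s], hχ.le_one s⟩

end IsCutoff

lemma norm_fderiv_bdryDist_le {n : ℕ} (φ : ℝ → Space n → ℝ) (t : ℝ) (x : Space n) :
    ‖fderiv ℝ (bdryDist φ t) x‖ ≤ 1 := by
  have := norm_fderiv_le_of_lipschitz ℝ (x₀ := x)
    (Metric.lipschitz_infDist_pt (frontier (dom φ t)))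
  rwa [NNReal.coe_one] at this

/-- The distance is `1`-Lipschitz, so its `fderiv` has norm at most `1` at every point, including
points of non-differentiability, where the default value is `0`. -/
lemma sum_projField_sq_le {n : ℕ} {χ : ℝ → ℝ} (hχ : IsCutoff χ) (d₀ : ℝ) (φ : ℝ → Space n → ℝ)
    (z : ℝ × Space n) : ∑ i, projField χ d₀ φ i z ^ 2 ≤ 1 := by
  have h1 := sum_sq_apply_basisVec_le (fderiv ℝ (bdryDist φ z.1) z.2)
  have h2 : ∑ i, projField χ d₀ φ i z ^ 2
      = χ (distFun φ z / d₀) ^ 2 * ∑ i, fderiv ℝ (bdryDist φ z.1) z.2 (basisVec i) ^ 2 := by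
    rw [Finset.mul_sum]
    exact Finset.sum_congr rfl fun i _ => by rw [projField, mul_pow, pd]
  have h3 : ‖fderiv ℝ (bdryDist φ z.1) z.2‖ ^ 2 ≤ 1 := by
    have := norm_fderiv_bdryDist_le φ z.1 z.2
    exact pow_le_one₀ (norm_nonneg _) this
  have h4 : χ (distFun φ z / d₀) ^ 2 ≤ 1 := pow_le_one₀ (hχ.nonneg _) (hχ.le_one _)
  rw [h2]
  exact mul_le_one₀ h4 (Finset.sum_nonneg fun i _ => sq_nonneg _) (h1.trans h3)

namespace IsSmoothSolution

variable {n : ℕ} {T ς : ℝ} {φ : ℝ → Space n → ℝ} {v B : ℝ → Space n → Space n}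
  {p : ℝ → Space n → ℝ} {t : ℝ} {x y : Space n} {d₀ : ℝ} {χ : ℝ → ℝ}

lemma mem_closure_of_closedRegion (h : IsSmoothSolution T ς φ v B p) {z : ℝ × Space n}
    (hz : z ∈ closedRegion T φ) : z.2 ∈ closure (dom φ z.1) := by
  rw [h.closure_dom hz.1]
  exact hz.2

lemma mem_closedRegion_of_frontier (h : IsSmoothSolution T ς φ v B p) (ht : t ∈ Icc 0 T)
    (hy : y ∈ frontier (dom φ t)) : ((t, y) : ℝ × Space n) ∈ closedRegion T φ :=
  ⟨ht, (h.phi_eq_zero ht hy).le⟩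

lemma contDiffAt_v (h : IsSmoothSolution T ς φ v B p) {z : ℝ × Space n}
    (hz : z ∈ closedRegion T φ) (i : Fin n) :
    ContDiffAt ℝ ∞ (fun z : ℝ × Space n => v z.1 z.2 i) z :=
  (contDiffAt_euclidean.1 (h.smooth_v z.1 hz.1 z.2 (h.mem_closure_of_closedRegion hz))) i

lemma contDiffAt_B (h : IsSmoothSolution T ς φ v B p) {z : ℝ × Space n}
    (hz : z ∈ closedRegion T φ) (i : Fin n) :
    ContDiffAt ℝ ∞ (fun z : ℝ × Space n => B z.1 z.2 i) z :=
  (contDiffAt_euclidean.1 (h.smooth_B z.1 hz.1 z.2 (h.mem_closure_of_closedRegion hz))) i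

lemma contDiffAt_totalPressure (h : IsSmoothSolution T ς φ v B p) {z : ℝ × Space n}
    (hz : z ∈ closedRegion T φ) :
    ContDiffAt ℝ ∞ (fun z : ℝ × Space n => totalPressure p B z.1 z.2) z :=
  (h.smooth_p z.1 hz.1 z.2 (h.mem_closure_of_closedRegion hz)).add
    (((h.smooth_B z.1 hz.1 z.2 (h.mem_closure_of_closedRegion hz)).norm_sq ℝ).div_const _)

/-- Lower semicontinuity of the distance to the boundary, at points of the fluid. -/
lemma eventually_lt_bdryDist [NeZero n] (h : IsSmoothSolution T ς φ v B p) {z₀ : ℝ × Space n}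
    (hz₀ : z₀ ∈ fluidRegion T φ) {r : ℝ} (hr : r < bdryDist φ z₀.1 z₀.2) :
    ∀ᶠ z in 𝓝 z₀, z ∈ fluidRegion T φ → r < bdryDist φ z.1 z.2 := by
  obtain ⟨r', hrr', hr'⟩ := exists_between hr
  have hK : IsCompact (Metric.closedBall z₀.2 r') := isCompact_closedBall _ _
  have hneg : ∀ u ∈ Metric.closedBall z₀.2 r', φ z₀.1 u < 0 := fun u hu =>
    ball_infDist_frontier_subset (h.isOpen_dom z₀.1) hz₀.2 (Metric.closedBall_subset_ball hr' hu)
  -- By compactness the closed ball stays in the fluid for all nearby times, so boundary points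
  -- remain outside it.
  have hev : ∀ᶠ t in 𝓝 z₀.1, ∀ u ∈ Metric.closedBall z₀.2 r', φ t u < 0 := by
    refine hK.eventually_forall_of_forall_eventually fun u hu => ?_
    exact h.continuous_phi.continuousAt.eventually (gt_mem_nhds (hneg u hu))
  have hdist : ∀ᶠ z : ℝ × Space n in 𝓝 z₀, dist z.2 z₀.2 < r' - r := by
    have : ContinuousAt (fun z : ℝ × Space n => dist z.2 z₀.2) z₀ := by fun_prop
    exact this.eventually (gt_mem_nhds (by simpa using hrr'))
  filter_upwards [continuousAt_fst.eventually hev, hdist] with z hz1 hz2 hz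
  obtain ⟨y, hy, hd, -⟩ := h.exists_nearest hz.1 hz.2
  have hyout : ¬ dist y z₀.2 ≤ r' := fun hle =>
    (hz1 y hle).ne (h.phi_eq_zero hz.1 hy)
  rw [hd]
  have := dist_triangle y z.2 z₀.2
  rw [dist_comm z.2 y]
  linarith

/-- Near the boundary the distance is smooth at the interior times. -/
lemma exists_smooth_foot_of_mem [NeZero n] (h : IsSmoothSolution T ς φ v B p) (hd₀ : 0 < d₀)
    (hι : ∀ t ∈ Icc 0 T, ENNReal.ofReal d₀ < injRadius φ t) {z₀ : ℝ × Space n}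
    (hz₀ : z₀ ∈ openFluidRegion T φ) (hd : bdryDist φ z₀.1 z₀.2 < d₀) :
    ∃ Y : ℝ × Space n → Space n, ContDiffAt ℝ ∞ Y z₀ ∧ ContDiffAt ℝ ∞ (distFun φ) z₀ ∧
      ∀ᶠ z in 𝓝 z₀, z ∈ openFluidRegion T φ ∧ Y z ∈ frontier (dom φ z.1) ∧
        bdryDist φ z.1 z.2 = ‖z.2 - Y z‖ ∧ DifferentiableAt ℝ (distFun φ) z ∧
        DifferentiableAt ℝ Y z := by
  have hz₀c := openFluidRegion_subset _ _ hz₀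
  obtain ⟨Y, hY, hev⟩ := h.exists_smooth_foot hd₀ hι hz₀c hd
  have hmem : ∀ᶠ z in 𝓝 z₀, z ∈ openFluidRegion T φ :=
    (isOpen_openFluidRegion T h.continuous_phi).mem_nhds hz₀
  have hev' : ∀ᶠ z in 𝓝 z₀, z ∈ openFluidRegion T φ ∧ Y z ∈ frontier (dom φ z.1) ∧
      bdryDist φ z.1 z.2 = ‖z.2 - Y z‖ := by
    filter_upwards [hev, hmem] with z hz hzm
    obtain ⟨h1, h2, -⟩ := hz (Ioo_subset_Icc_self hzm.1)
    exact ⟨hzm, h1, h2⟩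
  have hdist : distFun φ =ᶠ[𝓝 z₀] fun z => ‖z.2 - Y z‖ := hev'.mono fun z hz => hz.2.2
  have hne : z₀.2 - Y z₀ ≠ 0 := by
    obtain ⟨-, h1, h2, -⟩ := hev.self_of_nhds hz₀c.1
    rw [h1] at h2
    exact norm_pos_iff.1 h2
  have hds : ContDiffAt ℝ ∞ (distFun φ) z₀ :=
    ((contDiffAt_snd.sub hY).norm ℝ hne).congr_of_eventuallyEq hdist
  have hdd : ∀ᶠ z in 𝓝 z₀, DifferentiableAt ℝ (distFun φ) z :=
    eventually_differentiableAt hds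
  have hYd : ∀ᶠ z in 𝓝 z₀, DifferentiableAt ℝ Y z :=
    eventually_differentiableAt hY
  refine ⟨Y, hY, hds, ?_⟩
  filter_upwards [hev', hdd, hYd] with z h1 h2 h3 using ⟨h1.1, h1.2.1, h1.2.2, h2, h3⟩

lemma pd_bdryDist_eq {z : ℝ × Space n} (hd : DifferentiableAt ℝ (distFun φ) z) (i : Fin n) :
    pd i (bdryDist φ z.1) z.2 = spaceDeriv (basisVec i) (distFun φ) z :=
  pd_slice (F := distFun φ) (t := z.1) (x := z.2) hd i

lemma projField_eventuallyEq_zero [NeZero n] (h : IsSmoothSolution T ς φ v B p) (hχ : IsCutoff χ)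
    (hd₀ : 0 < d₀) {z₀ : ℝ × Space n} (hz₀ : z₀ ∈ fluidRegion T φ)
    (hd : d₀ / 2 < bdryDist φ z₀.1 z₀.2) (i : Fin n) :
    ∀ᶠ z in 𝓝 z₀, z ∈ fluidRegion T φ → projField χ d₀ φ i z = 0 := by
  filter_upwards [h.eventually_lt_bdryDist hz₀ hd] with z hz hzf
  rw [projField, hχ.eq_zero, zero_mul]
  rw [lt_div_iff₀ hd₀]
  have := hz hzf
  simp only [distFun]
  linarith

/-- The projection field is continuous up to the initial and final times. -/
lemma continuousOn_projField [NeZero n] (h : IsSmoothSolution T ς φ v B p) (hχ : IsCutoff χ)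
    (hd₀ : 0 < d₀) (hι : ∀ t ∈ Icc 0 T, ENNReal.ofReal d₀ < injRadius φ t) (i : Fin n) :
    ContinuousOn (projField χ d₀ φ i) (fluidRegion T φ) := by
  intro z₀ hz₀
  -- For `d < d₀` the foot is smooth, and for `d > d₀ / 2` the cutoff vanishes nearby; the two
  -- ranges cover the fluid.
  rcases lt_or_ge (bdryDist φ z₀.1 z₀.2) d₀ with hd | hd
  · obtain ⟨Y, hY, hev⟩ := h.exists_smooth_foot hd₀ hι hz₀ hd
    -- At the times `0` and `T` the distance is known to agree with `D` only for times in `[0, T]`,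
    -- whereas `D` is smooth across them.
    set D : ℝ × Space n → ℝ := fun z => ‖z.2 - Y z‖ with hD
    have hne : z₀.2 - Y z₀ ≠ 0 := by
      obtain ⟨-, h1, h2, -⟩ := hev.self_of_nhds hz₀.1
      rw [h1] at h2
      exact norm_pos_iff.1 h2
    have hDs : ContDiffAt ℝ ∞ D z₀ := (contDiffAt_snd.sub hY).norm ℝ hne
    have hDd : ∀ᶠ z in 𝓝 z₀, DifferentiableAt ℝ D z :=
      eventually_differentiableAt hDs
    have heq : ∀ᶠ z in 𝓝 z₀, z ∈ fluidRegion T φ →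
        projField χ d₀ φ i z = χ (D z / d₀) * spaceDeriv (basisVec i) D z := by
      filter_upwards [hev.eventually_nhds, hDd] with z hz hzd hzf
      have h1 : distFun φ z = D z := (hz.self_of_nhds hzf.1).2.1
      have h2 : bdryDist φ z.1 =ᶠ[𝓝 z.2] fun x => D (z.1, x) := by
        have h3 : ContinuousAt (fun x : Space n => ((z.1, x) : ℝ × Space n)) z.2 := by fun_prop
        filter_upwards [h3.eventually hz] with x hx using (hx hzf.1).2.1
      rw [projField, h1, pd, h2.fderiv_eq, fderiv_slice (F := D) (t := z.1) (x := z.2) hzd]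
    have hcont : ContinuousAt (fun z => χ (D z / d₀) * spaceDeriv (basisVec i) D z) z₀ := by
      refine (hχ.smooth.continuous.continuousAt.comp (hDs.continuousAt.div_const d₀)).mul ?_
      exact (contDiffAt_spaceDeriv hDs (m := 0) (by simp) _).continuousAt
    refine hcont.continuousWithinAt.congr_of_eventuallyEq ?_ (heq.self_of_nhds hz₀)
    filter_upwards [mem_nhdsWithin_of_mem_nhds heq, self_mem_nhdsWithin] with z hz hzf using hz hzf
  · have h0 := h.projField_eventuallyEq_zero hχ hd₀ hz₀ (by linarith) i
    refine (continuousWithinAt_const (b := (0 : ℝ))).congr_of_eventuallyEq ?_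
      (h0.self_of_nhds hz₀)
    filter_upwards [mem_nhdsWithin_of_mem_nhds h0, self_mem_nhdsWithin] with z hz hzf using hz hzf

lemma projField_eventuallyEq (i : Fin n) {z₀ : ℝ × Space n}
    (hd : ∀ᶠ z in 𝓝 z₀, DifferentiableAt ℝ (distFun φ) z) :
    projField χ d₀ φ i =ᶠ[𝓝 z₀]
      fun z => χ (distFun φ z / d₀) * spaceDeriv (basisVec i) (distFun φ) z := by
  filter_upwards [hd] with z hz
  rw [projField, pd_bdryDist_eq hz]

lemma contDiffAt_projField [NeZero n] (h : IsSmoothSolution T ς φ v B p) (hχ : IsCutoff χ)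
    (hd₀ : 0 < d₀) (hι : ∀ t ∈ Icc 0 T, ENNReal.ofReal d₀ < injRadius φ t) (i : Fin n)
    {z₀ : ℝ × Space n} (hz₀ : z₀ ∈ openFluidRegion T φ) :
    ContDiffAt ℝ 1 (projField χ d₀ φ i) z₀ := by
  rcases lt_or_ge (bdryDist φ z₀.1 z₀.2) d₀ with hd | hd
  · obtain ⟨Y, hY, hds, hev⟩ := h.exists_smooth_foot_of_mem hd₀ hι hz₀ hd
    refine ContDiffAt.congr_of_eventuallyEq ?_
      (projField_eventuallyEq i (hev.mono fun z hz => hz.2.2.2.1))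
    refine ContDiffAt.mul ?_ (contDiffAt_spaceDeriv hds (by norm_cast) _)
    exact ((hχ.smooth.of_le (by norm_cast)).contDiffAt).comp z₀
      ((hds.of_le (by norm_cast)).div_const d₀)
  · have h0 := h.projField_eventuallyEq_zero hχ hd₀ (openFluidRegion_subset _ _ hz₀)
      (by linarith) i
    refine (contDiffAt_const (c := (0 : ℝ))).congr_of_eventuallyEq ?_
    filter_upwards [h0, (isOpen_openFluidRegion T h.continuous_phi).mem_nhds hz₀] with z hz hzm
      using hz (openFluidRegion_subset _ _ hzm)

/-- The derivative of the projection field in an arbitrary spacetime direction. -/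
lemma fderiv_projField (hχ : IsCutoff χ) (i : Fin n) {z₀ : ℝ × Space n}
    (hds : ContDiffAt ℝ ∞ (distFun φ) z₀) (u : ℝ × Space n) :
    fderiv ℝ (projField χ d₀ φ i) z₀ u
      = deriv χ (distFun φ z₀ / d₀) * (fderiv ℝ (distFun φ) z₀ u / d₀)
          * spaceDeriv (basisVec i) (distFun φ) z₀
        + χ (distFun φ z₀ / d₀) * fderiv ℝ (spaceDeriv (basisVec i) (distFun φ)) z₀ u := by
  have hd : ∀ᶠ z in 𝓝 z₀, DifferentiableAt ℝ (distFun φ) z :=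
    eventually_differentiableAt hds
  rw [(projField_eventuallyEq i hd).fderiv_eq]
  have h1 : HasDerivAt χ (deriv χ (distFun φ z₀ / d₀)) (distFun φ z₀ / d₀) :=
    (hχ.smooth.differentiable (by simp) _).hasDerivAt
  have h2 : HasFDerivAt (fun z => distFun φ z * d₀⁻¹) _ z₀ :=
    hd.self_of_nhds.hasFDerivAt.mul_const d₀⁻¹
  simp only [div_eq_mul_inv] at h1 ⊢
  have h3 : HasFDerivAt (fun z => χ (distFun φ z * d₀⁻¹)) _ z₀ := h1.comp_hasFDerivAt z₀ h2
  have h4 := ((contDiffAt_spaceDeriv hds (m := 1) (by norm_cast) (basisVec i)).differentiableAt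
    one_ne_zero).hasFDerivAt
  have h5 : HasFDerivAt (fun z => χ (distFun φ z * d₀⁻¹) * spaceDeriv (basisVec i) (distFun φ) z) _ z₀ :=
    h3.mul h4
  rw [h5.fderiv]
  simp only [add_apply, smul_apply, smul_eq_mul]
  ring

end IsSmoothSolution

lemma tensorNormSq_nonneg {n : ℕ} (A : Matrix (Fin n) (Fin n) ℝ) : 0 ≤ tensorNormSq A :=
  Finset.sum_nonneg fun _ _ => Finset.sum_nonneg fun _ _ => sq_nonneg _

lemma tensorNorm_sq {n : ℕ} (A : Matrix (Fin n) (Fin n) ℝ) : tensorNorm A ^ 2 = tensorNormSq A :=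
  Real.sq_sqrt (tensorNormSq_nonneg A)

lemma tensorNorm_nonneg {n : ℕ} (A : Matrix (Fin n) (Fin n) ℝ) : 0 ≤ tensorNorm A :=
  Real.sqrt_nonneg _

lemma abs_sum_mul_le_norm_mul_tensorNorm {n : ℕ} (A : Matrix (Fin n) (Fin n) ℝ) (w : Space n)
    (k : Fin n) : |∑ i, w i * A i k| ≤ ‖w‖ * tensorNorm A := by
  refine abs_le_of_sq_le_sq ?_ (mul_nonneg (norm_nonneg _) (tensorNorm_nonneg _))
  rw [mul_pow, tensorNorm_sq, EuclideanSpace.norm_sq_eq]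
  refine (Finset.sum_mul_sq_le_sq_mul_sq _ _ _).trans ?_
  simp only [Real.norm_eq_abs, sq_abs]
  refine mul_le_mul_of_nonneg_left ?_ (Finset.sum_nonneg fun _ _ => sq_nonneg _)
  exact Finset.sum_le_sum fun i _ => Finset.single_le_sum (f := fun j => A i j ^ 2)
    (fun _ _ => sq_nonneg _) (Finset.mem_univ k)

/-! ### Bounds for the derivatives of the projection field. -/

namespace IsSmoothSolution

variable {n : ℕ} {T ς : ℝ} {φ : ℝ → Space n → ℝ} {v B : ℝ → Space n → Space n}
  {p : ℝ → Space n → ℝ} {t : ℝ} {x y : Space n} {d₀ M : ℝ} {χ : ℝ → ℝ}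

lemma gradTensor_v (h : IsSmoothSolution T ς φ v B p) {z : ℝ × Space n}
    (hz : z ∈ closedRegion T φ) (i k : Fin n) :
    gradTensor (v z.1) z.2 i k = spaceDeriv (basisVec i) (fun z : ℝ × Space n => v z.1 z.2 k) z :=
  pd_slice (F := fun z : ℝ × Space n => v z.1 z.2 k) (t := z.1) (x := z.2)
    ((h.contDiffAt_v hz k).differentiableAt (by simp)) i

lemma gradTensor_B (h : IsSmoothSolution T ς φ v B p) {z : ℝ × Space n}
    (hz : z ∈ closedRegion T φ) (i k : Fin n) :
    gradTensor (B z.1) z.2 i k = spaceDeriv (basisVec i) (fun z : ℝ × Space n => B z.1 z.2 k) z :=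
  pd_slice (F := fun z : ℝ × Space n => B z.1 z.2 k) (t := z.1) (x := z.2)
    ((h.contDiffAt_B hz k).differentiableAt (by simp)) i

/-- The bound for the velocity gradient extends to the boundary. -/
lemma abs_spaceDeriv_v_le (h : IsSmoothSolution T ς φ v B p)
    (hM : ∀ t ∈ Icc 0 T, ∀ x ∈ dom φ t, tensorNorm (gradTensor (v t) x) ≤ M)
    {z : ℝ × Space n} (hz : z ∈ closedRegion T φ) (w : Space n) (k : Fin n) :
    |spaceDeriv w (fun z : ℝ × Space n => v z.1 z.2 k) z| ≤ M * ‖w‖ := by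
  have hin : ∀ x ∈ dom φ z.1,
      |spaceDeriv w (fun z : ℝ × Space n => v z.1 z.2 k) (z.1, x)| ≤ M * ‖w‖ := by
    intro x hx
    have hzx : ((z.1, x) : ℝ × Space n) ∈ closedRegion T φ :=
      fluidRegion_subset _ _ ⟨hz.1, hx⟩
    rw [spaceDeriv_eq_sum, mul_comm M]
    have h1 := abs_sum_mul_le_norm_mul_tensorNorm (gradTensor (v z.1) x) w k
    have h2 := fun i => h.gradTensor_v hzx i k
    simp only at h2
    simp only [h2] at h1
    exact h1.trans (mul_le_mul_of_nonneg_left (hM z.1 hz.1 x hx) (norm_nonneg _))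
  have hcont : ContinuousAt (fun x : Space n =>
      |spaceDeriv w (fun z : ℝ × Space n => v z.1 z.2 k) (z.1, x)|) z.2 := by
    have h1 : ContinuousAt (spaceDeriv w (fun z : ℝ × Space n => v z.1 z.2 k)) (z.1, z.2) :=
      (contDiffAt_spaceDeriv (h.contDiffAt_v hz k) (m := 0) (by simp) w).continuousAt
    exact (h1.comp (f := fun x : Space n => ((z.1, x) : ℝ × Space n))
      (Continuous.prodMk_right z.1).continuousAt).abs
  exact hcont.continuousWithinAt.closure_le (h.mem_closure_of_closedRegion hz)
    continuousWithinAt_const hin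

lemma abs_v_sub_le (h : IsSmoothSolution T ς φ v B p) (hM0 : 0 ≤ M)
    (hM : ∀ t ∈ Icc 0 T, ∀ x ∈ dom φ t, tensorNorm (gradTensor (v t) x) ≤ M)
    (ht : t ∈ Icc 0 T) (hsub : Metric.closedBall x ‖x - y‖ ⊆ closure (dom φ t)) (k : Fin n) :
    |v t x k - v t y k| ≤ M * ‖x - y‖ := by
  have hmem : ∀ u ∈ Metric.closedBall x ‖x - y‖, ((t, u) : ℝ × Space n) ∈ closedRegion T φ := by
    intro u hu
    have := hsub hu
    rw [h.closure_dom ht] at this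
    exact ⟨ht, this⟩
  have hder : ∀ u ∈ Metric.closedBall x ‖x - y‖, HasFDerivWithinAt (fun u => v t u k)
      ((fderiv ℝ (fun z : ℝ × Space n => v z.1 z.2 k) (t, u)).comp
        (ContinuousLinearMap.inr ℝ ℝ (Space n)))
      (Metric.closedBall x ‖x - y‖) u := fun u hu =>
    (hasFDerivAt_slice (F := fun z : ℝ × Space n => v z.1 z.2 k)
      ((h.contDiffAt_v (hmem u hu) k).differentiableAt (by simp))).hasFDerivWithinAt
  have hnorm : ∀ u ∈ Metric.closedBall x ‖x - y‖,
      ‖(fderiv ℝ (fun z : ℝ × Space n => v z.1 z.2 k) (t, u)).comp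
        (ContinuousLinearMap.inr ℝ ℝ (Space n))‖ ≤ M := fun u hu =>
    ContinuousLinearMap.opNorm_le_bound _ hM0 fun w => h.abs_spaceDeriv_v_le hM (hmem u hu) w k
  have := (convex_closedBall x ‖x - y‖).norm_image_sub_le_of_norm_hasFDerivWithin_le hder hnorm
    (show y ∈ Metric.closedBall x ‖x - y‖ by rw [Metric.mem_closedBall, dist_eq_norm'])
    (Metric.mem_closedBall_self (norm_nonneg _))
  rwa [Real.norm_eq_abs] at this

lemma abs_spaceDeriv_distFun_le {z : ℝ × Space n} (hd : DifferentiableAt ℝ (distFun φ) z)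
    (w : Space n) : |spaceDeriv w (distFun φ) z| ≤ ‖w‖ := by
  have h1 := fderiv_slice (F := distFun φ) (t := z.1) (x := z.2) hd w
  rw [← h1]
  refine ((fderiv ℝ (bdryDist φ z.1) z.2).le_opNorm w).trans ?_
  exact (mul_le_mul_of_nonneg_right (norm_fderiv_bdryDist_le φ z.1 z.2) (norm_nonneg _)).trans_eq
    (one_mul _)

/-- The bound for the spatial derivatives of the projection field. -/
lemma abs_spaceDeriv_projField_le [NeZero n] (h : IsSmoothSolution T ς φ v B p)
    (hχ : IsCutoff χ) {Cχ : ℝ} (hC : ∀ s, |deriv χ s| ≤ Cχ) (hC0 : 0 ≤ Cχ)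
    (hd₀ : 0 < d₀) (hι : ∀ t ∈ Icc 0 T, ENNReal.ofReal d₀ < injRadius φ t)
    {z : ℝ × Space n} (hz : z ∈ openFluidRegion T φ) (i j : Fin n) :
    |spaceDeriv (basisVec j) (projField χ d₀ φ i) z| ≤ (Cχ + 4) / d₀ := by
  have hzc := openFluidRegion_subset _ _ hz
  rcases le_or_gt (bdryDist φ z.1 z.2) (d₀ / 2) with hd | hd
  · obtain ⟨Y, hY, hds, hev⟩ := h.exists_smooth_foot_of_mem hd₀ hι hz (by linarith)
    have hdd := hev.self_of_nhds.2.2.2.1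
    rw [spaceDeriv, fderiv_projField hχ i hds]
    have h1 := abs_spaceDeriv_distFun_le hdd (basisVec i)
    have h2 := abs_spaceDeriv_distFun_le hdd (basisVec j)
    have h3 := h.abs_hessian_distFun_le hzc.1 hd₀ (hι z.1 hzc.1) hzc.2 hd
      (hds.of_le (by norm_cast)) j i
    simp only [PiLp.norm_single, norm_one] at h1 h2
    change |deriv χ _ * (spaceDeriv (basisVec j) (distFun φ) z / d₀) * _ + _ *
      spaceDeriv (basisVec j) (spaceDeriv (basisVec i) (distFun φ)) z| ≤ _
    refine (abs_add_le _ _).trans ?_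
    rw [abs_mul, abs_mul, abs_mul, abs_div, abs_of_pos hd₀]
    have h4 : |deriv χ (distFun φ z / d₀)| * (|spaceDeriv (basisVec j) (distFun φ) z| / d₀)
        * |spaceDeriv (basisVec i) (distFun φ) z| ≤ Cχ * (1 / d₀) * 1 := by
      gcongr
      exact hC _
    have h5 : |χ (distFun φ z / d₀)|
        * |spaceDeriv (basisVec j) (spaceDeriv (basisVec i) (distFun φ)) z| ≤ 1 * (4 / d₀) := by
      gcongr
      exact hχ.abs_le_one _
    refine (add_le_add h4 h5).trans_eq ?_
    ring
  · have h0 := h.projField_eventuallyEq_zero hχ hd₀ hzc hd i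
    have h1 : projField χ d₀ φ i =ᶠ[𝓝 z] fun _ => 0 := by
      filter_upwards [h0, (isOpen_openFluidRegion T h.continuous_phi).mem_nhds hz] with q hq hqm
        using hq (openFluidRegion_subset _ _ hqm)
    rw [spaceDeriv, h1.fderiv_eq]
    simp only [fderiv_fun_const, Pi.zero_apply, _root_.zero_apply, abs_zero]
    positivity

/-- The material derivative of the distance function near the boundary. -/
lemma abs_flowDeriv_distFun_le [NeZero n] (h : IsSmoothSolution T ς φ v B p) (hM0 : 0 ≤ M)
    (hM : ∀ t ∈ Icc 0 T, ∀ x ∈ dom φ t, tensorNorm (gradTensor (v t) x) ≤ M)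
    (hd₀ : 0 < d₀) (hι : ∀ t ∈ Icc 0 T, ENNReal.ofReal d₀ < injRadius φ t)
    {z : ℝ × Space n} (hz : z ∈ openFluidRegion T φ) (hd : bdryDist φ z.1 z.2 ≤ d₀ / 2) :
    |flowDeriv (v z.1 z.2) (distFun φ) z| ≤ n * M * d₀ ∧ ∀ i,
    |flowDeriv (v z.1 z.2) (spaceDeriv (basisVec i) (distFun φ)) z| ≤ n * (4 + 4 * n) * M := by
  have hzc := openFluidRegion_subset _ _ hz
  have hzcc := fluidRegion_subset _ _ hzc
  obtain ⟨Y, hY, hds, hev⟩ := h.exists_smooth_foot_of_mem hd₀ hι hz (by linarith)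
  obtain ⟨-, hYf, hYd, hdd, hYdiff⟩ := hev.self_of_nhds
  have hYcl : ((z.1, Y z) : ℝ × Space n) ∈ closedRegion T φ :=
    h.mem_closedRegion_of_frontier hzc.1 hYf
  have hsub : Metric.closedBall z.2 ‖z.2 - Y z‖ ⊆ closure (dom φ z.1) := by
    rw [← hYd]
    exact closedBall_infDist_frontier_subset (h.isOpen_dom z.1) hzc.2
  have hn1 : ∀ k : Fin n, |spaceDeriv (basisVec k) (distFun φ) z| ≤ 1 := fun k => by
    simpa using abs_spaceDeriv_distFun_le hdd (basisVec k)
  have hdiff : ∀ k, |v z.1 z.2 k - v z.1 (Y z) k| ≤ M * (d₀ / 2) := fun k => by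
    refine (h.abs_v_sub_le hM0 hM hzc.1 hsub k).trans ?_
    rw [← hYd]
    exact mul_le_mul_of_nonneg_left hd hM0
  -- By `flowDeriv_distFun` the material derivative of `d` is `(v(x) - v(Y)) · ∂d`. The velocity
  -- difference is at most `M d` in each component, so the cutoff's `1 / d₀` will be compensated.
  set E : ℝ × Space n → ℝ := fun q =>
    ∑ k, (v q.1 q.2 k - v q.1 (Y q) k) * spaceDeriv (basisVec k) (distFun φ) q with hE
  have hflow : (fun q => flowDeriv (v q.1 q.2) (distFun φ) q) =ᶠ[𝓝 z] E := by
    filter_upwards [hev.eventually_nhds] with q hq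
    obtain ⟨h1, -, -, h4, h5⟩ := hq.self_of_nhds
    have hq' : ∀ᶠ z in 𝓝 q, Y z ∈ frontier (dom φ z.1) ∧ bdryDist φ z.1 z.2 = ‖z.2 - Y z‖ :=
      hq.mono fun z hz => ⟨hz.2.1, hz.2.2.1⟩
    rw [h.flowDeriv_distFun h1 h4 h5 hq', spaceDeriv_eq_sum, hE]
    simp
  constructor
  · have h0 : flowDeriv (v z.1 z.2) (distFun φ) z = E z := hflow.self_of_nhds
    rw [h0, hE]
    refine (Finset.abs_sum_le_sum_abs _ _).trans ?_
    calc ∑ k, |(v z.1 z.2 k - v z.1 (Y z) k) * spaceDeriv (basisVec k) (distFun φ) z|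
        ≤ ∑ _k : Fin n, M * (d₀ / 2) * 1 := Finset.sum_le_sum fun k _ => by
          rw [abs_mul]
          exact mul_le_mul (hdiff k) (hn1 k) (abs_nonneg _) (by positivity)
      _ = n * M * d₀ / 2 := by
          rw [Finset.sum_const, Finset.card_univ, Fintype.card_fin, nsmul_eq_mul]
          ring
      _ ≤ n * M * d₀ := by
          have : 0 ≤ n * M * d₀ := by positivity
          linarith
  · intro i
    have hhess : ∀ k, |spaceDeriv (basisVec i) (spaceDeriv (basisVec k) (distFun φ)) z| ≤ 4 / d₀ :=
      fun k => h.abs_hessian_distFun_le hzc.1 hd₀ (hι z.1 hzc.1) hzc.2 hd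
        (hds.of_le (by norm_cast)) i k
    have hds2 : ∀ k, DifferentiableAt ℝ (spaceDeriv (basisVec k) (distFun φ)) z := fun k =>
      (contDiffAt_spaceDeriv hds (m := 1) (by norm_cast) _).differentiableAt one_ne_zero
    -- the nearest point map is Lipschitz
    set Y' := fderiv ℝ Y z (0, basisVec i) with hY'
    -- From `Y = x - d ∂d` the entries of `∂Y` are at most `1 + (d₀/2)(4/d₀) + 1 = 4`.
    have hYeq : ∀ k, (fun q => Y q k) =ᶠ[𝓝 z] fun q =>
        q.2 k - distFun φ q * spaceDeriv (basisVec k) (distFun φ) q := fun k => by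
      filter_upwards [hev] with q hq
      have h1 := distFun_mul_spaceDeriv (t := q.1) (x := q.2) hq.2.2.2.1 hq.2.1 hq.2.2.1 (basisVec k)
      simp only [EuclideanSpace.inner_single_right, conj_trivial, one_mul] at h1
      change distFun φ q * spaceDeriv (basisVec k) (distFun φ) q = (q.2 - Y q) k at h1
      rw [h1]
      simp
    have hYk : ∀ k, |Y' k| ≤ 4 := fun k => by
      have h1 : HasFDerivAt (fun q => Y q k) ((EuclideanSpace.proj (𝕜 := ℝ) k).comp (fderiv ℝ Y z)) z :=
        HasFDerivAt.comp (g := fun u : Space n => u k) z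
          (EuclideanSpace.proj (𝕜 := ℝ) k : Space n →L[ℝ] ℝ).hasFDerivAt hYdiff.hasFDerivAt
      have h2 : HasFDerivAt (fun q : ℝ × Space n => q.2 k) ((EuclideanSpace.proj (𝕜 := ℝ) k).comp
          (ContinuousLinearMap.snd ℝ ℝ (Space n))) z :=
        HasFDerivAt.comp (g := fun u : Space n => u k) z
          (EuclideanSpace.proj (𝕜 := ℝ) k : Space n →L[ℝ] ℝ).hasFDerivAt hasFDerivAt_snd
      have h3 : HasFDerivAt (fun q : ℝ × Space n =>
          q.2 k - distFun φ q * spaceDeriv (basisVec k) (distFun φ) q) _ z :=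
        h2.sub (hdd.hasFDerivAt.mul (hds2 k).hasFDerivAt)
      have h4 : fderiv ℝ (fun q => (Y q k : ℝ)) z = fderiv ℝ (fun q : ℝ × Space n =>
          q.2 k - distFun φ q * spaceDeriv (basisVec k) (distFun φ) q) z :=
        Filter.EventuallyEq.fderiv_eq (hYeq k)
      rw [h1.fderiv, h3.fderiv] at h4
      have h5 := congrArg (fun L : ℝ × Space n →L[ℝ] ℝ => L (0, basisVec i)) h4
      simp only [ContinuousLinearMap.comp_apply, sub_apply, add_apply, smul_apply, smul_eq_mul,
        ContinuousLinearMap.coe_snd'] at h5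
      change Y' k = (basisVec i : Space n) k - (distFun φ z *
        spaceDeriv (basisVec i) (spaceDeriv (basisVec k) (distFun φ)) z +
        spaceDeriv (basisVec k) (distFun φ) z * spaceDeriv (basisVec i) (distFun φ) z) at h5
      rw [h5]
      have h6 : |(basisVec i : Space n) k| ≤ 1 := by
        have := PiLp.norm_apply_le (basisVec i : Space n) k
        simpa using this
      have h7 : |distFun φ z * spaceDeriv (basisVec i) (spaceDeriv (basisVec k) (distFun φ)) z| ≤ 2 := by
        rw [abs_mul]
        have h8 : |distFun φ z| ≤ d₀ / 2 := by
          rw [abs_of_nonneg (show 0 ≤ distFun φ z from Metric.infDist_nonneg)]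
          exact hd
        calc _ ≤ d₀ / 2 * (4 / d₀) := mul_le_mul h8 (hhess k) (abs_nonneg _) (by positivity)
          _ = 2 := by field_simp; norm_num
      have h9 : |spaceDeriv (basisVec k) (distFun φ) z * spaceDeriv (basisVec i) (distFun φ) z| ≤ 1 := by
        rw [abs_mul]
        exact mul_le_one₀ (hn1 k) (abs_nonneg _) (hn1 i)
      refine (abs_sub _ _).trans ?_
      have := abs_add_le (distFun φ z *
        spaceDeriv (basisVec i) (spaceDeriv (basisVec k) (distFun φ)) z)
        (spaceDeriv (basisVec k) (distFun φ) z * spaceDeriv (basisVec i) (distFun φ) z)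
      linarith
    have hY'n : ‖Y'‖ ≤ 4 * n := by
      refine (norm_le_sum_abs Y').trans ((Finset.sum_le_sum fun k _ => hYk k).trans_eq ?_)
      rw [Finset.sum_const, Finset.card_univ, Fintype.card_fin, nsmul_eq_mul, mul_comm]
    -- differentiate the formula for the material derivative
    have hvd : ∀ k, DifferentiableAt ℝ (fun q : ℝ × Space n => v q.1 q.2 k) z := fun k =>
      (h.contDiffAt_v hzcc k).differentiableAt (by simp)
    have hvY : ∀ k, HasFDerivAt (fun q : ℝ × Space n => v q.1 (Y q) k)
        ((fderiv ℝ (fun q : ℝ × Space n => v q.1 q.2 k) (z.1, Y z)).comp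
          ((ContinuousLinearMap.fst ℝ ℝ (Space n)).prod (fderiv ℝ Y z))) z := fun k =>
      HasFDerivAt.comp (g := fun q : ℝ × Space n => v q.1 q.2 k)
        (f := fun q : ℝ × Space n => (q.1, Y q)) z
        ((h.contDiffAt_v hYcl k).differentiableAt (by simp)).hasFDerivAt
        (hasFDerivAt_fst.prodMk hYdiff.hasFDerivAt)
    have hEd : spaceDeriv (basisVec i) E z = ∑ k,
        ((v z.1 z.2 k - v z.1 (Y z) k) * spaceDeriv (basisVec i) (spaceDeriv (basisVec k) (distFun φ)) z
          + spaceDeriv (basisVec k) (distFun φ) z *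
            (spaceDeriv (basisVec i) (fun q : ℝ × Space n => v q.1 q.2 k) z
              - spaceDeriv Y' (fun q : ℝ × Space n => v q.1 q.2 k) (z.1, Y z))) := by
      have h1 : HasFDerivAt E _ z := HasFDerivAt.fun_sum fun k _ =>
        ((hvd k).hasFDerivAt.sub (hvY k)).mul (hds2 k).hasFDerivAt
      rw [spaceDeriv, h1.fderiv]
      simp only [_root_.sum_apply, add_apply, smul_apply, sub_apply, smul_eq_mul,
        ContinuousLinearMap.comp_apply, ContinuousLinearMap.prod_apply,
        ContinuousLinearMap.coe_fst']
      rfl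
    have hcomm := spaceDeriv_flowDeriv (F := distFun φ) (w := fun q => v q.1 q.2) (z := z)
      (hds.of_le (by norm_cast)) hvd (basisVec i)
    have h1 : spaceDeriv (basisVec i) (fun q => flowDeriv (v q.1 q.2) (distFun φ) q) z
        = spaceDeriv (basisVec i) E z := by
      rw [spaceDeriv, hflow.fderiv_eq, spaceDeriv]
    rw [h1, hEd] at hcomm
    -- The commutator term `∂_i v^k ∂_k d` cancels the same term in `∂_i E`. What remains is a
    -- velocity difference times the Hessian of `d`, at most `2M` per summand, and the gradient of
    -- `v` at the foot along `∂_i Y`, at most `4nM`.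
    have h2 : flowDeriv (v z.1 z.2) (spaceDeriv (basisVec i) (distFun φ)) z = ∑ k,
        ((v z.1 z.2 k - v z.1 (Y z) k) * spaceDeriv (basisVec i) (spaceDeriv (basisVec k) (distFun φ)) z
          + spaceDeriv (basisVec k) (distFun φ) z *
            (spaceDeriv (basisVec i) (fun q : ℝ × Space n => v q.1 q.2 k) z
              - spaceDeriv Y' (fun q : ℝ × Space n => v q.1 q.2 k) (z.1, Y z))
          - spaceDeriv (basisVec i) (fun q : ℝ × Space n => v q.1 q.2 k) z
            * spaceDeriv (basisVec k) (distFun φ) z) := by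
      rw [Finset.sum_sub_distrib]
      linarith
    rw [h2]
    refine (Finset.abs_sum_le_sum_abs _ _).trans ?_
    have h3 : ∀ k, |spaceDeriv Y' (fun q : ℝ × Space n => v q.1 q.2 k) (z.1, Y z)| ≤ M * (4 * n) :=
      fun k => (h.abs_spaceDeriv_v_le hM hYcl Y' k).trans (mul_le_mul_of_nonneg_left hY'n hM0)
    have h5 : ∀ k, |(v z.1 z.2 k - v z.1 (Y z) k) *
        spaceDeriv (basisVec i) (spaceDeriv (basisVec k) (distFun φ)) z| ≤ 2 * M := fun k => by
      rw [abs_mul]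
      calc _ ≤ M * (d₀ / 2) * (4 / d₀) :=
            mul_le_mul (hdiff k) (hhess k) (abs_nonneg _) (by positivity)
        _ = 2 * M := by field_simp; ring
    calc _ ≤ ∑ _k : Fin n, (4 + 4 * n) * M := Finset.sum_le_sum fun k _ => by
          have h6 : (v z.1 z.2 k - v z.1 (Y z) k) *
              spaceDeriv (basisVec i) (spaceDeriv (basisVec k) (distFun φ)) z
              + spaceDeriv (basisVec k) (distFun φ) z *
                (spaceDeriv (basisVec i) (fun q : ℝ × Space n => v q.1 q.2 k) z
                  - spaceDeriv Y' (fun q : ℝ × Space n => v q.1 q.2 k) (z.1, Y z))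
              - spaceDeriv (basisVec i) (fun q : ℝ × Space n => v q.1 q.2 k) z
                * spaceDeriv (basisVec k) (distFun φ) z
              = (v z.1 z.2 k - v z.1 (Y z) k) *
              spaceDeriv (basisVec i) (spaceDeriv (basisVec k) (distFun φ)) z
              - spaceDeriv (basisVec k) (distFun φ) z *
                spaceDeriv Y' (fun q : ℝ × Space n => v q.1 q.2 k) (z.1, Y z) := by ring
          rw [h6]
          refine (abs_sub _ _).trans ?_
          have h7 : |spaceDeriv (basisVec k) (distFun φ) z *
                spaceDeriv Y' (fun q : ℝ × Space n => v q.1 q.2 k) (z.1, Y z)|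
              ≤ 1 * (M * (4 * n)) := by
            rw [abs_mul]
            exact mul_le_mul (hn1 k) (h3 k) (abs_nonneg _) zero_le_one
          have := h5 k
          nlinarith
      _ = n * (4 + 4 * n) * M := by
          rw [Finset.sum_const, Finset.card_univ, Fintype.card_fin, nsmul_eq_mul]
          ring

/-- The bound for the material derivative of the projection field. -/
lemma abs_flowDeriv_projField_le [NeZero n] (h : IsSmoothSolution T ς φ v B p)
    (hχ : IsCutoff χ) {Cχ : ℝ} (hC : ∀ s, |deriv χ s| ≤ Cχ) (hC0 : 0 ≤ Cχ) (hM0 : 0 ≤ M)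
    (hM : ∀ t ∈ Icc 0 T, ∀ x ∈ dom φ t, tensorNorm (gradTensor (v t) x) ≤ M)
    (hd₀ : 0 < d₀) (hι : ∀ t ∈ Icc 0 T, ENNReal.ofReal d₀ < injRadius φ t)
    {z : ℝ × Space n} (hz : z ∈ openFluidRegion T φ) (i : Fin n) :
    |flowDeriv (v z.1 z.2) (projField χ d₀ φ i) z| ≤ n * (Cχ + 4 + 4 * n) * M := by
  have hzc := openFluidRegion_subset _ _ hz
  rcases le_or_gt (bdryDist φ z.1 z.2) (d₀ / 2) with hd | hd
  · obtain ⟨Y, hY, hds, hev⟩ := h.exists_smooth_foot_of_mem hd₀ hι hz (by linarith)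
    have hdd := hev.self_of_nhds.2.2.2.1
    obtain ⟨h1, h2⟩ := h.abs_flowDeriv_distFun_le hM0 hM hd₀ hι hz hd
    rw [flowDeriv, fderiv_projField hχ i hds]
    change |deriv χ _ * (flowDeriv (v z.1 z.2) (distFun φ) z / d₀) * _ + _ *
      flowDeriv (v z.1 z.2) (spaceDeriv (basisVec i) (distFun φ)) z| ≤ _
    have h3 := abs_spaceDeriv_distFun_le hdd (basisVec i)
    simp only [PiLp.norm_single, norm_one] at h3
    refine (abs_add_le _ _).trans ?_
    rw [abs_mul, abs_mul, abs_mul, abs_div, abs_of_pos hd₀]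
    have h4 : |deriv χ (distFun φ z / d₀)| * (|flowDeriv (v z.1 z.2) (distFun φ) z| / d₀)
        * |spaceDeriv (basisVec i) (distFun φ) z| ≤ Cχ * (n * M * d₀ / d₀) * 1 := by
      gcongr
      exact hC _
    have h5 : |χ (distFun φ z / d₀)|
        * |flowDeriv (v z.1 z.2) (spaceDeriv (basisVec i) (distFun φ)) z|
        ≤ 1 * (n * (4 + 4 * n) * M) := by
      gcongr
      · exact hχ.abs_le_one _
      · exact h2 i
    refine (add_le_add h4 h5).trans_eq ?_
    field_simp
    ring
  · have h0 := h.projField_eventuallyEq_zero hχ hd₀ hzc hd i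
    have h1 : projField χ d₀ φ i =ᶠ[𝓝 z] fun _ => 0 := by
      filter_upwards [h0, (isOpen_openFluidRegion T h.continuous_phi).mem_nhds hz] with q hq hqm
        using hq (openFluidRegion_subset _ _ hqm)
    rw [flowDeriv, h1.fderiv_eq]
    simp only [fderiv_fun_const, Pi.zero_apply, _root_.zero_apply, abs_zero]
    positivity

end IsSmoothSolution

/-! ### Boundary behaviour of the pressure gradient and of the velocity. -/

namespace IsSmoothSolution

variable {n : ℕ} {T ς : ℝ} {φ : ℝ → Space n → ℝ} {v B : ℝ → Space n → Space n}
  {p : ℝ → Space n → ℝ} {t : ℝ} {x y : Space n} {d₀ : ℝ} {χ : ℝ → ℝ}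

lemma totalPressure_eq (h : IsSmoothSolution T ς φ v B p) (ht : t ∈ Icc 0 T)
    (hy : y ∈ frontier (dom φ t)) : totalPressure p B t y = ς ^ 2 / (8 * Real.pi) := by
  rw [totalPressure, h.p_zero t ht y hy, h.norm_B t ht y hy, zero_add]

lemma spaceDeriv_phi_eq (h : IsSmoothSolution T ς φ v B p) (t : ℝ) (y w : Space n) :
    spaceDeriv w (fun z : ℝ × Space n => φ z.1 z.2) (t, y) = inner ℝ (gradient (φ t) y) w := by
  rw [← inner_gradField, h.gradField_eq]

/-- At the boundary the spatial gradient of a function that is constant on the boundary is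
normal. -/
lemma exists_spaceDeriv_eq_mul (h : IsSmoothSolution T ς φ v B p) (ht : t ∈ Icc 0 T)
    (hy : y ∈ frontier (dom φ t)) {F : ℝ × Space n → ℝ} (hF : ContDiffAt ℝ 1 F (t, y))
    (hconst : ∀ u ∈ frontier (dom φ t), F (t, u) = F (t, y)) :
    ∃ c : ℝ, ∀ w, spaceDeriv w F (t, y)
      = c * spaceDeriv w (fun z : ℝ × Space n => φ z.1 z.2) (t, y) := by
  have hFs : HasStrictFDerivAt (fun u => F (t, u)) (fderiv ℝ (fun u => F (t, u)) y) y :=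
    ContDiffAt.hasStrictFDerivAt (n := 1) (ContDiffAt.comp y hF (contDiff_prodMk_right t).contDiffAt)
      (by simp)
  have hext : IsLocalExtrOn (fun u => F (t, u)) {x | φ t x = φ t y} y := by
    refine Or.inl (Filter.eventually_inf_principal.2 (Eventually.of_forall fun u hu => ?_))
    have hu' : u ∈ frontier (dom φ t) := by
      rw [h.frontier_dom ht]
      exact (show φ t u = φ t y from hu).trans (h.phi_eq_zero ht hy)
    exact (hconst u hu').ge
  obtain ⟨c, hc⟩ := exists_eq_smul_of_isLocalExtrOn hext (h.strict_slice t y)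
    (h.fderiv_slice_ne_zero ht hy) hFs
  refine ⟨c, fun w => ?_⟩
  rw [← fderiv_slice (hF.differentiableAt one_ne_zero), hc, _root_.smul_apply, smul_eq_mul,
    ← fderiv_slice (h.differentiableAt_phi _)]

/-- At the boundary the gradient of the total pressure is normal. -/
lemma spaceDeriv_totalPressure_eq (h : IsSmoothSolution T ς φ v B p) (ht : t ∈ Icc 0 T)
    (hy : y ∈ frontier (dom φ t)) (k : Fin n) :
    spaceDeriv (basisVec k) (fun z : ℝ × Space n => totalPressure p B z.1 z.2) (t, y)
      = normal φ t y k * ∑ l, normal φ t y l *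
        spaceDeriv (basisVec l) (fun z : ℝ × Space n => totalPressure p B z.1 z.2) (t, y) := by
  obtain ⟨c, hc⟩ := h.exists_spaceDeriv_eq_mul ht hy ((h.contDiffAt_totalPressure
    (h.mem_closedRegion_of_frontier ht hy)).of_le (by norm_cast)) fun u hu => by
      simp only [h.totalPressure_eq ht hu, h.totalPressure_eq ht hy]
  have h1 : ∀ l, spaceDeriv (basisVec l) (fun z : ℝ × Space n => totalPressure p B z.1 z.2) (t, y)
      = c * ‖gradient (φ t) y‖ * normal φ t y l := by
    intro l
    rw [hc, h.spaceDeriv_phi_eq,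
      show inner ℝ (gradient (φ t) y) (basisVec l)
        = ‖gradient (φ t) y‖ * inner ℝ (normal φ t y) (basisVec l) by
          conv_lhs => rw [h.gradient_eq ht hy]
          rw [real_inner_smul_left],
      EuclideanSpace.inner_single_right]
    simp [mul_assoc]
  have h3 : ∑ l, normal φ t y l ^ 2 = 1 := by
    have := EuclideanSpace.norm_sq_eq (normal φ t y)
    rw [h.norm_normal ht hy] at this
    simpa using this.symm
  simp only [h1]
  have h4 : ∑ l, normal φ t y l * (c * ‖gradient (φ t) y‖ * normal φ t y l)
      = c * ‖gradient (φ t) y‖ * ∑ l, normal φ t y l ^ 2 := by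
    rw [Finset.mul_sum]
    exact Finset.sum_congr rfl fun l _ => by ring
  rw [h4, h3]
  ring

/-- The projected gradient of the total pressure vanishes at the boundary. -/
lemma exists_abs_proj_totalPressure_le [NeZero n] (h : IsSmoothSolution T ς φ v B p)
    (hχ : IsCutoff χ) (hd₀ : 0 < d₀) (hι : ∀ t ∈ Icc 0 T, ENNReal.ofReal d₀ < injRadius φ t) :
    ∃ A : ℝ, 0 ≤ A ∧ ∀ z ∈ openFluidRegion T φ, ∀ k,
      |spaceDeriv (basisVec k) (fun z : ℝ × Space n => totalPressure p B z.1 z.2) z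
        - (∑ l, projField χ d₀ φ l z *
          spaceDeriv (basisVec l) (fun z : ℝ × Space n => totalPressure p B z.1 z.2) z)
          * projField χ d₀ φ k z| ≤ A * |φ z.1 z.2| := by
  set g : Fin n → ℝ × Space n → ℝ := fun k =>
    spaceDeriv (basisVec k) (fun z : ℝ × Space n => totalPressure p B z.1 z.2) with hg
  have hgc : ∀ k, ∀ z ∈ closedRegion T φ, ContDiffAt ℝ 1 (g k) z := fun k z hz =>
    contDiffAt_spaceDeriv (h.contDiffAt_totalPressure hz) (by norm_cast) _
  choose L hL0 hL using fun k => h.exists_lipschitz_nearest (hgc k)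
  choose A₀ hA₀0 hA₀ using fun k => h.exists_bound (g := g k) fun z hz => (hgc k z hz).continuousAt
  obtain ⟨A, hA0, hA⟩ := h.exists_bdryDist_le
  have hm : ∀ z l, |projField χ d₀ φ l z| ≤ 1 := fun z l => by
    have h1 := Finset.single_le_sum (f := fun i => projField χ d₀ φ i z ^ 2)
      (fun _ _ => sq_nonneg _) (Finset.mem_univ l)
    have h2 := h1.trans (sum_projField_sq_le hχ d₀ φ z)
    exact (sq_le_one_iff_abs_le_one _).1 h2
  set Q : ℝ := ∑ k, L k + (∑ k, A₀ k) * (4 / d₀) with hQ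
  have hLs : ∀ k, L k ≤ ∑ k, L k := fun k =>
    Finset.single_le_sum (fun i _ => hL0 i) (Finset.mem_univ k)
  have hAs : ∀ k, A₀ k ≤ ∑ k, A₀ k := fun k =>
    Finset.single_le_sum (fun i _ => hA₀0 i) (Finset.mem_univ k)
  have hsL : 0 ≤ ∑ k, L k := Finset.sum_nonneg fun k _ => hL0 k
  have hsA : 0 ≤ ∑ k, A₀ k := Finset.sum_nonneg fun k _ => hA₀0 k
  have hQ0 : 0 ≤ Q := by positivity
  -- For `d < d₀/4` the cutoff is `1` and `m = -N(Y)` is a unit normal, so the projection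
  -- annihilates the normal vector `∂P(Y)`, and `G` is the Lipschitz difference `∂P(x) - ∂P(Y)`.
  -- Farther inside `G = ∂P` suffices, since `1 ≤ (4 / d₀) d`. The two cases account for the two
  -- terms of `Q`.
  suffices H : ∀ z ∈ openFluidRegion T φ, ∃ G : Fin n → ℝ, (∀ k, |G k| ≤ Q * bdryDist φ z.1 z.2) ∧
      ∀ k, g k z - (∑ l, projField χ d₀ φ l z * g l z) * projField χ d₀ φ k z
        = G k - (∑ l, projField χ d₀ φ l z * G l) * projField χ d₀ φ k z by
    refine ⟨(1 + n) * (Q * A), by positivity, fun z hz k => ?_⟩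
    obtain ⟨G, hG, hGe⟩ := H z hz
    rw [hGe]
    have hd0 : 0 ≤ bdryDist φ z.1 z.2 := Metric.infDist_nonneg
    have h1 : |(∑ l, projField χ d₀ φ l z * G l) * projField χ d₀ φ k z|
        ≤ n * (Q * bdryDist φ z.1 z.2) := by
      rw [abs_mul]
      have h2 : |∑ l, projField χ d₀ φ l z * G l| ≤ n * (Q * bdryDist φ z.1 z.2) := by
        refine (Finset.abs_sum_le_sum_abs _ _).trans ?_
        calc _ ≤ ∑ _l : Fin n, 1 * (Q * bdryDist φ z.1 z.2) := Finset.sum_le_sum fun l _ => by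
              rw [abs_mul]
              exact mul_le_mul (hm z l) (hG l) (abs_nonneg _) zero_le_one
          _ = _ := by simp
      calc _ ≤ n * (Q * bdryDist φ z.1 z.2) * 1 :=
            mul_le_mul h2 (hm z k) (abs_nonneg _) (by positivity)
        _ = _ := mul_one _
    have h3 := hA z (openFluidRegion_subset _ _ hz)
    calc _ ≤ (1 + n) * (Q * bdryDist φ z.1 z.2) := by
          refine (abs_sub _ _).trans ?_
          have := hG k
          linarith
      _ ≤ (1 + n) * (Q * (A * |φ z.1 z.2|)) := by gcongr
      _ = _ := by ring
  intro z hz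
  have hzc := openFluidRegion_subset _ _ hz
  rcases lt_or_ge (bdryDist φ z.1 z.2) (d₀ / 4) with hd | hd
  · obtain ⟨Y, -, -, hev⟩ := h.exists_smooth_foot_of_mem hd₀ hι hz (by linarith)
    obtain ⟨-, hYf, hYd, hdd, -⟩ := hev.self_of_nhds
    have hpos := h.bdryDist_pos hzc.1 hzc.2
    have hsub : Metric.closedBall z.2 (dist z.2 (Y z)) ⊆ closure (dom φ z.1) := by
      rw [dist_eq_norm, ← hYd]
      exact closedBall_infDist_frontier_subset (h.isOpen_dom z.1) hzc.2
    have hmk : ∀ k, projField χ d₀ φ k z = -normal φ z.1 (Y z) k := by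
      intro k
      have h1 := distFun_mul_spaceDeriv (t := z.1) (x := z.2) hdd hYf hYd (basisVec k)
      have h2 := h.eq_sub_normal hzc.1 hzc.2 hYf (by rw [hYd, dist_eq_norm])
      have h3 : z.2 - Y z = -(bdryDist φ z.1 z.2 • normal φ z.1 (Y z)) := by
        conv_lhs => rw [h2]
        abel
      rw [h3] at h1
      simp only [EuclideanSpace.inner_single_right, conj_trivial, one_mul, PiLp.neg_apply,
        PiLp.smul_apply, smul_eq_mul, ← mul_neg] at h1
      have h4 := mul_left_cancel₀ hpos.ne' h1
      have h5 : distFun φ z / d₀ < 1 / 4 := by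
        rw [div_lt_iff₀ hd₀]
        change bdryDist φ z.1 z.2 < _
        linarith
      rw [projField, hχ.eq_one _ h5, one_mul, pd_bdryDist_eq hdd]
      exact h4
    refine ⟨fun k => g k z - g k (z.1, Y z), fun k => ?_, fun k => ?_⟩
    · refine (hL k z.1 hzc.1 z.2 (Y z) hsub).trans ?_
      rw [dist_eq_norm, ← hYd]
      refine mul_le_mul_of_nonneg_right ((hLs k).trans ?_) hpos.le
      rw [hQ]
      have : 0 ≤ (∑ k, A₀ k) * (4 / d₀) := by positivity
      linarith
    · have h1 := h.spaceDeriv_totalPressure_eq hzc.1 hYf k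
      change g k (z.1, Y z) = normal φ z.1 (Y z) k * ∑ l, normal φ z.1 (Y z) l * g l (z.1, Y z) at h1
      simp only [mul_sub, Finset.sum_sub_distrib]
      simp only [hmk, neg_mul, Finset.sum_neg_distrib]
      linear_combination h1
  · refine ⟨fun k => g k z, fun k => ?_, fun k => rfl⟩
    refine (hA₀ k z (fluidRegion_subset _ _ hzc)).trans ?_
    calc A₀ k ≤ (∑ k, A₀ k) * (4 / d₀) * (d₀ / 4) := by
          have : (∑ k, A₀ k) * (4 / d₀) * (d₀ / 4) = ∑ k, A₀ k := by field_simp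
          rw [this]
          exact hAs k
      _ ≤ Q * bdryDist φ z.1 z.2 := by
          refine mul_le_mul ?_ hd (by positivity) hQ0
          rw [hQ]
          linarith

/-- The velocity is tangent to the moving boundary. -/
lemma exists_abs_flowDeriv_phi_le [NeZero n] (h : IsSmoothSolution T ς φ v B p) :
    ∃ A : ℝ, 0 ≤ A ∧ ∀ z ∈ fluidRegion T φ,
      |flowDeriv (v z.1 z.2) (fun z : ℝ × Space n => φ z.1 z.2) z| ≤ A * |φ z.1 z.2| := by
  refine h.exists_abs_le_of_vanish subset_rfl
    (g := fun z => flowDeriv (v z.1 z.2) (fun z : ℝ × Space n => φ z.1 z.2) z) (fun z hz => ?_)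
    fun z hz y hy => h.flowDeriv_phi_eq_zero hz.1 hy
  have h1 : ContDiffAt ℝ 1 (fderiv ℝ (fun z : ℝ × Space n => φ z.1 z.2)) z :=
    (h.smooth_dom.contDiffAt).fderiv_right (by norm_cast)
  exact h1.clm_apply (contDiffAt_const.prodMk ((h.smooth_v z.1 hz.1 z.2
    (h.mem_closure_of_closedRegion hz)).of_le (by norm_cast)))

end IsSmoothSolution

/-! ### Evolution of `∂v` and `∂B`, and propagation of `div B = 0`. -/

variable {n : ℕ}

/-- A component of a time dependent vector field, as a function on spacetime. -/
abbrev coord (w : ℝ → Space n → Space n) (k : Fin n) : ℝ × Space n → ℝ := fun z => w z.1 z.2 k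

/-- The total pressure as a function on spacetime. -/
noncomputable abbrev pressureFun (p : ℝ → Space n → ℝ) (B : ℝ → Space n → Space n) :
    ℝ × Space n → ℝ := fun z => totalPressure p B z.1 z.2

/-- The level set function as a function on spacetime. -/
abbrev levelFun (φ : ℝ → Space n → ℝ) : ℝ × Space n → ℝ := fun z => φ z.1 z.2

/-- The matrix `∂_i w_j` as a function on spacetime. -/
noncomputable def gradMat (w : ℝ → Space n → Space n) (z : ℝ × Space n) :
    Matrix (Fin n) (Fin n) ℝ := fun i j => spaceDeriv (basisVec i) (coord w j) z

lemma spaceDeriv_coord (u : Space n) (w : ℝ → Space n → Space n) (j : Fin n) (z : ℝ × Space n) :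
    spaceDeriv u (coord w j) z = ∑ i, u i * gradMat w z i j := spaceDeriv_eq_sum u _ z

lemma contDiffAt_flowDeriv_field {F : ℝ × Space n → ℝ} {w : ℝ × Space n → Space n} {z : ℝ × Space n}
    {m k : WithTop ℕ∞} (hF : ContDiffAt ℝ k F z) (hw : ContDiffAt ℝ m w z) (hk : m + 1 ≤ k) :
    ContDiffAt ℝ m (fun z => flowDeriv (w z) F z) z :=
  (hF.fderiv_right hk).clm_apply (contDiffAt_const.prodMk hw)

lemma contDiffAt_spaceDeriv_field {F : ℝ × Space n → ℝ} {w : ℝ × Space n → Space n} {z : ℝ × Space n}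
    {m k : WithTop ℕ∞} (hF : ContDiffAt ℝ k F z) (hw : ContDiffAt ℝ m w z) (hk : m + 1 ≤ k) :
    ContDiffAt ℝ m (fun z => spaceDeriv (w z) F z) z :=
  (hF.fderiv_right hk).clm_apply (contDiffAt_const.prodMk hw)

lemma flowDeriv_sum {ι : Type*} (s : Finset ι) {F : ι → ℝ × Space n → ℝ} {z : ℝ × Space n}
    (hF : ∀ i ∈ s, DifferentiableAt ℝ (F i) z) (w : Space n) :
    flowDeriv w (fun z => ∑ i ∈ s, F i z) z = ∑ i ∈ s, flowDeriv w (F i) z := by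
  rw [flowDeriv, fderiv_fun_sum hF, _root_.sum_apply]
  rfl

lemma spaceDeriv_sum {ι : Type*} (s : Finset ι) {F : ι → ℝ × Space n → ℝ} {z : ℝ × Space n}
    (hF : ∀ i ∈ s, DifferentiableAt ℝ (F i) z) (w : Space n) :
    spaceDeriv w (fun z => ∑ i ∈ s, F i z) z = ∑ i ∈ s, spaceDeriv w (F i) z := by
  rw [spaceDeriv, fderiv_fun_sum hF, _root_.sum_apply]
  rfl

lemma flowDeriv_mul {F G : ℝ × Space n → ℝ} {z : ℝ × Space n} (hF : DifferentiableAt ℝ F z)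
    (hG : DifferentiableAt ℝ G z) (w : Space n) :
    flowDeriv w (fun z => F z * G z) z = F z * flowDeriv w G z + flowDeriv w F z * G z := by
  rw [flowDeriv, fderiv_fun_mul hF hG]
  simp [flowDeriv, mul_comm]

lemma spaceDeriv_mul {F G : ℝ × Space n → ℝ} {z : ℝ × Space n} (hF : DifferentiableAt ℝ F z)
    (hG : DifferentiableAt ℝ G z) (w : Space n) :
    spaceDeriv w (fun z => F z * G z) z = F z * spaceDeriv w G z + spaceDeriv w F z * G z := by
  rw [spaceDeriv, fderiv_fun_mul hF hG]
  simp [spaceDeriv, mul_comm]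

namespace IsSmoothSolution

variable {T ς : ℝ} {φ : ℝ → Space n → ℝ} {v B : ℝ → Space n → Space n}
  {p : ℝ → Space n → ℝ} {t : ℝ} {x y : Space n} {z : ℝ × Space n}

lemma smooth_v_at (h : IsSmoothSolution T ς φ v B p) (hz : z ∈ closedRegion T φ) :
    ContDiffAt ℝ ∞ (fun z : ℝ × Space n => v z.1 z.2) z :=
  h.smooth_v z.1 hz.1 z.2 (h.mem_closure_of_closedRegion hz)

lemma smooth_B_at (h : IsSmoothSolution T ς φ v B p) (hz : z ∈ closedRegion T φ) :
    ContDiffAt ℝ ∞ (fun z : ℝ × Space n => B z.1 z.2) z :=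
  h.smooth_B z.1 hz.1 z.2 (h.mem_closure_of_closedRegion hz)

/-- Identities extend to the boundary by continuity. -/
lemma eq_zero_of_continuousAt (h : IsSmoothSolution T ς φ v B p) {g : ℝ × Space n → ℝ}
    (hg : ∀ z ∈ closedRegion T φ, ContinuousAt g z) (h0 : ∀ z ∈ fluidRegion T φ, g z = 0)
    (hz : z ∈ closedRegion T φ) : g z = 0 := by
  have hc : ContinuousAt (fun x : Space n => g (z.1, x)) z.2 :=
    ContinuousAt.comp (f := fun x : Space n => ((z.1, x) : ℝ × Space n)) (hg z hz)
      (Continuous.prodMk_right z.1).continuousAt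
  have h1 : ∀ x ∈ dom φ z.1, g (z.1, x) = 0 := fun x hx => h0 (z.1, x) ⟨hz.1, hx⟩
  refine le_antisymm ?_ ?_
  · exact hc.continuousWithinAt.closure_le (h.mem_closure_of_closedRegion hz)
      continuousWithinAt_const fun x hx => (h1 x hx).le
  · exact continuousWithinAt_const.closure_le (h.mem_closure_of_closedRegion hz)
      hc.continuousWithinAt fun x hx => (h1 x hx).ge

lemma flowDeriv_v (h : IsSmoothSolution T ς φ v B p) (hz : z ∈ fluidRegion T φ) (j : Fin n) :
    flowDeriv (v z.1 z.2) (coord v j) z = -spaceDeriv (basisVec j) (pressureFun p B) z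
      + 1 / (4 * Real.pi) * spaceDeriv (B z.1 z.2) (coord B j) z := by
  have hzc := fluidRegion_subset _ _ hz
  have h1 := h.momentum z.1 hz.1 z.2 hz.2 j
  rw [matDeriv_eq (f := fun s y => v s y j) ((h.contDiffAt_v hzc j).differentiableAt (by simp))] at h1
  have h2 : pd j (totalPressure p B z.1) z.2 = spaceDeriv (basisVec j) (pressureFun p B) z :=
    pd_slice (F := pressureFun p B) ((h.contDiffAt_totalPressure hzc).differentiableAt (by simp)) j
  have h3 : spaceDeriv (B z.1 z.2) (coord B j) z
      = ∑ k, B z.1 z.2 k * gradTensor (B z.1) z.2 k j := by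
    rw [spaceDeriv_coord]
    exact Finset.sum_congr rfl fun k _ => by rw [h.gradTensor_B hzc]; rfl
  rw [h2, ← h3] at h1
  change flowDeriv (v z.1 z.2) (coord v j) z + _ = _ at h1
  linarith

/-- Continuity carries the induction equation up to the boundary, where it is needed for the
evolution of the normal component of `B`. -/
lemma flowDeriv_B (h : IsSmoothSolution T ς φ v B p) (hz : z ∈ closedRegion T φ) (j : Fin n) :
    flowDeriv (v z.1 z.2) (coord B j) z = spaceDeriv (B z.1 z.2) (coord v j) z := by
  refine sub_eq_zero.1 (h.eq_zero_of_continuousAt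
    (g := fun z => flowDeriv (v z.1 z.2) (coord B j) z - spaceDeriv (B z.1 z.2) (coord v j) z)
    (fun z hz => ?_) (fun z hz => sub_eq_zero.2 ?_) hz)
  · exact ((contDiffAt_flowDeriv_field (h.contDiffAt_B hz j)
      ((h.smooth_v_at hz).of_le (m := 0) (by simp)) (by simp)).sub
      (contDiffAt_spaceDeriv_field (h.contDiffAt_v hz j)
      ((h.smooth_B_at hz).of_le (m := 0) (by simp)) (by simp))).continuousAt
  · have hzc := fluidRegion_subset _ _ hz
    have h1 := h.induction z.1 hz.1 z.2 hz.2 j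
    rw [matDeriv_eq (f := fun s y => B s y j) ((h.contDiffAt_B hzc j).differentiableAt (by simp))] at h1
    simp only [h.gradTensor_v hzc] at h1
    rw [spaceDeriv_coord]
    exact h1

lemma trace_gradMat_v (h : IsSmoothSolution T ς φ v B p) (hz : z ∈ fluidRegion T φ) :
    (gradMat v z).trace = 0 := by
  have h1 := h.div_v z.1 hz.1 z.2 hz.2
  simp only [divergence, h.gradTensor_v (fluidRegion_subset _ _ hz)] at h1
  exact h1

lemma contDiffAt_gradMat_v (h : IsSmoothSolution T ς φ v B p) (hz : z ∈ closedRegion T φ)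
    (k i : Fin n) : ContDiffAt ℝ ∞ (fun z => gradMat v z k i) z :=
  contDiffAt_spaceDeriv (h.contDiffAt_v hz i) (by simp) _

lemma contDiffAt_gradMat_B (h : IsSmoothSolution T ς φ v B p) (hz : z ∈ closedRegion T φ)
    (k i : Fin n) : ContDiffAt ℝ ∞ (fun z => gradMat B z k i) z :=
  contDiffAt_spaceDeriv (h.contDiffAt_B hz i) (by simp) _

lemma eventually_mem_openFluidRegion (h : IsSmoothSolution T ς φ v B p)
    (hz : z ∈ openFluidRegion T φ) : ∀ᶠ z in 𝓝 z, z ∈ openFluidRegion T φ :=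
  (isOpen_openFluidRegion T h.continuous_phi).mem_nhds hz

/-- The evolution of the velocity gradient. -/
lemma flowDeriv_gradMat_v (h : IsSmoothSolution T ς φ v B p) (hz : z ∈ openFluidRegion T φ)
    (k i : Fin n) :
    flowDeriv (v z.1 z.2) (fun z => gradMat v z k i) z
      = -spaceDeriv (basisVec k) (spaceDeriv (basisVec i) (pressureFun p B)) z
        + 1 / (4 * Real.pi) * (spaceDeriv (B z.1 z.2) (fun z => gradMat B z k i) z
          + (gradMat B z * gradMat B z) k i) - (gradMat v z * gradMat v z) k i := by
  have hzc := fluidRegion_subset _ _ (openFluidRegion_subset _ _ hz)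
  have h1 := spaceDeriv_flowDeriv (F := coord v i) (w := fun q => v q.1 q.2) (z := z)
    ((h.contDiffAt_v hzc i).of_le (by norm_cast))
    (fun m => (h.contDiffAt_v hzc m).differentiableAt (by simp)) (basisVec k)
  have h2 : (fun q => flowDeriv (v q.1 q.2) (coord v i) q) =ᶠ[𝓝 z]
      fun q => -spaceDeriv (basisVec i) (pressureFun p B) q
        + 1 / (4 * Real.pi) * spaceDeriv (B q.1 q.2) (coord B i) q := by
    filter_upwards [h.eventually_mem_openFluidRegion hz] with q hq
    exact h.flowDeriv_v (openFluidRegion_subset _ _ hq) i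
  have h3 := spaceDeriv_spaceDeriv (F := coord B i) (w := fun q => B q.1 q.2) (z := z)
    ((h.contDiffAt_B hzc i).of_le (by norm_cast))
    (fun m => (h.contDiffAt_B hzc m).differentiableAt (by simp)) (basisVec k)
  have hPd : DifferentiableAt ℝ (spaceDeriv (basisVec i) (pressureFun p B)) z :=
    (contDiffAt_spaceDeriv (h.contDiffAt_totalPressure hzc) (m := 1)
      (by norm_cast) _).differentiableAt one_ne_zero
  have hBd : DifferentiableAt ℝ (fun q => spaceDeriv (B q.1 q.2) (coord B i) q) z :=
    (contDiffAt_spaceDeriv_field (h.contDiffAt_B hzc i) ((h.smooth_B_at hzc).of_le (m := 1)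
      (by norm_cast)) (by norm_cast)).differentiableAt one_ne_zero
  have h4 : spaceDeriv (basisVec k) (fun q => flowDeriv (v q.1 q.2) (coord v i) q) z
      = -spaceDeriv (basisVec k) (spaceDeriv (basisVec i) (pressureFun p B)) z
        + 1 / (4 * Real.pi) *
          spaceDeriv (basisVec k) (fun q => spaceDeriv (B q.1 q.2) (coord B i) q) z := by
    have h5 : HasFDerivAt (fun q => -spaceDeriv (basisVec i) (pressureFun p B) q
        + 1 / (4 * Real.pi) * spaceDeriv (B q.1 q.2) (coord B i) q) _ z :=
      (hPd.hasFDerivAt.neg).add (hBd.hasFDerivAt.const_mul _)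
    rw [spaceDeriv, h2.fderiv_eq, h5.fderiv]
    simp [spaceDeriv]
  rw [h1, h3] at h4
  simp only [Matrix.mul_apply]
  change flowDeriv (v z.1 z.2) (spaceDeriv (basisVec k) (coord v i)) z = _
  change flowDeriv (v z.1 z.2) (spaceDeriv (basisVec k) (coord v i)) z
    + ∑ m, gradMat v z k m * gradMat v z m i = _ + _ *
      (spaceDeriv (B z.1 z.2) (fun z => gradMat B z k i) z
        + ∑ m, gradMat B z k m * gradMat B z m i) at h4
  linarith

/-- The evolution of the gradient of the magnetic field. -/
lemma flowDeriv_gradMat_B (h : IsSmoothSolution T ς φ v B p) (hz : z ∈ openFluidRegion T φ)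
    (k i : Fin n) :
    flowDeriv (v z.1 z.2) (fun z => gradMat B z k i) z
      = spaceDeriv (B z.1 z.2) (fun z => gradMat v z k i) z
        + (gradMat B z * gradMat v z) k i - (gradMat v z * gradMat B z) k i := by
  have hzc := fluidRegion_subset _ _ (openFluidRegion_subset _ _ hz)
  have h1 := spaceDeriv_flowDeriv (F := coord B i) (w := fun q => v q.1 q.2) (z := z)
    ((h.contDiffAt_B hzc i).of_le (by norm_cast))
    (fun m => (h.contDiffAt_v hzc m).differentiableAt (by simp)) (basisVec k)
  have h2 : (fun q => flowDeriv (v q.1 q.2) (coord B i) q) =ᶠ[𝓝 z]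
      fun q => spaceDeriv (B q.1 q.2) (coord v i) q := by
    filter_upwards [h.eventually_mem_openFluidRegion hz] with q hq
    exact h.flowDeriv_B (fluidRegion_subset _ _ (openFluidRegion_subset _ _ hq)) i
  have h3 := spaceDeriv_spaceDeriv (F := coord v i) (w := fun q => B q.1 q.2) (z := z)
    ((h.contDiffAt_v hzc i).of_le (by norm_cast))
    (fun m => (h.contDiffAt_B hzc m).differentiableAt (by simp)) (basisVec k)
  rw [spaceDeriv, h2.fderiv_eq] at h1
  have h4 := h1.symm.trans h3
  simp only [Matrix.mul_apply]
  change flowDeriv (v z.1 z.2) (fun z => gradMat B z k i) z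
    + ∑ m, gradMat v z k m * gradMat B z m i = 
      spaceDeriv (B z.1 z.2) (fun z => gradMat v z k i) z
        + ∑ m, gradMat B z k m * gradMat v z m i at h4
  linarith

/-- Integrability of bounded continuous functions over the domain. -/
lemma integrableOn_dom (h : IsSmoothSolution T ς φ v B p) {f : ℝ × Space n → ℝ} {A : ℝ}
    (hfc : ContinuousOn f (fluidRegion T φ)) (hfA : ∀ z ∈ fluidRegion T φ, |f z| ≤ A)
    (ht : t ∈ Icc 0 T) : IntegrableOn (fun x => f (t, x)) (dom φ t) := by
  obtain ⟨R, hR⟩ := h.bounded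
  have hfin : volume (dom φ t) ≠ ⊤ :=
    ((measure_mono (hR t ht)).trans_lt measure_ball_lt_top).ne
  have hc : ContinuousOn (fun x => f (t, x)) (dom φ t) :=
    hfc.comp (Continuous.prodMk_right t).continuousOn fun x hx => ⟨ht, hx⟩
  refine IntegrableOn.of_bound hfin.lt_top
    (hc.aestronglyMeasurable (h.isOpen_dom t).measurableSet) A ?_
  exact ae_restrict_of_forall_mem (h.isOpen_dom t).measurableSet fun x hx => hfA (t, x) ⟨ht, hx⟩

/-- The transport inequality for the moving domain of a solution. -/
lemma integral_le [NeZero n] (h : IsSmoothSolution T ς φ v B p) {f : ℝ × Space n → ℝ}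
    {X : ℝ × Space n → Space n} {a : ℝ} (ha : 0 ≤ a)
    (hfc : ContinuousOn f (fluidRegion T φ)) (hf : ∀ z ∈ openFluidRegion T φ, ContDiffAt ℝ 1 f z)
    (hfA : ∃ A, ∀ z ∈ fluidRegion T φ, |f z| ≤ A)
    (hX : ∀ z ∈ openFluidRegion T φ, ∀ i, ContDiffAt ℝ 1 (fun y => X y i) z)
    (htan : ∃ A, ∀ z ∈ openFluidRegion T φ, |spaceDeriv (X z) (levelFun φ) z| ≤ A * |φ z.1 z.2|)
    (hineq : ∀ z ∈ openFluidRegion T φ, flowDeriv (v z.1 z.2) f z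
      ≤ ∑ i, spaceDeriv (basisVec i) (fun y => X y i) z + a * f z)
    (ht : t ∈ Icc 0 T) :
    ∫ x in dom φ t, f (t, x) ≤ Real.exp (a * t) * ∫ x in dom φ 0, f (0, x) := by
  obtain ⟨R, hR⟩ := h.exists_closedBall
  obtain ⟨A₁, hA₁⟩ := hfA
  obtain ⟨A₂, hA₂0, hA₂⟩ := h.exists_abs_flowDeriv_phi_le
  obtain ⟨A₃, hA₃⟩ := htan
  have hsub : ∀ z ∈ openFluidRegion T φ, z ∈ closedRegion T φ := fun z hz =>
    fluidRegion_subset _ _ (openFluidRegion_subset _ _ hz)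
  exact integral_dom_le (V := fun z => v z.1 z.2) (A := max A₁ (max A₂ A₃)) ha
    (le_max_of_le_right (le_max_of_le_left hA₂0))
    (h.smooth_dom.of_le (by norm_cast)) (fun z hz => hR z (fluidRegion_subset _ _ hz)) hfc hf
    (fun z hz i => (h.contDiffAt_v (hsub z hz) i).of_le (by norm_cast)) hX
    (fun z hz => h.trace_gradMat_v (openFluidRegion_subset _ _ hz))
    (fun z hz => (hA₂ z (openFluidRegion_subset _ _ hz)).trans
      (mul_le_mul_of_nonneg_right ((le_max_left _ _).trans (le_max_right _ _)) (abs_nonneg _)))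
    (fun z hz => (hA₃ z hz).trans
      (mul_le_mul_of_nonneg_right ((le_max_right _ _).trans (le_max_right _ _)) (abs_nonneg _)))
    (fun z hz => (hA₁ z hz).trans (le_max_left _ _)) hineq ht

/-- The constraint `div B = 0` is propagated. -/
lemma trace_gradMat_B [NeZero n] (h : IsSmoothSolution T ς φ v B p) (hz : z ∈ fluidRegion T φ) :
    (gradMat B z).trace = 0 := by
  -- `D_t div B = B · ∂ div v + tr (∂B ∂v - ∂v ∂B) = 0`, so the transport inequality with `X = 0`
  -- and `a = 0` applies to `(div B)²`. The square gives a sign: its integral starts at zero, hence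
  -- vanishes, and continuity yields the pointwise statement.
  set f : ℝ × Space n → ℝ := fun z => (gradMat B z).trace * (gradMat B z).trace with hf
  have htr : ∀ z ∈ closedRegion T φ, ContDiffAt ℝ ∞ (fun z => (gradMat B z).trace) z := fun z hz =>
    ContDiffAt.sum fun i _ => h.contDiffAt_gradMat_B hz i i
  have hfs : ∀ z ∈ closedRegion T φ, ContDiffAt ℝ ∞ f z := fun z hz => (htr z hz).mul (htr z hz)
  obtain ⟨A₁, hA₁0, hA₁⟩ := h.exists_bound fun z hz => (hfs z hz).continuousAt
  have hfc : ContinuousOn f (fluidRegion T φ) := fun z hz =>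
    (hfs z (fluidRegion_subset _ _ hz)).continuousAt.continuousWithinAt
  have hdiv : ∀ z ∈ openFluidRegion T φ, flowDeriv (v z.1 z.2) (fun z => (gradMat B z).trace) z = 0 := by
    intro z hz
    have hzc := fluidRegion_subset _ _ (openFluidRegion_subset _ _ hz)
    simp only [Matrix.trace, Matrix.diag_apply]
    rw [flowDeriv_sum _ fun i _ => (h.contDiffAt_gradMat_B hzc i i).differentiableAt (by simp)]
    simp only [h.flowDeriv_gradMat_B hz]
    rw [Finset.sum_sub_distrib, Finset.sum_add_distrib, ← spaceDeriv_sum _ fun i _ =>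
      (h.contDiffAt_gradMat_v hzc i i).differentiableAt (by simp)]
    have h1 : (fun z => ∑ i, gradMat v z i i) =ᶠ[𝓝 z] fun _ => 0 := by
      filter_upwards [h.eventually_mem_openFluidRegion hz] with q hq
      exact h.trace_gradMat_v (openFluidRegion_subset _ _ hq)
    have h2 : ∑ i, (gradMat B z * gradMat v z) i i = ∑ i, (gradMat v z * gradMat B z) i i :=
      Matrix.trace_mul_comm (gradMat B z) (gradMat v z)
    rw [spaceDeriv, h1.fderiv_eq, h2]
    simp
  have hint := h.integral_le (f := f) (X := fun _ => 0) le_rfl hfc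
    (fun z hz => (hfs z (fluidRegion_subset _ _ (openFluidRegion_subset _ _ hz))).of_le (by norm_cast))
    ⟨A₁, fun z hz => hA₁ z (fluidRegion_subset _ _ hz)⟩ (fun z hz i => contDiffAt_const)
    ⟨0, fun z hz => by
      have : spaceDeriv (0 : Space n) (levelFun φ) z = 0 := map_zero (fderiv ℝ (levelFun φ) z)
      rw [this, abs_zero, zero_mul]⟩
    (fun z hz => by
      have hd := (htr z (fluidRegion_subset _ _ (openFluidRegion_subset _ _ hz))).differentiableAt
        (by simp)
      rw [hf, flowDeriv_mul hd hd, hdiv z hz]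
      simp [spaceDeriv])
    hz.1
  have h0 : ∫ x in dom φ 0, f (0, x) = 0 := by
    refine setIntegral_eq_zero_of_forall_eq_zero fun x hx => ?_
    have h0T : (0 : ℝ) ∈ Icc 0 T := ⟨le_rfl, hz.1.1.trans hz.1.2⟩
    have h1 := h.div_B x hx
    simp only [divergence] at h1
    have h2 : ∀ j, gradTensor (B 0) x j j = gradMat B (0, x) j j := fun j =>
      h.gradTensor_B (z := (0, x)) (fluidRegion_subset _ _ ⟨h0T, hx⟩) j j
    simp only [h2] at h1
    have h3 : (gradMat B (0, x)).trace = 0 := h1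
    simp only [hf, h3, mul_zero]
  rw [h0, mul_zero] at hint
  have hnn : ∀ x, 0 ≤ f (z.1, x) := fun x => mul_self_nonneg _
  have hae := (setIntegral_eq_zero_iff_of_nonneg_ae (ae_of_all _ hnn)
    (h.integrableOn_dom hfc (fun z hz => hA₁ z (fluidRegion_subset _ _ hz)) hz.1)).1
    (le_antisymm hint (integral_nonneg hnn))
  have heq := Measure.eqOn_open_of_ae_eq hae (h.isOpen_dom z.1)
    (hfc.comp (Continuous.prodMk_right z.1).continuousOn fun x hx => ⟨hz.1, hx⟩) continuousOn_const
  exact mul_self_eq_zero.1 (heq hz.2)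

end IsSmoothSolution

/-! ### Tangency of the magnetic field to the moving boundary. -/

/-- The moving boundary as a subset of spacetime. -/
def boundaryRegion (T : ℝ) (φ : ℝ → Space n → ℝ) : Set (ℝ × Space n) :=
  {z | z.1 ∈ Icc 0 T ∧ φ z.1 z.2 = 0}

lemma boundaryRegion_subset (T : ℝ) (φ : ℝ → Space n → ℝ) :
    boundaryRegion T φ ⊆ closedRegion T φ := fun _ hz => ⟨hz.1, hz.2.le⟩

namespace IsSmoothSolution

variable {T ς : ℝ} {φ : ℝ → Space n → ℝ} {v B : ℝ → Space n → Space n}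
  {p : ℝ → Space n → ℝ} {t : ℝ} {x y : Space n} {z : ℝ × Space n}

lemma isCompact_boundaryRegion (h : IsSmoothSolution T ς φ v B p) :
    IsCompact (boundaryRegion T φ) := by
  refine h.isCompact_closedRegion.of_isClosed_subset ?_ (boundaryRegion_subset T φ)
  exact (isClosed_Icc.preimage continuous_fst).inter (isClosed_eq h.continuous_phi continuous_const)

lemma mem_frontier_of_boundaryRegion (h : IsSmoothSolution T ς φ v B p)
    (hz : z ∈ boundaryRegion T φ) : z.2 ∈ frontier (dom φ z.1) := by
  rw [h.frontier_dom hz.1]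
  exact hz.2

/-- The material derivative of the level set function has normal gradient at the boundary. -/
lemma exists_spaceDeriv_flowDeriv_phi (h : IsSmoothSolution T ς φ v B p) :
    ∃ Λ : ℝ, 0 ≤ Λ ∧ ∀ z ∈ boundaryRegion T φ, ∃ c : ℝ, |c| ≤ Λ ∧ ∀ w,
      spaceDeriv w (fun z => flowDeriv (v z.1 z.2) (levelFun φ) z) z
        = c * spaceDeriv w (levelFun φ) z := by
  set D : ℝ × Space n → ℝ := fun z => flowDeriv (v z.1 z.2) (levelFun φ) z with hD
  have hDs : ∀ z ∈ closedRegion T φ, ContDiffAt ℝ 1 D z := fun z hz =>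
    contDiffAt_flowDeriv_field (k := 2) (h.smooth_dom.contDiffAt.of_le (by norm_cast))
      ((h.smooth_v_at hz).of_le (by norm_cast)) (by norm_num)
  have hpos : ∀ z ∈ boundaryRegion T φ, 0 < spaceDeriv (gradField φ z) (levelFun φ) z := by
    intro z hz
    rw [← inner_gradField, real_inner_self_eq_norm_sq]
    have h1 := h.gradField_eq z.1 z.2
    rw [Prod.mk.eta] at h1
    rw [h1]
    have := norm_pos_iff.2 (h.regular z.1 hz.1 z.2 hz.2)
    positivity
  -- Testing the proportionality in the direction `∂φ` expresses the multiplier as a continuous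
  -- quotient, bounded on the compact boundary.
  have hcont : ContinuousOn (fun z => spaceDeriv (gradField φ z) D z /
      spaceDeriv (gradField φ z) (levelFun φ) z) (boundaryRegion T φ) := by
    intro z hz
    have hg : ContDiffAt ℝ 0 (gradField φ) z := (h.contDiff_gradField.of_le (by simp)).contDiffAt
    refine ContinuousAt.continuousWithinAt (ContinuousAt.div ?_ ?_ (hpos z hz).ne')
    · exact (contDiffAt_spaceDeriv_field (hDs z (boundaryRegion_subset _ _ hz)) hg
        (by simp)).continuousAt
    · exact (contDiffAt_spaceDeriv_field (k := 1) (h.smooth_dom.contDiffAt.of_le (by norm_cast)) hg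
        (by simp)).continuousAt
  obtain ⟨Λ, hΛ⟩ := h.isCompact_boundaryRegion.exists_bound_of_continuousOn hcont
  refine ⟨max Λ 0, le_max_right _ _, fun z hz => ?_⟩
  have hf := h.mem_frontier_of_boundaryRegion hz
  obtain ⟨c, hc⟩ := h.exists_spaceDeriv_eq_mul hz.1 hf (F := D)
    (hDs z (boundaryRegion_subset _ _ hz)) fun u hu =>
      (h.flowDeriv_phi_eq_zero hz.1 hu).trans (h.flowDeriv_phi_eq_zero hz.1 hf).symm
  rw [Prod.mk.eta] at hc
  refine ⟨c, ?_, hc⟩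
  have h1 := hΛ z hz
  rw [hc, mul_div_cancel_right₀ _ (hpos z hz).ne'] at h1
  exact h1.trans (le_max_left _ _)

/-- The evolution of the normal component of the magnetic field at the boundary. -/
lemma flowDeriv_normal_B (h : IsSmoothSolution T ς φ v B p) (hz : z ∈ closedRegion T φ) :
    flowDeriv (v z.1 z.2) (fun z => spaceDeriv (B z.1 z.2) (levelFun φ) z) z
      = spaceDeriv (B z.1 z.2) (fun z => flowDeriv (v z.1 z.2) (levelFun φ) z) z := by
  have hΦ : ContDiffAt ℝ 2 (levelFun φ) z := h.smooth_dom.contDiffAt.of_le (by norm_cast)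
  have hΦi : ∀ i, DifferentiableAt ℝ (spaceDeriv (basisVec i) (levelFun φ)) z := fun i =>
    (contDiffAt_spaceDeriv hΦ (m := 1) (by norm_num) _).differentiableAt one_ne_zero
  have hBd : ∀ i, DifferentiableAt ℝ (coord B i) z := fun i =>
    (h.contDiffAt_B hz i).differentiableAt (by simp)
  have h1 : (fun z => spaceDeriv (B z.1 z.2) (levelFun φ) z)
      = fun z => ∑ i, coord B i z * spaceDeriv (basisVec i) (levelFun φ) z :=
    funext fun z => spaceDeriv_eq_sum _ _ _
  rw [h1, flowDeriv_sum _ fun i _ => (hBd i).fun_mul (hΦi i)]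
  -- The commutator of `∂_i` with `D_t` contributes `-B^i (∂_i v^m) ∂_mφ`, which cancels, after
  -- renaming indices, the contribution of `D_t B = B · ∂v`. Hence `D_t` and `B · ∂` commute on `φ`.
  have h2 : ∀ i, flowDeriv (v z.1 z.2) (fun z => coord B i z * spaceDeriv (basisVec i) (levelFun φ) z) z
      = coord B i z * (spaceDeriv (basisVec i) (fun z => flowDeriv (v z.1 z.2) (levelFun φ) z) z
          - ∑ m, gradMat v z i m * spaceDeriv (basisVec m) (levelFun φ) z)
        + (∑ m, B z.1 z.2 m * gradMat v z m i) * spaceDeriv (basisVec i) (levelFun φ) z := by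
    intro i
    rw [flowDeriv_mul (hBd i) (hΦi i), h.flowDeriv_B hz, spaceDeriv_coord]
    have h3 := spaceDeriv_flowDeriv (w := fun q => v q.1 q.2) hΦ
      (fun m => (h.contDiffAt_v hz m).differentiableAt (by simp)) (basisVec i)
    rw [h3]
    change _ = coord B i z * (_ + ∑ m, gradMat v z i m * spaceDeriv (basisVec m) (levelFun φ) z
      - ∑ m, gradMat v z i m * spaceDeriv (basisVec m) (levelFun φ) z) + _
    ring
  simp only [h2, mul_sub, Finset.sum_add_distrib, Finset.sum_sub_distrib, Finset.mul_sum,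
    Finset.sum_mul]
  rw [spaceDeriv_eq_sum (B z.1 z.2), Finset.sum_comm (f := fun i m => coord B i z *
    (gradMat v z i m * spaceDeriv (basisVec m) (levelFun φ) z))]
  simp only [mul_assoc]
  abel

/-- The condition `B · N = 0` is propagated. -/
lemma normal_B_eq_zero (h : IsSmoothSolution T ς φ v B p) (hz : z ∈ boundaryRegion T φ)
    (hzT : z.1 < T) : spaceDeriv (B z.1 z.2) (levelFun φ) z = 0 := by
  set g : ℝ × Space n → ℝ := fun z => spaceDeriv (B z.1 z.2) (levelFun φ) z with hg
  obtain ⟨Λ, hΛ0, hΛ⟩ := h.exists_spaceDeriv_flowDeriv_phi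
  have hgs : ∀ z ∈ closedRegion T φ, ContDiffAt ℝ 1 g z := fun z hz =>
    contDiffAt_spaceDeriv_field (k := 2) (h.smooth_dom.contDiffAt.of_le (by norm_cast))
      ((h.smooth_B_at hz).of_le (by norm_cast)) (by norm_num)
  -- The maximum of `e g²` over the compact moving boundary is examined. If it is positive, the
  -- factor `T - t` keeps it away from time `T`, and the initial condition keeps it away from time
  -- `0`. The exponential beats the growth `D_t g = c g` with `c ≤ Λ`.
  set e : ℝ × Space n → ℝ := fun z => Real.exp (-(2 * Λ) * z.1) * (T - z.1) with he
  have hes : ContDiff ℝ 1 e := by fun_prop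
  have hus : ∀ z ∈ closedRegion T φ, ContDiffAt ℝ 1 (fun z => e z * (g z * g z)) z := fun z hz =>
    hes.contDiffAt.mul ((hgs z hz).mul (hgs z hz))
  by_contra hne
  have hposz : 0 < e z * (g z * g z) := by
    have h1 : 0 < T - z.1 := by linarith
    have h2 : 0 < g z * g z := mul_self_pos.2 hne
    simp only [he]
    positivity
  obtain ⟨q, hq, hmax⟩ := h.isCompact_boundaryRegion.exists_isMaxOn ⟨z, hz⟩
    (f := fun z => e z * (g z * g z))
    fun q hq => (hus q (boundaryRegion_subset _ _ hq)).continuousAt.continuousWithinAt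
  have hqc := boundaryRegion_subset _ _ hq
  have hposq : 0 < e q * (g q * g q) := hposz.trans_le (hmax hz)
  have hgq : g q ≠ 0 := fun h0 => by simp [h0] at hposq
  have hqT : q.1 < T := by
    refine lt_of_le_of_ne hq.1.2 fun h0 => ?_
    simp [he, h0] at hposq
  have hq0 : 0 < q.1 := by
    refine lt_of_le_of_ne hq.1.1 fun h0 => hgq ?_
    have h1 := h.mem_frontier_of_boundaryRegion hq
    have h2 := h.gradient_eq hq.1 h1
    have h3 := h.spaceDeriv_phi_eq q.1 q.2 (B q.1 q.2)
    rw [Prod.mk.eta] at h3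
    rw [← h0] at h1
    have h4 := h.B_tangent q.2 h1
    rw [hg]
    simp only
    rw [h3, h2, real_inner_smul_left, real_inner_comm, ← h0, h4, mul_zero]
  have hext : IsLocalExtrOn (fun z => e z * (g z * g z)) {z | levelFun φ z = levelFun φ q} q := by
    refine Or.inr (Filter.eventually_inf_principal.2 ?_)
    have h1 : ∀ᶠ z : ℝ × Space n in 𝓝 q, z.1 ∈ Ioo 0 T :=
      continuous_fst.continuousAt.eventually (isOpen_Ioo.mem_nhds ⟨hq0, hqT⟩)
    filter_upwards [h1] with u hu hu'
    exact hmax ⟨Ioo_subset_Icc_self hu, (show φ u.1 u.2 = φ q.1 q.2 from hu').trans hq.2⟩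
  have hΦ0 : fderiv ℝ (levelFun φ) q ≠ 0 := by
    intro h0
    have h1 := h.spaceDeriv_phi_eq q.1 q.2 (gradient (φ q.1) q.2)
    rw [real_inner_self_eq_norm_sq, Prod.mk.eta, spaceDeriv, h0, _root_.zero_apply] at h1
    have := norm_pos_iff.2 (h.regular q.1 hq.1 q.2 hq.2)
    have : 0 < ‖gradient (φ q.1) q.2‖ ^ 2 := by positivity
    linarith
  obtain ⟨c', hc'⟩ := exists_eq_smul_of_isLocalExtrOn hext
    ((h.smooth_dom.contDiffAt (x := q)).hasStrictFDerivAt (by simp)) hΦ0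
    ((hus q hqc).hasStrictFDerivAt (by simp))
  -- At the maximum the differential of `e g²` is a multiple of `dφ`, and the flow direction `(1,
  -- v)` annihilates `dφ`.
  have hflow0 : flowDeriv (v q.1 q.2) (fun z => e z * (g z * g z)) q = 0 := by
    have h1 := h.flowDeriv_phi_eq_zero hq.1 (h.mem_frontier_of_boundaryRegion hq)
    rw [Prod.mk.eta, flowDeriv] at h1
    rw [flowDeriv, hc', _root_.smul_apply, h1, smul_zero]
  obtain ⟨c, hcΛ, hc⟩ := hΛ q hq
  have hgd : DifferentiableAt ℝ g q := (hgs q hqc).differentiableAt one_ne_zero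
  have hgflow : flowDeriv (v q.1 q.2) g q = c * g q := by
    rw [hg, h.flowDeriv_normal_B hqc, hc]
  have heflow : flowDeriv (v q.1 q.2) e q
      = Real.exp (-(2 * Λ) * q.1) * (-(2 * Λ) * (T - q.1) - 1) := by
    have h1 : HasFDerivAt e _ q := (((hasFDerivAt_fst (𝕜 := ℝ) (p := q)).const_mul (-(2 * Λ))).exp).mul
      ((hasFDerivAt_fst (𝕜 := ℝ) (p := q)).const_sub T)
    rw [flowDeriv, h1.fderiv]
    simp
    ring
  rw [flowDeriv_mul (hes.differentiable one_ne_zero q) (hgd.fun_mul hgd), flowDeriv_mul hgd hgd,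
    hgflow, heflow] at hflow0
  have hE := Real.exp_pos (-(2 * Λ) * q.1)
  have hfac : Real.exp (-(2 * Λ) * q.1) * (g q * g q) * (2 * (T - q.1) * (c - Λ) - 1) = 0 := by
    rw [← hflow0]
    simp only [he]
    ring
  have h2 : 0 < Real.exp (-(2 * Λ) * q.1) * (g q * g q) := mul_pos hE (mul_self_pos.2 hgq)
  -- Contradiction: `T - t > 0` and `c ≤ Λ` make the left side at most `-1`.
  have h3 : 2 * (T - q.1) * (c - Λ) - 1 = 0 := (mul_eq_zero.1 hfac).resolve_left h2.ne'
  nlinarith [le_abs_self c]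

/-- The magnetic field is tangent to the boundary. -/
lemma exists_abs_normal_B_le [NeZero n] (h : IsSmoothSolution T ς φ v B p) :
    ∃ A : ℝ, 0 ≤ A ∧ ∀ z ∈ openFluidRegion T φ,
      |spaceDeriv (B z.1 z.2) (levelFun φ) z| ≤ A * |φ z.1 z.2| := by
  refine h.exists_abs_le_of_vanish (openFluidRegion_subset T φ)
    (g := fun z => spaceDeriv (B z.1 z.2) (levelFun φ) z) (fun z hz => ?_) fun z hz y hy => ?_
  · exact contDiffAt_spaceDeriv_field (k := 2) (h.smooth_dom.contDiffAt.of_le (by norm_cast))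
      ((h.smooth_B_at hz).of_le (by norm_cast)) (by norm_num)
  · have ht : z.1 ∈ Icc 0 T := (openFluidRegion_subset T φ hz).1
    exact h.normal_B_eq_zero (z := (z.1, y)) ⟨ht, h.phi_eq_zero ht hy⟩ hz.1.2

end IsSmoothSolution

/-! ### Algebra of the energy form and its coercivity. -/

/-- The polarized quadratic form of the first order energy, with `q = δ - m ⊗ m`. -/
def quadForm (m : Fin n → ℝ) (A A' : Matrix (Fin n) (Fin n) ℝ) : ℝ :=
  ∑ k, ∑ i, A k i * A' k i - ∑ i, (∑ k, m k * A k i) * (∑ k, m k * A' k i)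
    + ∑ k, ∑ i, (A k i - A i k) * (A' k i - A' i k)

lemma quadForm_comm (m : Fin n → ℝ) (A A' : Matrix (Fin n) (Fin n) ℝ) :
    quadForm m A A' = quadForm m A' A := by
  simp only [quadForm, mul_comm]

lemma quadForm_add (m : Fin n → ℝ) (A₁ A₂ A' : Matrix (Fin n) (Fin n) ℝ) :
    quadForm m (A₁ + A₂) A' = quadForm m A₁ A' + quadForm m A₂ A' := by
  simp only [quadForm, Matrix.add_apply, add_mul, mul_add, Finset.sum_add_distrib,
    add_sub_add_comm]
  ring

lemma quadForm_smul (m : Fin n → ℝ) (c : ℝ) (A A' : Matrix (Fin n) (Fin n) ℝ) :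
    quadForm m (c • A) A' = c * quadForm m A A' := by
  have h1 : ∀ i, ∑ k, m k * (c * A k i) = c * ∑ k, m k * A k i := fun i => by
    rw [Finset.mul_sum]
    exact Finset.sum_congr rfl fun k _ => by ring
  simp only [quadForm, Matrix.smul_apply, smul_eq_mul, h1, ← mul_sub, mul_assoc, ← Finset.mul_sum]
  ring

lemma quadForm_neg (m : Fin n → ℝ) (A A' : Matrix (Fin n) (Fin n) ℝ) :
    quadForm m (-A) A' = -quadForm m A A' := by
  rw [← neg_one_smul ℝ A, quadForm_smul, neg_one_mul]

lemma quadForm_sub (m : Fin n → ℝ) (A₁ A₂ A' : Matrix (Fin n) (Fin n) ℝ) :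
    quadForm m (A₁ - A₂) A' = quadForm m A₁ A' - quadForm m A₂ A' := by
  rw [sub_eq_add_neg, quadForm_add, quadForm_neg, ← sub_eq_add_neg]

lemma abs_sum_le_card_mul {f : Fin n → ℝ} {a : ℝ} (hf : ∀ i, |f i| ≤ a) :
    |∑ i, f i| ≤ n * a := by
  refine (Finset.abs_sum_le_sum_abs _ _).trans ((Finset.sum_le_sum fun i _ => hf i).trans_eq ?_)
  simp

lemma abs_mul_apply_le {A A' : Matrix (Fin n) (Fin n) ℝ} {α α' : ℝ}
    (hA : ∀ k i, |A k i| ≤ α) (hA' : ∀ k i, |A' k i| ≤ α') (k i : Fin n) :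
    |(A * A') k i| ≤ n * (α * α') := by
  rw [Matrix.mul_apply]
  refine abs_sum_le_card_mul fun m => ?_
  rw [abs_mul]
  exact mul_le_mul (hA _ _) (hA' _ _) (abs_nonneg _) ((abs_nonneg _).trans (hA k m))

lemma abs_vecMul_le {m : Fin n → ℝ} {A : Matrix (Fin n) (Fin n) ℝ} {μ α : ℝ}
    (hm : ∀ k, |m k| ≤ μ) (hA : ∀ k i, |A k i| ≤ α) (i : Fin n) :
    |∑ k, m k * A k i| ≤ n * (μ * α) := by
  refine abs_sum_le_card_mul fun k => ?_
  rw [abs_mul]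
  exact mul_le_mul (hm _) (hA _ _) (abs_nonneg _) ((abs_nonneg _).trans (hm k))

lemma abs_vecMul_mul_le {m m' : Fin n → ℝ} {A A' : Matrix (Fin n) (Fin n) ℝ} {μ μ' α α' : ℝ}
    (hm : ∀ k, |m k| ≤ μ) (hA : ∀ k i, |A k i| ≤ α)
    (hm' : ∀ k, |m' k| ≤ μ') (hA' : ∀ k i, |A' k i| ≤ α') :
    |∑ i, (∑ k, m k * A k i) * (∑ k, m' k * A' k i)| ≤ n ^ 3 * (μ * α * (μ' * α')) := by
  have h1 : |∑ i, (∑ k, m k * A k i) * (∑ k, m' k * A' k i)|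
      ≤ n * (n * (μ * α) * (n * (μ' * α'))) := by
    refine abs_sum_le_card_mul fun i => ?_
    rw [abs_mul]
    exact mul_le_mul (abs_vecMul_le hm hA i) (abs_vecMul_le hm' hA' i) (abs_nonneg _)
      ((abs_nonneg _).trans (abs_vecMul_le hm hA i))
  exact h1.trans_eq (by ring)

/-- The full contraction, the normal part and the curl part contribute `n²`, `n³` and `4 n²`. -/
lemma abs_quadForm_le {m : Fin n → ℝ} {A A' : Matrix (Fin n) (Fin n) ℝ} {α α' : ℝ}
    (hm : ∀ k, |m k| ≤ 1) (hA : ∀ k i, |A k i| ≤ α) (hA' : ∀ k i, |A' k i| ≤ α') :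
    |quadForm m A A'| ≤ (n ^ 3 + 5 * n ^ 2) * (α * α') := by
  have h1 : |∑ k, ∑ i, A k i * A' k i| ≤ n * (n * (α * α')) :=
    abs_sum_le_card_mul fun k => abs_sum_le_card_mul fun i => by
      rw [abs_mul]
      exact mul_le_mul (hA _ _) (hA' _ _) (abs_nonneg _) ((abs_nonneg _).trans (hA k i))
  have h2 := abs_vecMul_mul_le hm hA hm hA'
  have h3 : |∑ k, ∑ i, (A k i - A i k) * (A' k i - A' i k)| ≤ n * (n * (2 * α * (2 * α'))) :=
    abs_sum_le_card_mul fun k => abs_sum_le_card_mul fun i => by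
      rw [abs_mul]
      refine mul_le_mul ?_ ?_ (abs_nonneg _) ?_
      · exact (abs_sub _ _).trans (by linarith [hA k i, hA i k])
      · exact (abs_sub _ _).trans (by linarith [hA' k i, hA' i k])
      · linarith [(abs_nonneg _).trans (hA k i)]
  rw [quadForm]
  refine (abs_add_le _ _).trans ((add_le_add_left (abs_sub _ _) _).trans ?_)
  linarith

lemma abs_apply_le_tensorNorm (A : Matrix (Fin n) (Fin n) ℝ) (k i : Fin n) :
    |A k i| ≤ tensorNorm A := by
  refine abs_le_of_sq_le_sq ?_ (tensorNorm_nonneg _)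
  rw [tensorNorm_sq]
  exact (Finset.single_le_sum (f := fun j => A k j ^ 2) (fun _ _ => sq_nonneg _)
    (Finset.mem_univ i)).trans (Finset.single_le_sum (f := fun k => ∑ j, A k j ^ 2)
    (fun _ _ => Finset.sum_nonneg fun _ _ => sq_nonneg _) (Finset.mem_univ k))

lemma sum_sum_mul_vecMul_sq_le {m : Fin n → ℝ} (hm : ∑ k, m k ^ 2 ≤ 1)
    (A : Matrix (Fin n) (Fin n) ℝ) :
    ∑ k, (∑ i, A k i * m i) ^ 2 ≤ tensorNormSq A := by
  refine Finset.sum_le_sum fun k _ => (Finset.sum_mul_sq_le_sq_mul_sq _ _ _).trans ?_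
  exact mul_le_of_le_one_right (Finset.sum_nonneg fun _ _ => sq_nonneg _) hm

/-- For trace free matrices the tangential part and the antisymmetric part control the matrix. -/
lemma tensorNormSq_le_quadForm {m : Fin n → ℝ} (hm : ∑ k, m k ^ 2 ≤ 1)
    {A : Matrix (Fin n) (Fin n) ℝ} (hA : A.trace = 0) :
    tensorNormSq A ≤ (5 + 2 * n) * quadForm m A A := by
  -- The matrix splits as `A = E + m ⊗ w`, where `w` is the normal derivative. Since `|m| ≤ 1`,
  -- `|E|²` is at most `Q₁ = |A|² - |w|²`, and the form equals `Q₁ + |S|²`. It remains to bound `w`: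
  -- the antisymmetric part gives `w - s m = E m + S m`, and vanishing trace gives `s = -tr E`. Thus
  -- `|w|² ≤ (4 + 2n)|E|² + 4|S|²`, and the constant is `1 + 4 + 2n`.
  set w : Fin n → ℝ := fun i => ∑ k, m k * A k i with hw
  set s : ℝ := ∑ i, m i * w i with hs
  set E : Matrix (Fin n) (Fin n) ℝ := fun k i => A k i - m k * w i with hE
  set S : Matrix (Fin n) (Fin n) ℝ := fun k i => A i k - A k i with hS
  set W : ℝ := ∑ i, w i ^ 2 with hW
  have hW0 : 0 ≤ W := Finset.sum_nonneg fun _ _ => sq_nonneg _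
  have hm0 : 0 ≤ ∑ k, m k ^ 2 := Finset.sum_nonneg fun _ _ => sq_nonneg _
  have hEsq : tensorNormSq E = tensorNormSq A - 2 * W + (∑ k, m k ^ 2) * W := by
    have h1 : ∑ k, ∑ i, m k * w i * A k i = W := by
      rw [Finset.sum_comm]
      refine Finset.sum_congr rfl fun i _ => ?_
      rw [sq, hw]
      simp only
      rw [Finset.mul_sum]
      exact Finset.sum_congr rfl fun k _ => by ring
    have h2 : ∑ k, ∑ i, (m k * w i) ^ 2 = (∑ k, m k ^ 2) * W := by
      rw [hW, Finset.sum_mul_sum]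
      simp only [mul_pow]
    rw [← h2, ← h1, tensorNormSq, tensorNormSq, Finset.mul_sum, ← Finset.sum_sub_distrib,
      ← Finset.sum_add_distrib]
    refine Finset.sum_congr rfl fun k _ => ?_
    rw [Finset.mul_sum, ← Finset.sum_sub_distrib, ← Finset.sum_add_distrib]
    exact Finset.sum_congr rfl fun i _ => by simp only [hE]; ring
  set Q₁ : ℝ := tensorNormSq A - W with hQ₁
  have hEle : tensorNormSq E ≤ Q₁ := by
    rw [hEsq, hQ₁]
    nlinarith
  have hquad : quadForm m A A = Q₁ + tensorNormSq S := by
    rw [quadForm, hQ₁, hW, tensorNormSq, tensorNormSq]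
    simp only [sq, hS]
    congr 1
    exact Finset.sum_congr rfl fun k _ => Finset.sum_congr rfl fun i _ => by ring
  have hS0 := tensorNormSq_nonneg S
  have hE0 := tensorNormSq_nonneg E
  have hkey : ∀ k, w k - m k * s = ∑ i, E k i * m i + ∑ i, S k i * m i := by
    intro k
    have h1 : ∑ i, E k i * m i = ∑ i, A k i * m i - m k * s := by
      rw [hs, Finset.mul_sum, ← Finset.sum_sub_distrib]
      exact Finset.sum_congr rfl fun i _ => by simp only [hE]; ring
    have h2 : ∑ i, S k i * m i = w k - ∑ i, A k i * m i := by
      rw [hw]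
      simp only
      rw [← Finset.sum_sub_distrib]
      exact Finset.sum_congr rfl fun i _ => by simp only [hS]; ring
    rw [h1, h2]
    ring
  have hT : ∑ k, (w k - m k * s) ^ 2 ≤ 2 * tensorNormSq E + 2 * tensorNormSq S := by
    calc _ ≤ ∑ k, (2 * (∑ i, E k i * m i) ^ 2 + 2 * (∑ i, S k i * m i) ^ 2) := by
          refine Finset.sum_le_sum fun k _ => ?_
          rw [hkey k]
          nlinarith [sq_nonneg (∑ i, E k i * m i - ∑ i, S k i * m i)]
      _ = 2 * ∑ k, (∑ i, E k i * m i) ^ 2 + 2 * ∑ k, (∑ i, S k i * m i) ^ 2 := by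
          rw [Finset.sum_add_distrib, Finset.mul_sum, Finset.mul_sum]
      _ ≤ _ := by
          have h1 := sum_sum_mul_vecMul_sq_le hm E
          have h2 := sum_sum_mul_vecMul_sq_le hm S
          linarith
  have hs2 : s ^ 2 ≤ n * tensorNormSq E := by
    have h1 : s = -∑ k, E k k := by
      simp only [hE, Finset.sum_sub_distrib]
      rw [show ∑ k, A k k = 0 from hA]
      simp [hs]
    have h2 : (∑ k, E k k) ^ 2 ≤ n * ∑ k, E k k ^ 2 := by
      have := sq_sum_le_card_mul_sum_sq (s := Finset.univ) (f := fun k => E k k)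
      simpa using this
    rw [h1, neg_sq]
    refine h2.trans (mul_le_mul_of_nonneg_left ?_ (Nat.cast_nonneg _))
    exact Finset.sum_le_sum fun k _ => Finset.single_le_sum (f := fun i => E k i ^ 2)
      (fun _ _ => sq_nonneg _) (Finset.mem_univ k)
  have hWle : W ≤ 2 * ∑ k, (w k - m k * s) ^ 2 + 2 * s ^ 2 := by
    calc W ≤ ∑ k, (2 * (w k - m k * s) ^ 2 + 2 * s ^ 2 * m k ^ 2) := by
          refine Finset.sum_le_sum fun k _ => ?_
          nlinarith [sq_nonneg (w k - m k * s - m k * s)]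
      _ = 2 * ∑ k, (w k - m k * s) ^ 2 + 2 * s ^ 2 * ∑ k, m k ^ 2 := by
          rw [Finset.sum_add_distrib, Finset.mul_sum, Finset.mul_sum]
      _ ≤ _ := by
          have := mul_le_of_le_one_right (a := 2 * s ^ 2) (by positivity) hm
          linarith
  have hn0 : (0 : ℝ) ≤ n := Nat.cast_nonneg _
  have h3 : (n : ℝ) * tensorNormSq E ≤ n * Q₁ := mul_le_mul_of_nonneg_left hEle hn0
  rw [hquad]
  have h4 : tensorNormSq A = Q₁ + W := by rw [hQ₁]; ring
  have h5 : 0 ≤ (n : ℝ) * tensorNormSq S := mul_nonneg hn0 hS0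
  rw [h4]
  nlinarith

lemma quadForm_nonneg {m : Fin n → ℝ} (hm : ∑ k, m k ^ 2 ≤ 1)
    {A : Matrix (Fin n) (Fin n) ℝ} (hA : A.trace = 0) : 0 ≤ quadForm m A A := by
  have h1 := (tensorNormSq_nonneg A).trans (tensorNormSq_le_quadForm hm hA)
  exact nonneg_of_mul_nonneg_right h1 (by positivity)

/-- The product rule for the quadratic form. -/
lemma fderiv_quadForm {E : Type*} [NormedAddCommGroup E] [NormedSpace ℝ E]
    {m : E → Fin n → ℝ} {A A' : E → Matrix (Fin n) (Fin n) ℝ} {z : E}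
    (hm : ∀ k, DifferentiableAt ℝ (fun y => m y k) z)
    (hA : ∀ k i, DifferentiableAt ℝ (fun y => A y k i) z)
    (hA' : ∀ k i, DifferentiableAt ℝ (fun y => A' y k i) z) (u : E) :
    fderiv ℝ (fun y => quadForm (m y) (A y) (A' y)) z u
      = quadForm (m z) (fun k i => fderiv ℝ (fun y => A y k i) z u) (A' z)
        + quadForm (m z) (A z) (fun k i => fderiv ℝ (fun y => A' y k i) z u)
        - (∑ i, (∑ k, fderiv ℝ (fun y => m y k) z u * A z k i) * (∑ k, m z k * A' z k i)
          + ∑ i, (∑ k, m z k * A z k i) * (∑ k, fderiv ℝ (fun y => m y k) z u * A' z k i)) := by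
  have h1 : HasFDerivAt (fun y => quadForm (m y) (A y) (A' y)) _ z :=
    ((HasFDerivAt.fun_sum (u := Finset.univ) fun k _ => HasFDerivAt.fun_sum (u := Finset.univ)
      fun i _ => (hA k i).hasFDerivAt.mul (hA' k i).hasFDerivAt).sub
    (HasFDerivAt.fun_sum (u := Finset.univ) fun i _ =>
      (HasFDerivAt.fun_sum (u := Finset.univ) fun k _ =>
        (hm k).hasFDerivAt.mul (hA k i).hasFDerivAt).mul
      (HasFDerivAt.fun_sum (u := Finset.univ) fun k _ =>
        (hm k).hasFDerivAt.mul (hA' k i).hasFDerivAt))).add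
    (HasFDerivAt.fun_sum (u := Finset.univ) fun k _ => HasFDerivAt.fun_sum (u := Finset.univ)
      fun i _ => ((hA k i).hasFDerivAt.sub (hA i k).hasFDerivAt).mul
        ((hA' k i).hasFDerivAt.sub (hA' i k).hasFDerivAt))
  rw [h1.fderiv]
  simp only [add_apply, sub_apply, smul_apply, _root_.sum_apply, smul_eq_mul, quadForm,
    Pi.mul_apply, Pi.sub_apply]
  simp only [Finset.sum_add_distrib, mul_add]
  simp only [mul_comm]
  ring

lemma contDiffAt_quadForm {E : Type*} [NormedAddCommGroup E] [NormedSpace ℝ E]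
    {m : E → Fin n → ℝ} {A A' : E → Matrix (Fin n) (Fin n) ℝ} {z : E} {r : WithTop ℕ∞}
    (hm : ∀ k, ContDiffAt ℝ r (fun y => m y k) z)
    (hA : ∀ k i, ContDiffAt ℝ r (fun y => A y k i) z)
    (hA' : ∀ k i, ContDiffAt ℝ r (fun y => A' y k i) z) :
    ContDiffAt ℝ r (fun y => quadForm (m y) (A y) (A' y)) z :=
  ((ContDiffAt.sum fun k _ => ContDiffAt.sum fun i _ => (hA k i).mul (hA' k i)).sub
    (ContDiffAt.sum fun i _ => (ContDiffAt.sum fun k _ => (hm k).mul (hA k i)).mul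
      (ContDiffAt.sum fun k _ => (hm k).mul (hA' k i)))).add
    (ContDiffAt.sum fun k _ => ContDiffAt.sum fun i _ => ((hA k i).sub (hA i k)).mul
      ((hA' k i).sub (hA' i k)))

lemma continuousOn_quadForm {E : Type*} [TopologicalSpace E]
    {m : E → Fin n → ℝ} {A A' : E → Matrix (Fin n) (Fin n) ℝ} {s : Set E}
    (hm : ∀ k, ContinuousOn (fun y => m y k) s)
    (hA : ∀ k i, ContinuousOn (fun y => A y k i) s)
    (hA' : ∀ k i, ContinuousOn (fun y => A' y k i) s) :
    ContinuousOn (fun y => quadForm (m y) (A y) (A' y)) s := by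
  unfold quadForm
  fun_prop

lemma projGradSq_add_curl (χ : ℝ → ℝ) (d₀ : ℝ) (φ : ℝ → Space n → ℝ) (t : ℝ)
    (w : Space n → Space n) (x : Space n) :
    projGradSq χ d₀ φ t w x + tensorNormSq (curl w x)
      = quadForm (fun k => projField χ d₀ φ k (t, x)) (gradTensor w x) (gradTensor w x) := by
  rw [quadForm, tensorNormSq, projGradSq]
  congr 1
  · simp only [projCoeff_eq, sub_mul, Finset.sum_sub_distrib, ite_mul, one_mul, zero_mul,
      Finset.sum_ite_eq, Finset.mem_univ, if_true, Finset.sum_mul_sum]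
    congr 1
    · exact Finset.sum_comm
    · exact Finset.sum_congr rfl fun i _ => Finset.sum_congr rfl fun k _ =>
        Finset.sum_congr rfl fun l _ => by ring
  · exact Finset.sum_congr rfl fun k _ => Finset.sum_congr rfl fun i _ => by rw [curl, sq]

/-! ### Divergences, the pressure flux and tangent fields. -/

/-- The spatial divergence of a vector field on spacetime. -/
noncomputable def divField (X : ℝ × Space n → Space n) (z : ℝ × Space n) : ℝ :=
  ∑ i, spaceDeriv (basisVec i) (fun y => X y i) z

lemma divField_add {X Y : ℝ × Space n → Space n} {z : ℝ × Space n}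
    (hX : ∀ i, DifferentiableAt ℝ (fun y => X y i) z)
    (hY : ∀ i, DifferentiableAt ℝ (fun y => Y y i) z) :
    divField (fun y => X y + Y y) z = divField X z + divField Y z := by
  rw [divField, divField, divField, ← Finset.sum_add_distrib]
  refine Finset.sum_congr rfl fun i _ => ?_
  simp only [PiLp.add_apply, spaceDeriv]
  rw [fderiv_fun_add (hX i) (hY i), add_apply]

lemma divField_smul {g : ℝ × Space n → ℝ} {Y : ℝ × Space n → Space n} {z : ℝ × Space n}
    (hg : DifferentiableAt ℝ g z) (hY : ∀ i, DifferentiableAt ℝ (fun y => Y y i) z) :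
    divField (fun y => g y • Y y) z = g z * divField Y z + spaceDeriv (Y z) g z := by
  rw [divField, divField, spaceDeriv_eq_sum (Y z), Finset.mul_sum, ← Finset.sum_add_distrib]
  refine Finset.sum_congr rfl fun i _ => ?_
  simp only [PiLp.smul_apply, smul_eq_mul]
  rw [spaceDeriv_mul hg (hY i)]
  ring

lemma divField_const_smul (c : ℝ) {Y : ℝ × Space n → Space n} {z : ℝ × Space n}
    (hY : ∀ i, DifferentiableAt ℝ (fun y => Y y i) z) :
    divField (fun y => c • Y y) z = c * divField Y z := by
  rw [divField_smul (differentiableAt_const c) hY, spaceDeriv]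
  simp

/-- The vector field `(P - (m · P) m)_k V_{ki}`. -/
noncomputable def projFlux (m P : Fin n → ℝ × Space n → ℝ)
    (V : ℝ × Space n → Matrix (Fin n) (Fin n) ℝ) (z : ℝ × Space n) : Space n :=
  WithLp.toLp 2 fun i => ∑ k, (P k z - (∑ l, m l z * P l z) * m k z) * V z k i

lemma contDiffAt_projFlux {m P : Fin n → ℝ × Space n → ℝ}
    {V : ℝ × Space n → Matrix (Fin n) (Fin n) ℝ} {z : ℝ × Space n} {r : WithTop ℕ∞}
    (hm : ∀ k, ContDiffAt ℝ r (m k) z) (hP : ∀ k, ContDiffAt ℝ r (P k) z)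
    (hV : ∀ k i, ContDiffAt ℝ r (fun y => V y k i) z) (i : Fin n) :
    ContDiffAt ℝ r (fun y => projFlux m P V y i) z := by
  change ContDiffAt ℝ r (fun y => ∑ k, (P k y - (∑ l, m l y * P l y) * m k y) * V y k i) z
  exact ContDiffAt.sum fun k _ => ((hP k).sub ((ContDiffAt.sum fun l _ => (hm l).mul (hP l)).mul
    (hm k))).mul (hV k i)

/-- Meant for `P` the pressure gradient and `V` the velocity gradient. Derivatives of `V` drop out
because `V` is divergence free in its second index, and the curl part of the form vanishes by the
symmetry of the Hessian. Only derivatives of `m` are left as error terms. -/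
lemma divField_projFlux {m P : Fin n → ℝ × Space n → ℝ}
    {V : ℝ × Space n → Matrix (Fin n) (Fin n) ℝ} {z : ℝ × Space n}
    (hm : ∀ k, DifferentiableAt ℝ (m k) z) (hP : ∀ k, DifferentiableAt ℝ (P k) z)
    (hV : ∀ k i, DifferentiableAt ℝ (fun y => V y k i) z)
    (hsymm : ∀ i k, spaceDeriv (basisVec i) (P k) z = spaceDeriv (basisVec k) (P i) z)
    (hdiv : ∀ k, ∑ i, spaceDeriv (basisVec i) (fun y => V y k i) z = 0) :
    divField (projFlux m P V) z
      = quadForm (fun k => m k z) (fun k i => spaceDeriv (basisVec k) (P i) z) (V z)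
        - ∑ i, ∑ k, ((∑ l, spaceDeriv (basisVec i) (m l) z * P l z) * m k z
          + (∑ l, m l z * P l z) * spaceDeriv (basisVec i) (m k) z) * V z k i := by
  have hS : DifferentiableAt ℝ (fun y => ∑ l, m l y * P l y) z :=
    DifferentiableAt.fun_sum fun l _ => (hm l).fun_mul (hP l)
  have hG : ∀ k, DifferentiableAt ℝ (fun y => P k y - (∑ l, m l y * P l y) * m k y) z := fun k =>
    (hP k).fun_sub (hS.fun_mul (hm k))
  have hSd : ∀ i, spaceDeriv (basisVec i) (fun y => ∑ l, m l y * P l y) z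
      = ∑ l, m l z * spaceDeriv (basisVec l) (P i) z
        + ∑ l, spaceDeriv (basisVec i) (m l) z * P l z := fun i => by
    rw [spaceDeriv_sum _ fun l _ => (hm l).fun_mul (hP l), ← Finset.sum_add_distrib]
    refine Finset.sum_congr rfl fun l _ => ?_
    rw [spaceDeriv_mul (hm l) (hP l), hsymm i l]
  have hGd : ∀ i k, spaceDeriv (basisVec i) (fun y => P k y - (∑ l, m l y * P l y) * m k y) z
      = spaceDeriv (basisVec k) (P i) z
        - (∑ l, m l z * spaceDeriv (basisVec l) (P i) z) * m k z
        - ((∑ l, spaceDeriv (basisVec i) (m l) z * P l z) * m k z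
          + (∑ l, m l z * P l z) * spaceDeriv (basisVec i) (m k) z) := fun i k => by
    have h1 : spaceDeriv (basisVec i) (fun y => P k y - (∑ l, m l y * P l y) * m k y) z
        = spaceDeriv (basisVec i) (P k) z
          - spaceDeriv (basisVec i) (fun y => (∑ l, m l y * P l y) * m k y) z := by
      rw [spaceDeriv, fderiv_fun_sub (hP k) (hS.fun_mul (hm k)), sub_apply]
      rfl
    rw [h1, spaceDeriv_mul hS (hm k), hSd, hsymm i k]
    ring
  have h1 : divField (projFlux m P V) z = ∑ i, ∑ k,
      ((P k z - (∑ l, m l z * P l z) * m k z) * spaceDeriv (basisVec i) (fun y => V y k i) z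
        + spaceDeriv (basisVec i) (fun y => P k y - (∑ l, m l y * P l y) * m k y) z * V z k i) := by
    refine Finset.sum_congr rfl fun i _ => ?_
    simp only [projFlux]
    rw [spaceDeriv_sum _ fun k _ => (hG k).fun_mul (hV k i)]
    exact Finset.sum_congr rfl fun k _ => spaceDeriv_mul (hG k) (hV k i) _
  have h2 : ∑ i, ∑ k, (P k z - (∑ l, m l z * P l z) * m k z) *
      spaceDeriv (basisVec i) (fun y => V y k i) z = 0 := by
    rw [Finset.sum_comm]
    refine Finset.sum_eq_zero fun k _ => ?_
    rw [← Finset.mul_sum, hdiv, mul_zero]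
  have h3 : ∑ k, ∑ i, (spaceDeriv (basisVec k) (P i) z - spaceDeriv (basisVec i) (P k) z)
      * (V z k i - V z i k) = 0 :=
    Finset.sum_eq_zero fun k _ => Finset.sum_eq_zero fun i _ => by rw [hsymm k i, sub_self, zero_mul]
  have h4 : divField (projFlux m P V) z = ∑ i, ∑ k, (spaceDeriv (basisVec k) (P i) z
        - (∑ l, m l z * spaceDeriv (basisVec l) (P i) z) * m k z
        - ((∑ l, spaceDeriv (basisVec i) (m l) z * P l z) * m k z
          + (∑ l, m l z * P l z) * spaceDeriv (basisVec i) (m k) z)) * V z k i := by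
    simp only [h1, Finset.sum_add_distrib]
    rw [h2, zero_add]
    exact Finset.sum_congr rfl fun i _ => Finset.sum_congr rfl fun k _ => by rw [hGd]
  have h5 : quadForm (fun k => m k z) (fun k i => spaceDeriv (basisVec k) (P i) z) (V z)
      = ∑ k, ∑ i, spaceDeriv (basisVec k) (P i) z * V z k i
        - ∑ i, (∑ k, m k z * spaceDeriv (basisVec k) (P i) z) * (∑ k, m k z * V z k i)
        + ∑ k, ∑ i, (spaceDeriv (basisVec k) (P i) z - spaceDeriv (basisVec i) (P k) z)
          * (V z k i - V z i k) := rfl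
  rw [h4, h5, h3, add_zero, Finset.sum_comm (f := fun k i =>
    spaceDeriv (basisVec k) (P i) z * V z k i), ← Finset.sum_sub_distrib, ← Finset.sum_sub_distrib]
  refine Finset.sum_congr rfl fun i _ => ?_
  rw [Finset.mul_sum, ← Finset.sum_sub_distrib, ← Finset.sum_sub_distrib]
  exact Finset.sum_congr rfl fun k _ => by ring

/-- Vector fields in the fluid region which are tangent to the moving boundary at fixed times. -/
structure IsTangentField (T : ℝ) (φ : ℝ → Space n → ℝ) (X : ℝ × Space n → Space n) : Prop where
  contDiffAt : ∀ z ∈ openFluidRegion T φ, ∀ i, ContDiffAt ℝ 1 (fun y => X y i) z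
  tangent : ∃ A, ∀ z ∈ openFluidRegion T φ, |spaceDeriv (X z) (levelFun φ) z| ≤ A * |φ z.1 z.2|

namespace IsTangentField

variable {T : ℝ} {φ : ℝ → Space n → ℝ} {X Y : ℝ × Space n → Space n}

lemma differentiableAt (hX : IsTangentField T φ X) {z : ℝ × Space n}
    (hz : z ∈ openFluidRegion T φ) (i : Fin n) : DifferentiableAt ℝ (fun y => X y i) z :=
  (hX.contDiffAt z hz i).differentiableAt one_ne_zero

lemma add (hX : IsTangentField T φ X) (hY : IsTangentField T φ Y) :
    IsTangentField T φ fun z => X z + Y z := by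
  refine ⟨fun z hz i => (hX.contDiffAt z hz i).add (hY.contDiffAt z hz i), ?_⟩
  obtain ⟨A, hA⟩ := hX.tangent
  obtain ⟨A', hA'⟩ := hY.tangent
  refine ⟨A + A', fun z hz => ?_⟩
  have h1 : spaceDeriv (X z + Y z) (levelFun φ) z
      = spaceDeriv (X z) (levelFun φ) z + spaceDeriv (Y z) (levelFun φ) z := by
    rw [spaceDeriv, spaceDeriv, spaceDeriv, ← map_add]
    simp
  rw [h1, add_mul]
  exact (abs_add_le _ _).trans (add_le_add (hA z hz) (hA' z hz))

lemma smul (hX : IsTangentField T φ X) {g : ℝ × Space n → ℝ}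
    (hg : ∀ z ∈ openFluidRegion T φ, ContDiffAt ℝ 1 g z)
    (hgb : ∃ A, ∀ z ∈ openFluidRegion T φ, |g z| ≤ A) :
    IsTangentField T φ fun z => g z • X z := by
  refine ⟨fun z hz i => (hg z hz).mul (hX.contDiffAt z hz i), ?_⟩
  obtain ⟨A, hA⟩ := hX.tangent
  obtain ⟨A', hA'⟩ := hgb
  refine ⟨A' * A, fun z hz => ?_⟩
  have h1 : spaceDeriv (g z • X z) (levelFun φ) z = g z * spaceDeriv (X z) (levelFun φ) z := by
    rw [spaceDeriv, spaceDeriv, ← smul_eq_mul, ← map_smul]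
    simp
  rw [h1, abs_mul, mul_assoc]
  exact mul_le_mul (hA' z hz) (hA z hz) (abs_nonneg _) ((abs_nonneg _).trans (hA' z hz))

lemma const_smul (hX : IsTangentField T φ X) (c : ℝ) : IsTangentField T φ fun z => c • X z :=
  hX.smul (fun _ _ => contDiffAt_const) ⟨|c|, fun _ _ => le_rfl⟩

end IsTangentField

/-! ### Local conservation of energy. -/

/-- The energy flux of the conservation of energy. -/
noncomputable def flux0 (ς : ℝ) (v B : ℝ → Space n → Space n) (p : ℝ → Space n → ℝ)
    (z : ℝ × Space n) : Space n :=
  (-(pressureFun p B z - ς ^ 2 / (8 * Real.pi))) • v z.1 z.2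
    + (1 / (4 * Real.pi) * ∑ j, coord v j z * coord B j z) • B z.1 z.2

/-- The energy density. -/
noncomputable def density0 (v B : ℝ → Space n → Space n) (z : ℝ × Space n) : ℝ :=
  1 / 2 * ∑ j, coord v j z * coord v j z + 1 / (8 * Real.pi) * ∑ j, coord B j z * coord B j z

lemma density0_eq (v B : ℝ → Space n → Space n) (t : ℝ) (x : Space n) :
    density0 v B (t, x) = 1 / 2 * ‖v t x‖ ^ 2 + 1 / (8 * Real.pi) * ‖B t x‖ ^ 2 := by
  simp only [density0, EuclideanSpace.norm_sq_eq, Real.norm_eq_abs, sq_abs]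
  simp only [sq]

namespace IsSmoothSolution

variable {T ς : ℝ} {φ : ℝ → Space n → ℝ} {v B : ℝ → Space n → Space n}
  {p : ℝ → Space n → ℝ} {t : ℝ} {z : ℝ × Space n} {d₀ : ℝ} {χ : ℝ → ℝ}

lemma exists_bound_family (h : IsSmoothSolution T ς φ v B p) {ι : Type*} [Fintype ι]
    {g : ι → ℝ × Space n → ℝ} (hg : ∀ i, ∀ z ∈ closedRegion T φ, ContinuousAt (g i) z) :
    ∃ A : ℝ, 0 ≤ A ∧ ∀ z ∈ closedRegion T φ, ∀ i, |g i z| ≤ A := by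
  choose A hA0 hA using fun i => h.exists_bound (hg i)
  exact ⟨∑ i, A i, Finset.sum_nonneg fun i _ => hA0 i, fun z hz i =>
    (hA i z hz).trans (Finset.single_le_sum (fun i _ => hA0 i) (Finset.mem_univ i))⟩

/-- A vector field whose components are controlled by the level set function is tangent. -/
lemma isTangentField_of_abs_le (h : IsSmoothSolution T ς φ v B p) {X : ℝ × Space n → Space n}
    (hX : ∀ z ∈ openFluidRegion T φ, ∀ i, ContDiffAt ℝ 1 (fun y => X y i) z)
    (hb : ∃ A, ∀ z ∈ openFluidRegion T φ, ∀ i, |X z i| ≤ A * |φ z.1 z.2|) :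
    IsTangentField T φ X := by
  refine ⟨hX, ?_⟩
  obtain ⟨A, hA⟩ := hb
  obtain ⟨A', hA'0, hA'⟩ := h.exists_bound_family
    (g := fun i : Fin n => spaceDeriv (basisVec i) (levelFun φ)) fun i z _ =>
      (contDiffAt_spaceDeriv (h.smooth_dom.contDiffAt) (m := 0) (by simp) _).continuousAt
  refine ⟨n * (A * A'), fun z hz => ?_⟩
  rw [spaceDeriv_eq_sum]
  refine (abs_sum_le_card_mul (a := A * |φ z.1 z.2| * A') fun i => ?_).trans_eq (by ring)
  rw [abs_mul]
  exact mul_le_mul (hA z hz i) (hA' z (fluidRegion_subset _ _ (openFluidRegion_subset _ _ hz)) i)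
    (abs_nonneg _) ((abs_nonneg _).trans (hA z hz i))

lemma isTangentField_B [NeZero n] (h : IsSmoothSolution T ς φ v B p) :
    IsTangentField T φ fun z => B z.1 z.2 := by
  obtain ⟨A, -, hA⟩ := h.exists_abs_normal_B_le
  exact ⟨fun z hz i => (h.contDiffAt_B (fluidRegion_subset _ _ (openFluidRegion_subset _ _ hz))
    i).of_le (by norm_cast), A, hA⟩

lemma contDiffAt_density0 (h : IsSmoothSolution T ς φ v B p) (hz : z ∈ closedRegion T φ) :
    ContDiffAt ℝ ∞ (density0 v B) z :=
  (contDiffAt_const.mul (ContDiffAt.sum fun j _ => (h.contDiffAt_v hz j).mul (h.contDiffAt_v hz j))).add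
    (contDiffAt_const.mul (ContDiffAt.sum fun j _ => (h.contDiffAt_B hz j).mul (h.contDiffAt_B hz j)))

lemma contDiffAt_vB (h : IsSmoothSolution T ς φ v B p) (hz : z ∈ closedRegion T φ) :
    ContDiffAt ℝ ∞ (fun z => 1 / (4 * Real.pi) * ∑ j, coord v j z * coord B j z) z :=
  contDiffAt_const.mul (ContDiffAt.sum fun j _ => (h.contDiffAt_v hz j).mul (h.contDiffAt_B hz j))

/-- At a fixed time `v` need not be tangent, because the boundary moves. The constant subtracted
from the pressure is its boundary value, so the coefficient of `v` vanishes there; it does not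
affect the divergence since `div v = 0`. The other part is a multiple of the tangent field `B`. -/
lemma isTangentField_flux0 [NeZero n] (h : IsSmoothSolution T ς φ v B p) :
    IsTangentField T φ (flux0 ς v B p) := by
  have hsub : ∀ z ∈ openFluidRegion T φ, z ∈ closedRegion T φ := fun z hz =>
    fluidRegion_subset _ _ (openFluidRegion_subset _ _ hz)
  have hPs : ∀ z ∈ closedRegion T φ, ContDiffAt ℝ 1
      (fun z => -(pressureFun p B z - ς ^ 2 / (8 * Real.pi))) z := fun z hz =>
    (((h.contDiffAt_totalPressure hz).sub contDiffAt_const).neg).of_le (by norm_cast)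
  refine IsTangentField.add ?_ ?_
  · obtain ⟨A, -, hA⟩ := h.exists_abs_le_of_vanish (openFluidRegion_subset T φ) hPs
      fun z hz y hy => by
        have := h.totalPressure_eq (openFluidRegion_subset T φ hz).1 hy
        simp [this]
    obtain ⟨A', -, hA'⟩ := h.exists_bound_family (g := fun j => coord v j) fun j z hz =>
      (h.contDiffAt_v hz j).continuousAt
    refine h.isTangentField_of_abs_le (fun z hz i => (hPs z (hsub z hz)).mul
      ((h.contDiffAt_v (hsub z hz) i).of_le (by norm_cast))) ⟨A * A', fun z hz i => ?_⟩
    rw [PiLp.smul_apply, smul_eq_mul, abs_mul, mul_right_comm]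
    exact mul_le_mul (hA z hz) (hA' z (hsub z hz) i) (abs_nonneg _) ((abs_nonneg _).trans (hA z hz))
  · refine h.isTangentField_B.smul (fun z hz => (h.contDiffAt_vB (hsub z hz)).of_le (by norm_cast)) ?_
    obtain ⟨A, -, hA⟩ := h.exists_bound fun z hz => (h.contDiffAt_vB hz).continuousAt
    exact ⟨A, fun z hz => hA z (hsub z hz)⟩

/-- The local conservation of energy. -/
lemma flowDeriv_density0 [NeZero n] (h : IsSmoothSolution T ς φ v B p)
    (hz : z ∈ openFluidRegion T φ) :
    flowDeriv (v z.1 z.2) (density0 v B) z = divField (flux0 ς v B p) z := by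
  have hzf := openFluidRegion_subset _ _ hz
  have hzc := fluidRegion_subset _ _ hzf
  have hv : ∀ i, DifferentiableAt ℝ (coord v i) z := fun i =>
    (h.contDiffAt_v hzc i).differentiableAt (by simp)
  have hB : ∀ i, DifferentiableAt ℝ (coord B i) z := fun i =>
    (h.contDiffAt_B hzc i).differentiableAt (by simp)
  have hP : DifferentiableAt ℝ (pressureFun p B) z :=
    (h.contDiffAt_totalPressure hzc).differentiableAt (by simp)
  have hvB := (h.contDiffAt_vB hzc).differentiableAt (by simp)
  have hvBs : DifferentiableAt ℝ (fun z => ∑ j, coord v j z * coord B j z) z :=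
    DifferentiableAt.fun_sum fun j _ => (hv j).fun_mul (hB j)
  have hneg : DifferentiableAt ℝ (fun z => -(pressureFun p B z - ς ^ 2 / (8 * Real.pi))) z :=
    (hP.sub_const _).neg
  have hdv : divField (fun z => v z.1 z.2) z = 0 := h.trace_gradMat_v hzf
  have hdB : divField (fun z => B z.1 z.2) z = 0 := h.trace_gradMat_B hzf
  have hright : divField (flux0 ς v B p) z = -∑ j, coord v j z * spaceDeriv (basisVec j) (pressureFun p B) z
      + 1 / (4 * Real.pi) * ∑ j, (coord v j z * spaceDeriv (B z.1 z.2) (coord B j) z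
        + spaceDeriv (B z.1 z.2) (coord v j) z * coord B j z) := by
    have h1 : divField (flux0 ς v B p) z = divField (fun z =>
        (-(pressureFun p B z - ς ^ 2 / (8 * Real.pi))) • v z.1 z.2) z
        + divField (fun z => (1 / (4 * Real.pi) * ∑ j, coord v j z * coord B j z) • B z.1 z.2) z :=
      divField_add (fun i => hneg.fun_mul (hv i)) (fun i => hvB.fun_mul (hB i))
    rw [h1, divField_smul hneg hv, divField_smul hvB hB, hdv, hdB, mul_zero, mul_zero, zero_add,
      zero_add]
    congr 1
    · rw [spaceDeriv, fderiv_fun_neg, fderiv_sub_const, _root_.neg_apply]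
      congr 1
      exact spaceDeriv_eq_sum _ _ _
    · rw [spaceDeriv, fderiv_const_mul hvBs, _root_.smul_apply, smul_eq_mul]
      congr 1
      refine (spaceDeriv_sum _ (fun j _ => (hv j).fun_mul (hB j)) (B z.1 z.2)).trans ?_
      exact Finset.sum_congr rfl fun j _ => spaceDeriv_mul (hv j) (hB j) _
  have hleft : flowDeriv (v z.1 z.2) (density0 v B) z
      = 1 / 2 * ∑ j, (coord v j z * flowDeriv (v z.1 z.2) (coord v j) z
          + flowDeriv (v z.1 z.2) (coord v j) z * coord v j z)
        + 1 / (8 * Real.pi) * ∑ j, (coord B j z * flowDeriv (v z.1 z.2) (coord B j) z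
          + flowDeriv (v z.1 z.2) (coord B j) z * coord B j z) := by
    have h1 : DifferentiableAt ℝ (fun z => ∑ j, coord v j z * coord v j z) z :=
      DifferentiableAt.fun_sum fun j _ => (hv j).fun_mul (hv j)
    have h2 : DifferentiableAt ℝ (fun z => ∑ j, coord B j z * coord B j z) z :=
      DifferentiableAt.fun_sum fun j _ => (hB j).fun_mul (hB j)
    have h3 : HasFDerivAt (density0 v B) _ z :=
      (h1.hasFDerivAt.const_mul (1 / 2)).add (h2.hasFDerivAt.const_mul (1 / (8 * Real.pi)))
    rw [flowDeriv, h3.fderiv, add_apply, smul_apply, smul_apply, smul_eq_mul, smul_eq_mul]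
    congr 2
    · refine (flowDeriv_sum _ (fun j _ => (hv j).fun_mul (hv j)) (v z.1 z.2)).trans ?_
      exact Finset.sum_congr rfl fun j _ => flowDeriv_mul (hv j) (hv j) _
    · refine (flowDeriv_sum _ (fun j _ => (hB j).fun_mul (hB j)) (v z.1 z.2)).trans ?_
      exact Finset.sum_congr rfl fun j _ => flowDeriv_mul (hB j) (hB j) _
  rw [hleft, hright, Finset.mul_sum, Finset.mul_sum, Finset.mul_sum, ← Finset.sum_neg_distrib,
    ← Finset.sum_add_distrib, ← Finset.sum_add_distrib]
  refine Finset.sum_congr rfl fun j _ => ?_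
  rw [h.flowDeriv_v hzf, h.flowDeriv_B hzc]
  have := Real.pi_pos
  field_simp
  ring

end IsSmoothSolution

/-! ### Evolution of the first-order energy density. -/

/-- The projection field as a vector. -/
noncomputable def projVec (χ : ℝ → ℝ) (d₀ : ℝ) (φ : ℝ → Space n → ℝ) (z : ℝ × Space n) :
    Fin n → ℝ := fun k => projField χ d₀ φ k z

/-- The density of the first order energy. -/
noncomputable def density1 (χ : ℝ → ℝ) (d₀ : ℝ) (φ : ℝ → Space n → ℝ) (v B : ℝ → Space n → Space n)
    (z : ℝ × Space n) : ℝ :=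
  quadForm (projVec χ d₀ φ z) (gradMat v z) (gradMat v z)
    + 1 / (4 * Real.pi) * quadForm (projVec χ d₀ φ z) (gradMat B z) (gradMat B z)

/-- The flux of the first order energy. -/
noncomputable def flux1 (χ : ℝ → ℝ) (d₀ : ℝ) (φ : ℝ → Space n → ℝ) (v B : ℝ → Space n → Space n)
    (p : ℝ → Space n → ℝ) (z : ℝ × Space n) : Space n :=
  (1 / (2 * Real.pi) * quadForm (projVec χ d₀ φ z) (gradMat B z) (gradMat v z)) • B z.1 z.2
    + (-2 : ℝ) • projFlux (projField χ d₀ φ) (fun k => spaceDeriv (basisVec k) (pressureFun p B))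
        (gradMat v) z

/-- The lower order terms in the evolution of the first order energy density. Here `m` is the
projection field, `m₁` and `m₂` are its derivatives along the flow and along `B`, `D` is its
gradient, `P` is the pressure gradient, `V` and `b` are the gradients of `v` and `B`. -/
noncomputable def remainder (m m₁ m₂ P : Fin n → ℝ) (D V b : Matrix (Fin n) (Fin n) ℝ) : ℝ :=
  1 / (2 * Real.pi) * (quadForm m (b * b) V + quadForm m (b * V) b - quadForm m (V * b) b)
    - 2 * quadForm m (V * V) V
    - 2 * ∑ i, (∑ k, m₁ k * V k i) * (∑ k, m k * V k i)
    - 1 / (2 * Real.pi) * ∑ i, (∑ k, m₁ k * b k i) * (∑ k, m k * b k i)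
    + 1 / (2 * Real.pi) * (∑ i, (∑ k, m₂ k * b k i) * (∑ k, m k * V k i)
      + ∑ i, (∑ k, m k * b k i) * (∑ k, m₂ k * V k i))
    - 2 * ∑ i, ∑ k, ((∑ l, D i l * P l) * m k + (∑ l, m l * P l) * D i k) * V k i

namespace IsSmoothSolution

variable {T ς : ℝ} {φ : ℝ → Space n → ℝ} {v B : ℝ → Space n → Space n}
  {p : ℝ → Space n → ℝ} {t : ℝ} {z : ℝ × Space n} {d₀ : ℝ} {χ : ℝ → ℝ}

/-- The terms with `B · ∂∂B` from the momentum equation and with `B · ∂∂v` from induction have equal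
weights after the factor `1 / (4π)`. They combine to `B · ∂` of the polarized form, a divergence
since `div B = 0`. The pressure Hessian is supplied by `divField_projFlux`. No second derivatives of
the fields survive in the remainder. -/
lemma flowDeriv_density1 [NeZero n] (h : IsSmoothSolution T ς φ v B p) (hχ : IsCutoff χ)
    (hd₀ : 0 < d₀) (hι : ∀ t ∈ Icc 0 T, ENNReal.ofReal d₀ < injRadius φ t)
    (hz : z ∈ openFluidRegion T φ) :
    flowDeriv (v z.1 z.2) (density1 χ d₀ φ v B) z = divField (flux1 χ d₀ φ v B p) z
      + remainder (projVec χ d₀ φ z) (fun k => flowDeriv (v z.1 z.2) (projField χ d₀ φ k) z)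
        (fun k => spaceDeriv (B z.1 z.2) (projField χ d₀ φ k) z)
        (fun k => spaceDeriv (basisVec k) (pressureFun p B) z)
        (fun i k => spaceDeriv (basisVec i) (projField χ d₀ φ k) z) (gradMat v z) (gradMat B z) := by
  have hzf := openFluidRegion_subset _ _ hz
  have hzc := fluidRegion_subset _ _ hzf
  have hm : ∀ k, DifferentiableAt ℝ (projField χ d₀ φ k) z := fun k =>
    (h.contDiffAt_projField hχ hd₀ hι k hz).differentiableAt one_ne_zero
  have hm' : ∀ k, DifferentiableAt ℝ (fun y => projVec χ d₀ φ y k) z := hm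
  have hV : ∀ k i, DifferentiableAt ℝ (fun y => gradMat v y k i) z := fun k i =>
    (h.contDiffAt_gradMat_v hzc k i).differentiableAt (by simp)
  have hb : ∀ k i, DifferentiableAt ℝ (fun y => gradMat B y k i) z := fun k i =>
    (h.contDiffAt_gradMat_B hzc k i).differentiableAt (by simp)
  have hP : ∀ k, ContDiffAt ℝ 1 (spaceDeriv (basisVec k) (pressureFun p B)) z := fun k =>
    contDiffAt_spaceDeriv (h.contDiffAt_totalPressure hzc) (by norm_cast) _
  have hPd := fun k => (hP k).differentiableAt one_ne_zero
  have hQVV : DifferentiableAt ℝ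
      (fun y => quadForm (projVec χ d₀ φ y) (gradMat v y) (gradMat v y)) z :=
    (contDiffAt_quadForm (h.contDiffAt_projField hχ hd₀ hι · hz)
      (fun k i => (h.contDiffAt_gradMat_v hzc k i).of_le (by norm_cast))
      (fun k i => (h.contDiffAt_gradMat_v hzc k i).of_le (by norm_cast))).differentiableAt one_ne_zero
  have hQbb : DifferentiableAt ℝ
      (fun y => quadForm (projVec χ d₀ φ y) (gradMat B y) (gradMat B y)) z :=
    (contDiffAt_quadForm (h.contDiffAt_projField hχ hd₀ hι · hz)
      (fun k i => (h.contDiffAt_gradMat_B hzc k i).of_le (by norm_cast))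
      (fun k i => (h.contDiffAt_gradMat_B hzc k i).of_le (by norm_cast))).differentiableAt one_ne_zero
  have hQbV : DifferentiableAt ℝ
      (fun y => quadForm (projVec χ d₀ φ y) (gradMat B y) (gradMat v y)) z :=
    (contDiffAt_quadForm (h.contDiffAt_projField hχ hd₀ hι · hz)
      (fun k i => (h.contDiffAt_gradMat_B hzc k i).of_le (by norm_cast))
      (fun k i => (h.contDiffAt_gradMat_v hzc k i).of_le (by norm_cast))).differentiableAt one_ne_zero
  have hBd : ∀ i, DifferentiableAt ℝ (coord B i) z := fun i =>
    (h.contDiffAt_B hzc i).differentiableAt (by simp)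
  have hflux : ∀ i, DifferentiableAt ℝ (fun y => projFlux (projField χ d₀ φ)
      (fun k => spaceDeriv (basisVec k) (pressureFun p B)) (gradMat v) y i) z := fun i =>
    (contDiffAt_projFlux (fun k => h.contDiffAt_projField hχ hd₀ hι k hz) hP
      (fun k i => (h.contDiffAt_gradMat_v hzc k i).of_le (by norm_cast)) i).differentiableAt one_ne_zero
  have hdB : divField (fun z => B z.1 z.2) z = 0 := h.trace_gradMat_B hzf
  -- Divergence in the second index: `∂_i ∂_k v_i = ∂_k div v = 0`.
  have hdivV : ∀ k, ∑ i, spaceDeriv (basisVec i) (fun y => gradMat v y k i) z = 0 := fun k => by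
    have h1 : ∀ i, spaceDeriv (basisVec i) (fun y => gradMat v y k i) z
        = spaceDeriv (basisVec k) (fun y => gradMat v y i i) z := fun i =>
      spaceDeriv_comm ((h.contDiffAt_v hzc i).of_le (by norm_cast)) _ _
    simp only [h1]
    rw [← spaceDeriv_sum _ fun i _ => hV i i]
    have h2 : (fun z => ∑ i, gradMat v z i i) =ᶠ[𝓝 z] fun _ => 0 := by
      filter_upwards [h.eventually_mem_openFluidRegion hz] with q hq
      exact h.trace_gradMat_v (openFluidRegion_subset _ _ hq)
    rw [spaceDeriv, h2.fderiv_eq]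
    simp
  set m := projVec χ d₀ φ z with hmdef
  set V := gradMat v z with hVdef
  set b := gradMat B z with hbdef
  set H : Matrix (Fin n) (Fin n) ℝ := fun k i =>
    spaceDeriv (basisVec k) (spaceDeriv (basisVec i) (pressureFun p B)) z with hH
  set Db : Matrix (Fin n) (Fin n) ℝ := fun k i =>
    spaceDeriv (B z.1 z.2) (fun y => gradMat B y k i) z with hDb
  set DV : Matrix (Fin n) (Fin n) ℝ := fun k i =>
    spaceDeriv (B z.1 z.2) (fun y => gradMat v y k i) z with hDV
  have hVdot : (fun k i => fderiv ℝ (fun y => gradMat v y k i) z (1, v z.1 z.2) :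
      Matrix (Fin n) (Fin n) ℝ) = (1 / (4 * Real.pi)) • (Db + b * b) - H - V * V := by
    ext k i
    refine (h.flowDeriv_gradMat_v hz k i).trans ?_
    simp only [Matrix.sub_apply, Matrix.smul_apply, Matrix.add_apply, smul_eq_mul]
    ring
  have hbdot : (fun k i => fderiv ℝ (fun y => gradMat B y k i) z (1, v z.1 z.2) :
      Matrix (Fin n) (Fin n) ℝ) = DV + b * V - V * b := by
    ext k i
    exact h.flowDeriv_gradMat_B hz k i
  have hleft : flowDeriv (v z.1 z.2) (density1 χ d₀ φ v B) z
      = flowDeriv (v z.1 z.2) (fun y => quadForm (projVec χ d₀ φ y) (gradMat v y) (gradMat v y)) z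
        + 1 / (4 * Real.pi) * flowDeriv (v z.1 z.2)
          (fun y => quadForm (projVec χ d₀ φ y) (gradMat B y) (gradMat B y)) z := by
    have h1 : HasFDerivAt (density1 χ d₀ φ v B) _ z :=
      hQVV.hasFDerivAt.add (hQbb.hasFDerivAt.const_mul (1 / (4 * Real.pi)))
    rw [flowDeriv, h1.fderiv, add_apply, smul_apply, smul_eq_mul]
    rfl
  have hright : divField (flux1 χ d₀ φ v B p) z
      = 1 / (2 * Real.pi) * spaceDeriv (B z.1 z.2)
          (fun y => quadForm (projVec χ d₀ φ y) (gradMat B y) (gradMat v y)) z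
        - 2 * (quadForm m H V - ∑ i, ∑ k, ((∑ l, spaceDeriv (basisVec i) (projField χ d₀ φ l) z *
            spaceDeriv (basisVec l) (pressureFun p B) z) * m k
          + (∑ l, m l * spaceDeriv (basisVec l) (pressureFun p B) z) *
            spaceDeriv (basisVec i) (projField χ d₀ φ k) z) * V k i) := by
    have h1 : divField (flux1 χ d₀ φ v B p) z = divField (fun z => (1 / (2 * Real.pi) *
        quadForm (projVec χ d₀ φ z) (gradMat B z) (gradMat v z)) • B z.1 z.2) z
        + divField (fun z => (-2 : ℝ) • projFlux (projField χ d₀ φ)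
          (fun k => spaceDeriv (basisVec k) (pressureFun p B)) (gradMat v) z) z :=
      divField_add (fun i => (hQbV.const_mul _).fun_mul (hBd i)) (fun i => (hflux i).const_mul (-2))
    have h2 := divField_projFlux hm hPd hV (fun i k => spaceDeriv_comm
      ((h.contDiffAt_totalPressure hzc).of_le (by norm_cast)) _ _) hdivV
    rw [h1, divField_smul (hQbV.const_mul _) hBd, divField_const_smul _ hflux, h2, hdB, mul_zero,
      zero_add, spaceDeriv, fderiv_const_mul hQbV, _root_.smul_apply, smul_eq_mul, neg_mul,
      ← sub_eq_add_neg]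
    rfl
  have e1 := fderiv_quadForm hm' hV hV (1, v z.1 z.2)
  have e2 := fderiv_quadForm hm' hb hb (1, v z.1 z.2)
  have e3 := fderiv_quadForm hm' hb hV (0, B z.1 z.2)
  rw [hVdot, quadForm_comm m V] at e1
  rw [hbdot, quadForm_comm m b] at e2
  change _ = quadForm m Db V + quadForm m b DV - _ at e3
  rw [quadForm_comm m b] at e3
  simp only [quadForm_sub, quadForm_add, quadForm_smul] at e1 e2
  have c1 : ∀ a a' : Fin n → ℝ, ∑ i, a i * a' i = ∑ i, a' i * a i := fun a a' =>
    Finset.sum_congr rfl fun i _ => mul_comm _ _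
  rw [c1 (fun i => ∑ k, m k * V k i)] at e1
  rw [c1 (fun i => ∑ k, m k * b k i)] at e2
  rw [hleft, hright]
  change fderiv ℝ _ z (1, v z.1 z.2) + _ * fderiv ℝ _ z (1, v z.1 z.2)
    = _ * fderiv ℝ _ z (0, B z.1 z.2) - _ + _
  rw [e1, e2, e3]
  unfold remainder
  simp only [flowDeriv, spaceDeriv, projVec, hmdef]
  have := Real.pi_pos
  field_simp
  ring

end IsSmoothSolution

set_option maxHeartbeats 1000000 in
/-- Algebraic bound for the lower order terms. -/
lemma abs_remainder_le {m m₁ m₂ P : Fin n → ℝ} {D V b : Matrix (Fin n) (Fin n) ℝ}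
    {M K c₁ c₂ α β γ : ℝ} (hM : 0 ≤ M) (hK : 0 ≤ K) (hc₁ : 0 ≤ c₁) (hc₂ : 0 ≤ c₂) (hα0 : 0 ≤ α)
    (hβ0 : 0 ≤ β) (hγ0 : 0 ≤ γ) (hα : α ≤ M)
    (hm : ∀ k, |m k| ≤ 1) (hm₁ : ∀ k, |m₁ k| ≤ c₁ * M) (hm₂ : ∀ k, |m₂ k| ≤ c₂ * K * γ)
    (hP : ∀ k, |P k| ≤ M) (hD : ∀ i k, |D i k| ≤ c₂ * K)
    (hV : ∀ k i, |V k i| ≤ α) (hb : ∀ k i, |b k i| ≤ β) :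
    |remainder m m₁ m₂ P D V b|
      ≤ (3 * n * (n ^ 3 + 5 * n ^ 2) + 2 * n ^ 3 * c₁ + 2 * n ^ 3 * c₂) * M *
        (α ^ 2 + β ^ 2 + K ^ 2 * (1 + γ ^ 2)) := by
  have hn : (0 : ℝ) ≤ n := Nat.cast_nonneg n
  set N : ℝ := n ^ 3 + 5 * n ^ 2 with hN
  have hN0 : 0 ≤ N := by positivity
  have q1 := abs_quadForm_le hm (abs_mul_apply_le hb hb) hV
  have q2 := abs_quadForm_le hm (abs_mul_apply_le hb hV) hb
  have q3 := abs_quadForm_le hm (abs_mul_apply_le hV hb) hb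
  have q4 := abs_quadForm_le hm (abs_mul_apply_le hV hV) hV
  have q5 := abs_vecMul_mul_le hm₁ hV hm hV
  have q6 := abs_vecMul_mul_le hm₁ hb hm hb
  have q7 := abs_vecMul_mul_le hm₂ hb hm hV
  have q8 := abs_vecMul_mul_le hm hb hm₂ hV
  have q9 : |∑ i, ∑ k, ((∑ l, D i l * P l) * m k + (∑ l, m l * P l) * D i k) * V k i|
      ≤ n * (n * ((n * (c₂ * K * M) * 1 + n * (1 * M) * (c₂ * K)) * α)) := by
    refine abs_sum_le_card_mul fun i => abs_sum_le_card_mul fun k => ?_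
    rw [abs_mul]
    refine mul_le_mul ((abs_add_le _ _).trans (add_le_add ?_ ?_)) (hV k i) (abs_nonneg _)
      (by positivity)
    · rw [abs_mul]
      refine mul_le_mul (abs_sum_le_card_mul fun l => ?_) (hm k) (abs_nonneg _) (by positivity)
      rw [abs_mul]
      exact mul_le_mul (hD i l) (hP l) (abs_nonneg _) (by positivity)
    · rw [abs_mul]
      refine mul_le_mul (abs_sum_le_card_mul fun l => ?_) (hD i k) (abs_nonneg _) (by positivity)
      rw [abs_mul]
      exact mul_le_mul (hm l) (hP l) (abs_nonneg _) zero_le_one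
  have hpi : 0 ≤ 1 / (2 * Real.pi) := by have := Real.pi_pos; positivity
  have hpi1 : 1 / (2 * Real.pi) ≤ 1 := by
    rw [div_le_one (by have := Real.pi_pos; positivity)]
    linarith [Real.pi_gt_three]
  have hmulpi : ∀ {x y : ℝ}, |x| ≤ y → |1 / (2 * Real.pi) * x| ≤ y := fun {x y} hxy => by
    rw [abs_mul, abs_of_nonneg hpi]
    exact (mul_le_of_le_one_left (abs_nonneg _) hpi1).trans hxy
  have hmul2 : ∀ {x y : ℝ}, |x| ≤ y → |2 * x| ≤ 2 * y := fun {x y} hxy => by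
    rw [abs_mul, abs_two]
    linarith
  have r1 := hmulpi (((abs_sub _ _).trans (add_le_add ((abs_add_le _ _).trans (add_le_add q1 q2)) q3)))
  have r2 := hmul2 q4
  have r3 := hmul2 q5
  have r4 := hmulpi q6
  have r5 := hmulpi ((abs_add_le _ _).trans (add_le_add q7 q8))
  have r6 := hmul2 q9
  have htot : |remainder m m₁ m₂ P D V b|
      ≤ 3 * n * N * (α * β ^ 2) + 2 * n * N * (α * α ^ 2) + 2 * n ^ 3 * c₁ * (M * α ^ 2)
        + n ^ 3 * c₁ * (M * β ^ 2) + n ^ 3 * c₂ * (α * (2 * (K * γ) * β))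
        + 2 * n ^ 3 * c₂ * (M * (2 * K * α)) := by
    unfold remainder
    refine (abs_sub _ _).trans ((add_le_add ((abs_add_le _ _).trans (add_le_add ((abs_sub _ _).trans
      (add_le_add ((abs_sub _ _).trans (add_le_add ((abs_sub _ _).trans (add_le_add r1 r2)) r3)) r4))
      r5)) r6).trans_eq ?_)
    ring
  -- Every cubic term contains a factor `V`, bounded by `α ≤ M`. The terms with derivatives of `m`
  -- along `B`, and those with the pressure gradient, are split by Young's inequality into squares
  -- of gradients and `K² (1 + γ²)`.
  have s1 : α * β ^ 2 ≤ M * β ^ 2 := by gcongr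
  have s2 : α * α ^ 2 ≤ M * α ^ 2 := by gcongr
  have s3 : α * (2 * (K * γ) * β) ≤ M * (K ^ 2 * γ ^ 2 + β ^ 2) := by
    refine mul_le_mul hα ?_ (by positivity) hM
    nlinarith [sq_nonneg (K * γ - β)]
  have s4 : M * (2 * K * α) ≤ M * (K ^ 2 + α ^ 2) :=
    mul_le_mul_of_nonneg_left (by nlinarith [sq_nonneg (K - α)]) hM
  calc _ ≤ _ := htot
    _ ≤ 3 * n * N * (M * β ^ 2) + 2 * n * N * (M * α ^ 2) + 2 * n ^ 3 * c₁ * (M * α ^ 2)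
        + n ^ 3 * c₁ * (M * β ^ 2) + n ^ 3 * c₂ * (M * (K ^ 2 * γ ^ 2 + β ^ 2))
        + 2 * n ^ 3 * c₂ * (M * (K ^ 2 + α ^ 2)) := by gcongr
    _ = (3 * n * N + 2 * n ^ 3 * c₁ + 2 * n ^ 3 * c₂) * M * (α ^ 2 + β ^ 2 + K ^ 2 * (1 + γ ^ 2))
        - (n * N * (M * α ^ 2) + 3 * n * N * (M * (K ^ 2 * (1 + γ ^ 2))) + n ^ 3 * c₁ * (M * β ^ 2)
          + 2 * n ^ 3 * c₁ * (M * (K ^ 2 * (1 + γ ^ 2)))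
          + n ^ 3 * c₂ * (M * (K ^ 2 * γ ^ 2 + β ^ 2))) := by ring
    _ ≤ _ := sub_le_self _ (by positivity)

/-! ### Boundedness, tangency and the differential inequality. -/

namespace IsSmoothSolution

variable {T ς : ℝ} {φ : ℝ → Space n → ℝ} {v B : ℝ → Space n → Space n}
  {p : ℝ → Space n → ℝ} {t : ℝ} {z : ℝ × Space n} {d₀ M K : ℝ} {χ : ℝ → ℝ}

lemma gradTensor_v_eq (h : IsSmoothSolution T ς φ v B p) (hz : z ∈ closedRegion T φ) :
    gradTensor (v z.1) z.2 = gradMat v z := by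
  ext i k
  exact h.gradTensor_v hz i k

lemma gradTensor_B_eq (h : IsSmoothSolution T ς φ v B p) (hz : z ∈ closedRegion T φ) :
    gradTensor (B z.1) z.2 = gradMat B z := by
  ext i k
  exact h.gradTensor_B hz i k

lemma abs_projVec_le (hχ : IsCutoff χ) (z : ℝ × Space n) (k : Fin n) :
    |projVec χ d₀ φ z k| ≤ 1 :=
  (sq_le_one_iff_abs_le_one _).1 ((Finset.single_le_sum
    (f := fun i => projField χ d₀ φ i z ^ 2) (fun _ _ => sq_nonneg _) (Finset.mem_univ k)).trans
    (sum_projField_sq_le hχ d₀ φ z))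

lemma abs_spaceDeriv_pressure_le (h : IsSmoothSolution T ς φ v B p)
    (hM : ∀ t ∈ Icc 0 T, ∀ x ∈ dom φ t, ‖gradient (totalPressure p B t) x‖ ≤ M)
    (hz : z ∈ fluidRegion T φ) (k : Fin n) :
    |spaceDeriv (basisVec k) (pressureFun p B) z| ≤ M := by
  have hP : DifferentiableAt ℝ (pressureFun p B) (z.1, z.2) :=
    (h.contDiffAt_totalPressure (fluidRegion_subset _ _ hz)).differentiableAt (by simp)
  have h1 := fderiv_slice hP (basisVec k)
  have h2 : DifferentiableAt ℝ (totalPressure p B z.1) z.2 := (hasFDerivAt_slice hP).differentiableAt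
  have h3 : spaceDeriv (basisVec k) (pressureFun p B) z
      = inner ℝ (gradient (totalPressure p B z.1) z.2) (basisVec k) :=
    h1.symm.trans (inner_gradient h2 _).symm
  rw [h3]
  refine (abs_real_inner_le_norm _ _).trans ?_
  simpa using hM z.1 hz.1 z.2 hz.2

lemma contDiffAt_density1 [NeZero n] (h : IsSmoothSolution T ς φ v B p) (hχ : IsCutoff χ)
    (hd₀ : 0 < d₀) (hι : ∀ t ∈ Icc 0 T, ENNReal.ofReal d₀ < injRadius φ t)
    (hz : z ∈ openFluidRegion T φ) : ContDiffAt ℝ 1 (density1 χ d₀ φ v B) z := by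
  have hzc := fluidRegion_subset _ _ (openFluidRegion_subset _ _ hz)
  exact (contDiffAt_quadForm (h.contDiffAt_projField hχ hd₀ hι · hz)
    (fun k i => (h.contDiffAt_gradMat_v hzc k i).of_le (by norm_cast))
    (fun k i => (h.contDiffAt_gradMat_v hzc k i).of_le (by norm_cast))).add
    (contDiffAt_const.mul (contDiffAt_quadForm (h.contDiffAt_projField hχ hd₀ hι · hz)
      (fun k i => (h.contDiffAt_gradMat_B hzc k i).of_le (by norm_cast))
      (fun k i => (h.contDiffAt_gradMat_B hzc k i).of_le (by norm_cast))))

lemma continuousOn_gradMat_v (h : IsSmoothSolution T ς φ v B p) (k i : Fin n) :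
    ContinuousOn (fun z => gradMat v z k i) (fluidRegion T φ) := fun _ hz =>
  (h.contDiffAt_gradMat_v (fluidRegion_subset _ _ hz) k i).continuousAt.continuousWithinAt

lemma continuousOn_gradMat_B (h : IsSmoothSolution T ς φ v B p) (k i : Fin n) :
    ContinuousOn (fun z => gradMat B z k i) (fluidRegion T φ) := fun _ hz =>
  (h.contDiffAt_gradMat_B (fluidRegion_subset _ _ hz) k i).continuousAt.continuousWithinAt

lemma continuousOn_density1 [NeZero n] (h : IsSmoothSolution T ς φ v B p) (hχ : IsCutoff χ)
    (hd₀ : 0 < d₀) (hι : ∀ t ∈ Icc 0 T, ENNReal.ofReal d₀ < injRadius φ t) :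
    ContinuousOn (density1 χ d₀ φ v B) (fluidRegion T φ) :=
  (continuousOn_quadForm (fun k => h.continuousOn_projField hχ hd₀ hι k) h.continuousOn_gradMat_v
    h.continuousOn_gradMat_v).add (continuousOn_const.mul (continuousOn_quadForm
      (fun k => h.continuousOn_projField hχ hd₀ hι k) h.continuousOn_gradMat_B
      h.continuousOn_gradMat_B))

lemma exists_bound_gradMat (h : IsSmoothSolution T ς φ v B p) :
    ∃ A : ℝ, 0 ≤ A ∧ ∀ z ∈ closedRegion T φ,
      (∀ k i, |gradMat v z k i| ≤ A) ∧ ∀ k i, |gradMat B z k i| ≤ A := by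
  obtain ⟨A, hA0, hA⟩ := h.exists_bound_family (g := fun (q : Fin n × Fin n) z => gradMat v z q.1 q.2)
    fun q z hz => (h.contDiffAt_gradMat_v hz q.1 q.2).continuousAt
  obtain ⟨A', hA'0, hA'⟩ := h.exists_bound_family
    (g := fun (q : Fin n × Fin n) z => gradMat B z q.1 q.2)
    fun q z hz => (h.contDiffAt_gradMat_B hz q.1 q.2).continuousAt
  exact ⟨max A A', le_max_of_le_left hA0, fun z hz => ⟨fun k i => (hA z hz (k, i)).trans
    (le_max_left _ _), fun k i => (hA' z hz (k, i)).trans (le_max_right _ _)⟩⟩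

lemma exists_bound_density1 (h : IsSmoothSolution T ς φ v B p) (hχ : IsCutoff χ) (d₀ : ℝ) :
    ∃ A : ℝ, ∀ z ∈ fluidRegion T φ, |density1 χ d₀ φ v B z| ≤ A := by
  obtain ⟨A, hA0, hA⟩ := h.exists_bound_gradMat
  refine ⟨(n ^ 3 + 5 * n ^ 2) * (A * A) + |1 / (4 * Real.pi)| * ((n ^ 3 + 5 * n ^ 2) * (A * A)),
    fun z hz => ?_⟩
  obtain ⟨h1, h2⟩ := hA z (fluidRegion_subset _ _ hz)
  refine (abs_add_le _ _).trans (add_le_add (abs_quadForm_le (abs_projVec_le hχ z) h1 h1) ?_)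
  rw [abs_mul]
  exact mul_le_mul_of_nonneg_left (abs_quadForm_le (abs_projVec_le hχ z) h2 h2) (abs_nonneg _)

lemma isTangentField_flux1 [NeZero n] (h : IsSmoothSolution T ς φ v B p) (hχ : IsCutoff χ)
    (hd₀ : 0 < d₀) (hι : ∀ t ∈ Icc 0 T, ENNReal.ofReal d₀ < injRadius φ t) :
    IsTangentField T φ (flux1 χ d₀ φ v B p) := by
  have hsub : ∀ z ∈ openFluidRegion T φ, z ∈ closedRegion T φ := fun z hz =>
    fluidRegion_subset _ _ (openFluidRegion_subset _ _ hz)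
  obtain ⟨A, hA0, hA⟩ := h.exists_bound_gradMat
  refine IsTangentField.add (h.isTangentField_B.smul (fun z hz => ?_) ?_)
    (IsTangentField.const_smul (h.isTangentField_of_abs_le (fun z hz i => ?_) ?_) _)
  · exact contDiffAt_const.mul (contDiffAt_quadForm (h.contDiffAt_projField hχ hd₀ hι · hz)
      (fun k i => (h.contDiffAt_gradMat_B (hsub z hz) k i).of_le (by norm_cast))
      (fun k i => (h.contDiffAt_gradMat_v (hsub z hz) k i).of_le (by norm_cast)))
  · refine ⟨|1 / (2 * Real.pi)| * ((n ^ 3 + 5 * n ^ 2) * (A * A)), fun z hz => ?_⟩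
    obtain ⟨h1, h2⟩ := hA z (hsub z hz)
    rw [abs_mul]
    exact mul_le_mul_of_nonneg_left (abs_quadForm_le (abs_projVec_le hχ z) h2 h1) (abs_nonneg _)
  · exact contDiffAt_projFlux (fun k => h.contDiffAt_projField hχ hd₀ hι k hz)
      (fun k => contDiffAt_spaceDeriv (h.contDiffAt_totalPressure (hsub z hz)) (by norm_cast) _)
      (fun k i => (h.contDiffAt_gradMat_v (hsub z hz) k i).of_le (by norm_cast)) i
  · obtain ⟨A', hA'0, hA'⟩ := h.exists_abs_proj_totalPressure_le hχ hd₀ hι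
    refine ⟨n * (A' * A), fun z hz i => ?_⟩
    refine (abs_sum_le_card_mul (a := A' * |φ z.1 z.2| * A) fun k => ?_).trans_eq (by ring)
    rw [abs_mul]
    exact mul_le_mul (hA' z hz k) ((hA z (hsub z hz)).1 k i) (abs_nonneg _) (by positivity)

lemma sq_norm_B_le (v B : ℝ → Space n → Space n) (z : ℝ × Space n) :
    ‖B z.1 z.2‖ ^ 2 ≤ 8 * Real.pi * density0 v B z := by
  have h1 := density0_eq v B z.1 z.2
  rw [Prod.mk.eta] at h1
  rw [h1]
  have := Real.pi_pos
  have h2 : 8 * Real.pi * (1 / 2 * ‖v z.1 z.2‖ ^ 2 + 1 / (8 * Real.pi) * ‖B z.1 z.2‖ ^ 2)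
      = 4 * Real.pi * ‖v z.1 z.2‖ ^ 2 + ‖B z.1 z.2‖ ^ 2 := by
    field_simp
    ring
  rw [h2]
  have : 0 ≤ 4 * Real.pi * ‖v z.1 z.2‖ ^ 2 := by positivity
  linarith

lemma density0_nonneg (v B : ℝ → Space n → Space n) (z : ℝ × Space n) : 0 ≤ density0 v B z :=
  nonneg_of_mul_nonneg_right ((sq_nonneg _).trans (sq_norm_B_le v B z))
    (by have := Real.pi_pos; positivity)

lemma density1_nonneg [NeZero n] (h : IsSmoothSolution T ς φ v B p) (hχ : IsCutoff χ) (d₀ : ℝ)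
    (hz : z ∈ fluidRegion T φ) : 0 ≤ density1 χ d₀ φ v B z :=
  add_nonneg (quadForm_nonneg (sum_projField_sq_le hχ d₀ φ z) (h.trace_gradMat_v hz))
    (mul_nonneg (by have := Real.pi_pos; positivity)
      (quadForm_nonneg (sum_projField_sq_le hχ d₀ φ z) (h.trace_gradMat_B hz)))

/-- The differential inequality for the first order energy density. The constant `Cχ` bounds the
derivative of the cutoff function. -/
lemma flowDeriv_density1_le [NeZero n] (h : IsSmoothSolution T ς φ v B p) (hχ : IsCutoff χ)
    {Cχ c₀ : ℝ} (hC : ∀ s, |deriv χ s| ≤ Cχ) (hC0 : 0 ≤ Cχ) (hM0 : 0 ≤ M)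
    (hP : ∀ t ∈ Icc 0 T, ∀ x ∈ dom φ t, ‖gradient (totalPressure p B t) x‖ ≤ M)
    (hM : ∀ t ∈ Icc 0 T, ∀ x ∈ dom φ t, tensorNorm (gradTensor (v t) x) ≤ M)
    (hd₀ : 0 < d₀) (hι : ∀ t ∈ Icc 0 T, ENNReal.ofReal d₀ < injRadius φ t)
    (hc₀ : 0 < c₀) (hK : c₀ ≤ d₀ * K) (hz : z ∈ openFluidRegion T φ) :
    flowDeriv (v z.1 z.2) (density1 χ d₀ φ v B) z ≤ divField (flux1 χ d₀ φ v B p) z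
      + ((3 * n * (n ^ 3 + 5 * n ^ 2) + 2 * n ^ 3 * (n * (Cχ + 4 + 4 * n))
        + 2 * n ^ 3 * (n * ((Cχ + 4) / c₀))) * (4 * Real.pi * (5 + 2 * n))) * M *
        (density1 χ d₀ φ v B z + K ^ 2 * (1 + density0 v B z)) := by
  have hzf := openFluidRegion_subset _ _ hz
  have hzc := fluidRegion_subset _ _ hzf
  have hpi := Real.pi_gt_three
  have hn1 : (1 : ℝ) ≤ n := by
    have := NeZero.one_le (n := n)
    exact_mod_cast this
  have hK0 : 0 < K := pos_of_mul_pos_right (hc₀.trans_le hK) hd₀.le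
  -- The hypothesis `c₀ ≤ d₀ K` converts the scale `1 / d₀` of the projection field into `K / c₀`.
  have hDK : (Cχ + 4) / d₀ ≤ (Cχ + 4) / c₀ * K := by
    rw [div_mul_eq_mul_div, div_le_div_iff₀ hd₀ hc₀, mul_assoc]
    refine mul_le_mul_of_nonneg_left ?_ (by positivity)
    linarith
  have hD' : ∀ i k, |spaceDeriv (basisVec i) (projField χ d₀ φ k) z| ≤ (Cχ + 4) / c₀ * K :=
    fun i k => (h.abs_spaceDeriv_projField_le hχ hC hC0 hd₀ hι hz k i).trans hDK
  have hDpos : 0 ≤ (Cχ + 4) / c₀ * K := by positivity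
  have hD : ∀ i k, |spaceDeriv (basisVec i) (projField χ d₀ φ k) z| ≤ n * ((Cχ + 4) / c₀) * K :=
    fun i k => (hD' i k).trans (by rw [mul_assoc]; exact le_mul_of_one_le_left hDpos hn1)
  have hm₂ : ∀ k, |spaceDeriv (B z.1 z.2) (projField χ d₀ φ k) z|
      ≤ n * ((Cχ + 4) / c₀) * K * ‖B z.1 z.2‖ := fun k => by
    rw [spaceDeriv_eq_sum]
    refine (abs_sum_le_card_mul (a := ‖B z.1 z.2‖ * ((Cχ + 4) / c₀ * K)) fun i => ?_).trans_eq
      (by ring)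
    rw [abs_mul]
    exact mul_le_mul (PiLp.norm_apply_le (B z.1 z.2) i) (hD' i k) (abs_nonneg _) (norm_nonneg _)
  have hrem := abs_remainder_le (α := tensorNorm (gradMat v z)) (β := tensorNorm (gradMat B z))
    hM0 hK0.le (c₁ := n * (Cχ + 4 + 4 * n)) (c₂ := n * ((Cχ + 4) / c₀)) (by positivity)
    (by positivity) (tensorNorm_nonneg _) (tensorNorm_nonneg _) (norm_nonneg (B z.1 z.2))
    (by rw [← h.gradTensor_v_eq hzc]; exact hM z.1 hzf.1 z.2 hzf.2) (abs_projVec_le (d₀ := d₀) (φ := φ) hχ z)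
    (fun k => h.abs_flowDeriv_projField_le hχ hC hC0 hM0 hM hd₀ hι hz k) hm₂
    (fun k => h.abs_spaceDeriv_pressure_le hP hzf k) hD (abs_apply_le_tensorNorm _)
    (abs_apply_le_tensorNorm _)
  rw [h.flowDeriv_density1 hχ hd₀ hι hz]
  refine add_le_add_right ((le_abs_self _).trans (hrem.trans ?_)) _
  set C₁ : ℝ := 3 * n * (n ^ 3 + 5 * n ^ 2) + 2 * n ^ 3 * (n * (Cχ + 4 + 4 * n))
        + 2 * n ^ 3 * (n * ((Cχ + 4) / c₀)) with hC₁
  have hC₁0 : 0 ≤ C₁ := by positivity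
  rw [tensorNorm_sq, tensorNorm_sq]
  have k1 := tensorNormSq_le_quadForm (sum_projField_sq_le hχ d₀ φ z) (h.trace_gradMat_v hzf)
  have k2 := tensorNormSq_le_quadForm (sum_projField_sq_le hχ d₀ φ z) (h.trace_gradMat_B hzf)
  have k3 := quadForm_nonneg (sum_projField_sq_le hχ d₀ φ z) (h.trace_gradMat_v hzf)
  have k5 := sq_norm_B_le v B z
  have k6 := density0_nonneg v B z
  have hden : density1 χ d₀ φ v B z = quadForm (fun i => projField χ d₀ φ i z) (gradMat v z) (gradMat v z)
    + 1 / (4 * Real.pi) * quadForm (fun i => projField χ d₀ φ i z) (gradMat B z) (gradMat B z) := rfl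
  have k7 : 4 * Real.pi * (5 + 2 * n) * density1 χ d₀ φ v B z
      = 4 * Real.pi * ((5 + 2 * n) * quadForm (fun i => projField χ d₀ φ i z) (gradMat v z) (gradMat v z))
        + (5 + 2 * n) * quadForm (fun i => projField χ d₀ φ i z) (gradMat B z) (gradMat B z) := by
    rw [hden]
    field_simp
  -- Coercivity recovers the full gradients; the factor `4π` undoes the weight `1 / (4π)` of the
  -- magnetic part.
  have k8 : tensorNormSq (gradMat v z) + tensorNormSq (gradMat B z)
      ≤ 4 * Real.pi * (5 + 2 * n) * density1 χ d₀ φ v B z := by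
    rw [k7]
    refine add_le_add ?_ k2
    have : 0 ≤ (5 + 2 * (n : ℝ)) * quadForm (fun i => projField χ d₀ φ i z) (gradMat v z) (gradMat v z) := by
      positivity
    nlinarith
  -- Since `8π ≤ 4π (5 + 2n)`, the same constant serves for the term with `|B|²`.
  have k9 : 1 + ‖B z.1 z.2‖ ^ 2 ≤ 4 * Real.pi * (5 + 2 * n) * (1 + density0 v B z) := by
    have : 8 * Real.pi * (1 + density0 v B z) ≤ 4 * Real.pi * (5 + 2 * n) * (1 + density0 v B z) :=
      mul_le_mul_of_nonneg_right (by nlinarith) (by linarith)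
    nlinarith
  calc _ ≤ C₁ * M * (4 * Real.pi * (5 + 2 * n) * density1 χ d₀ φ v B z
        + K ^ 2 * (4 * Real.pi * (5 + 2 * n) * (1 + density0 v B z))) := by gcongr
    _ = _ := by ring

end IsSmoothSolution

/-! ### Conserved quantities and the energy estimate. -/

namespace IsSmoothSolution

variable {T ς : ℝ} {φ : ℝ → Space n → ℝ} {v B : ℝ → Space n → Space n}
  {p : ℝ → Space n → ℝ} {t : ℝ} {z : ℝ × Space n} {d₀ M K : ℝ} {χ : ℝ → ℝ}

lemma integrableOn_density0 (h : IsSmoothSolution T ς φ v B p) (ht : t ∈ Icc 0 T) :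
    IntegrableOn (fun x => density0 v B (t, x)) (dom φ t) := by
  obtain ⟨A, -, hA⟩ := h.exists_bound fun z hz => (h.contDiffAt_density0 hz).continuousAt
  exact h.integrableOn_dom (fun z hz =>
    (h.contDiffAt_density0 (fluidRegion_subset _ _ hz)).continuousAt.continuousWithinAt)
    (fun z hz => hA z (fluidRegion_subset _ _ hz)) ht

lemma energy0_eq (φ : ℝ → Space n → ℝ) (v B : ℝ → Space n → Space n) (t : ℝ) :
    energy0 φ v B t = ∫ x in dom φ t, density0 v B (t, x) := by
  simp only [energy0, density0_eq]

/-- A density transported by a tangential flux has constant integral. -/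
lemma integral_eq_of_flowDeriv_eq [NeZero n] (h : IsSmoothSolution T ς φ v B p)
    {f : ℝ × Space n → ℝ} {X : ℝ × Space n → Space n}
    (hf : ∀ z ∈ closedRegion T φ, ContDiffAt ℝ 1 f z) (hX : IsTangentField T φ X)
    (heq : ∀ z ∈ openFluidRegion T φ, flowDeriv (v z.1 z.2) f z = divField X z)
    (ht : t ∈ Icc 0 T) : ∫ x in dom φ t, f (t, x) = ∫ x in dom φ 0, f (0, x) := by
  obtain ⟨A, -, hA⟩ := h.exists_bound fun z hz => (hf z hz).continuousAt
  have hc : ContinuousOn f (fluidRegion T φ) := fun z hz =>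
    (hf z (fluidRegion_subset _ _ hz)).continuousAt.continuousWithinAt
  have hsub : ∀ z ∈ openFluidRegion T φ, z ∈ closedRegion T φ := fun z hz =>
    fluidRegion_subset _ _ (openFluidRegion_subset _ _ hz)
  refine le_antisymm ?_ ?_
  · have h1 := h.integral_le (f := f) le_rfl hc (fun z hz => hf z (hsub z hz))
      ⟨A, fun z hz => hA z (fluidRegion_subset _ _ hz)⟩ hX.contDiffAt hX.tangent
      (fun z hz => by rw [zero_mul, add_zero]; exact (heq z hz).le) ht
    simpa using h1
  -- The transport inequality for `-f`, with the reversed flux, gives the other direction.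
  · have hX' := hX.const_smul (-1)
    have h1 := h.integral_le (f := fun z => -f z) le_rfl hc.neg (fun z hz => (hf z (hsub z hz)).neg)
      ⟨A, fun z hz => by rw [abs_neg]; exact hA z (fluidRegion_subset _ _ hz)⟩ hX'.contDiffAt
      hX'.tangent (fun z hz => by
        rw [zero_mul, add_zero]
        have h2 : divField (fun z => (-1 : ℝ) • X z) z = -divField X z := by
          rw [divField_const_smul _ (hX.differentiableAt hz), neg_one_mul]
        refine le_of_eq (Eq.trans ?_ h2.symm)
        rw [← heq z hz, flowDeriv, fderiv_fun_neg, _root_.neg_apply]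
        rfl) ht
    simp only [zero_mul, Real.exp_zero, one_mul, integral_neg] at h1
    linarith

lemma energy0_conserved [NeZero n] (h : IsSmoothSolution T ς φ v B p) (ht : t ∈ Icc 0 T) :
    energy0 φ v B t = energy0 φ v B 0 := by
  rw [energy0_eq, energy0_eq]
  exact h.integral_eq_of_flowDeriv_eq (fun z hz => (h.contDiffAt_density0 hz).of_le (by norm_cast))
    h.isTangentField_flux0 (fun z hz => h.flowDeriv_density0 hz) ht

lemma volume_conserved [NeZero n] (h : IsSmoothSolution T ς φ v B p) (ht : t ∈ Icc 0 T) :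
    volume.real (dom φ t) = volume.real (dom φ 0) := by
  have h0 : IsTangentField T φ fun _ => 0 :=
    ⟨fun _ _ _ => contDiffAt_const, 0, fun z _ => by
      have : spaceDeriv (0 : Space n) (levelFun φ) z = 0 := map_zero (fderiv ℝ (levelFun φ) z)
      rw [this, abs_zero, zero_mul]⟩
  have h1 := h.integral_eq_of_flowDeriv_eq (f := fun _ => 1) (fun _ _ => contDiffAt_const) h0
    (fun z _ => by simp [flowDeriv, divField, spaceDeriv]) ht
  simpa using h1

lemma integrableOn_density1 [NeZero n] (h : IsSmoothSolution T ς φ v B p) (hχ : IsCutoff χ)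
    (hd₀ : 0 < d₀) (hι : ∀ t ∈ Icc 0 T, ENNReal.ofReal d₀ < injRadius φ t) (ht : t ∈ Icc 0 T) :
    IntegrableOn (fun x => density1 χ d₀ φ v B (t, x)) (dom φ t) := by
  obtain ⟨A, hA⟩ := h.exists_bound_density1 hχ d₀
  exact h.integrableOn_dom (h.continuousOn_density1 hχ hd₀ hι) hA ht

/-- Merging the two integrals of the energy requires integrability of each. The curl part is bounded
and continuous by smoothness of the fields; the projected part is the difference of `density1` and
the curl part. -/
lemma energy1_eq [NeZero n] (h : IsSmoothSolution T ς φ v B p) (hχ : IsCutoff χ)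
    (hd₀ : 0 < d₀) (hι : ∀ t ∈ Icc 0 T, ENNReal.ofReal d₀ < injRadius φ t) (ht : t ∈ Icc 0 T) :
    energy1 χ d₀ φ v B t = ∫ x in dom φ t, density1 χ d₀ φ v B (t, x) := by
  have hmeas := (h.isOpen_dom t).measurableSet
  have hmem : ∀ x ∈ dom φ t, ((t, x) : ℝ × Space n) ∈ closedRegion T φ := fun x hx =>
    fluidRegion_subset _ _ ⟨ht, hx⟩
  have hsum : ∀ x ∈ dom φ t, (projGradSq χ d₀ φ t (v t) x + 1 / (4 * Real.pi) *
      projGradSq χ d₀ φ t (B t) x) + (tensorNormSq (curl (v t) x)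
      + 1 / (4 * Real.pi) * tensorNormSq (curl (B t) x)) = density1 χ d₀ φ v B (t, x) := by
    intro x hx
    have h1 := projGradSq_add_curl χ d₀ φ t (v t) x
    have h2 := projGradSq_add_curl χ d₀ φ t (B t) x
    rw [show gradTensor (v t) x = gradMat v (t, x) from h.gradTensor_v_eq (hmem x hx)] at h1
    rw [show gradTensor (B t) x = gradMat B (t, x) from h.gradTensor_B_eq (hmem x hx)] at h2
    have h3 : density1 χ d₀ φ v B (t, x) = quadForm (fun k => projField χ d₀ φ k (t, x))
        (gradMat v (t, x)) (gradMat v (t, x)) + 1 / (4 * Real.pi) * quadForm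
        (fun k => projField χ d₀ φ k (t, x)) (gradMat B (t, x)) (gradMat B (t, x)) := rfl
    rw [h3, ← h1, ← h2]
    ring
  set c : ℝ × Space n → ℝ := fun z =>
    ∑ i, ∑ j, (gradMat v z i j - gradMat v z j i) ^ 2
      + 1 / (4 * Real.pi) * ∑ i, ∑ j, (gradMat B z i j - gradMat B z j i) ^ 2 with hc
  have hcs : ∀ z ∈ closedRegion T φ, ContDiffAt ℝ ∞ c z := fun z hz =>
    (ContDiffAt.sum fun i _ => ContDiffAt.sum fun j _ =>
      ((h.contDiffAt_gradMat_v hz i j).sub (h.contDiffAt_gradMat_v hz j i)).pow 2).add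
    (contDiffAt_const.mul (ContDiffAt.sum fun i _ => ContDiffAt.sum fun j _ =>
      ((h.contDiffAt_gradMat_B hz i j).sub (h.contDiffAt_gradMat_B hz j i)).pow 2))
  obtain ⟨A, -, hA⟩ := h.exists_bound fun z hz => (hcs z hz).continuousAt
  have hcint : IntegrableOn (fun x => c (t, x)) (dom φ t) := h.integrableOn_dom (fun z hz =>
    (hcs z (fluidRegion_subset _ _ hz)).continuousAt.continuousWithinAt)
    (fun z hz => hA z (fluidRegion_subset _ _ hz)) ht
  have hceq : ∀ x ∈ dom φ t, tensorNormSq (curl (v t) x)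
      + 1 / (4 * Real.pi) * tensorNormSq (curl (B t) x) = c (t, x) := by
    intro x hx
    have h1 : ∀ i j, curl (v t) x i j = gradMat v (t, x) i j - gradMat v (t, x) j i := fun i j => by
      rw [curl, show gradTensor (v t) x = gradMat v (t, x) from h.gradTensor_v_eq (hmem x hx)]
    have h2 : ∀ i j, curl (B t) x i j = gradMat B (t, x) i j - gradMat B (t, x) j i := fun i j => by
      rw [curl, show gradTensor (B t) x = gradMat B (t, x) from h.gradTensor_B_eq (hmem x hx)]
    simp only [tensorNormSq, h1, h2, hc]
  have hcurl : IntegrableOn (fun x => tensorNormSq (curl (v t) x)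
      + 1 / (4 * Real.pi) * tensorNormSq (curl (B t) x)) (dom φ t) :=
    hcint.congr_fun (fun x hx => (hceq x hx).symm) hmeas
  have hproj : IntegrableOn (fun x => projGradSq χ d₀ φ t (v t) x + 1 / (4 * Real.pi) *
      projGradSq χ d₀ φ t (B t) x) (dom φ t) :=
    ((h.integrableOn_density1 hχ hd₀ hι ht).sub hcurl).congr_fun (fun x hx => by
      have := hsum x hx
      simp only [Pi.sub_apply]
      linarith) hmeas
  rw [energy1, ← integral_add hproj hcurl]
  exact setIntegral_congr_fun hmeas hsum

/-- The energy estimate with a constant depending on a bound `Cχ` for the derivative of the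
cutoff function. -/
theorem energy1_le [NeZero n] (h : IsSmoothSolution T ς φ v B p) (hχ : IsCutoff χ)
    {Cχ c₀ C : ℝ} (hC : ∀ s, |deriv χ s| ≤ Cχ) (hC0 : 0 ≤ Cχ)
    (hP : ∀ t ∈ Icc 0 T, ∀ x ∈ dom φ t, ‖gradient (totalPressure p B t) x‖ ≤ M)
    (hM : ∀ t ∈ Icc 0 T, ∀ x ∈ dom φ t, tensorNorm (gradTensor (v t) x) ≤ M)
    (hd₀ : 0 < d₀) (hι : ∀ t ∈ Icc 0 T, ENNReal.ofReal d₀ < injRadius φ t)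
    (hc₀ : 0 < c₀) (hK : c₀ ≤ d₀ * K) (hC1 : 1 ≤ C)
    (hCle : ((3 * n * (n ^ 3 + 5 * n ^ 2) + 2 * n ^ 3 * (n * (Cχ + 4 + 4 * n))
      + 2 * n ^ 3 * (n * ((Cχ + 4) / c₀))) * (4 * Real.pi * (5 + 2 * n))) ≤ C)
    (ht : t ∈ Icc 0 T) :
    energy1 χ d₀ φ v B t ≤ 2 * Real.exp (C * M * t) * energy1 χ d₀ φ v B 0
      + C * K ^ 2 * (volume.real (dom φ t) + energy0 φ v B 0) * (Real.exp (C * M * t) - 1) := by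
  have h0T : (0 : ℝ) ∈ Icc 0 T := ⟨le_rfl, ht.1.trans ht.2⟩
  -- The initial domain is nonempty, so `M` bounds a norm at some point.
  have hM0 : 0 ≤ M := by
    obtain ⟨x, hx⟩ := h.connected.nonempty
    exact (tensorNorm_nonneg _).trans (hM 0 h0T x hx)
  have hsub : ∀ z ∈ openFluidRegion T φ, z ∈ closedRegion T φ := fun z hz =>
    fluidRegion_subset _ _ (openFluidRegion_subset _ _ hz)
  -- Adding `K² (1 + density0)`, whose integral is conserved, absorbs the inhomogeneous term and
  -- makes the differential inequality linear in `f`.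
  set f : ℝ × Space n → ℝ := fun z => density1 χ d₀ φ v B z + K ^ 2 * (1 + density0 v B z) with hf
  have hd0s : ∀ z ∈ closedRegion T φ, ContDiffAt ℝ 1 (fun z => K ^ 2 * (1 + density0 v B z)) z :=
    fun z hz => (contDiffAt_const.mul (contDiffAt_const.add (h.contDiffAt_density0 hz))).of_le
      (by norm_cast)
  have hfc : ContinuousOn f (fluidRegion T φ) :=
    (h.continuousOn_density1 hχ hd₀ hι).add fun z hz =>
      (hd0s z (fluidRegion_subset _ _ hz)).continuousAt.continuousWithinAt
  obtain ⟨A, hA⟩ := h.exists_bound_density1 hχ d₀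
  obtain ⟨A', -, hA'⟩ := h.exists_bound fun z hz => (hd0s z hz).continuousAt
  have hfA : ∀ z ∈ fluidRegion T φ, |f z| ≤ A + A' := fun z hz =>
    (abs_add_le _ _).trans (add_le_add (hA z hz) (hA' z (fluidRegion_subset _ _ hz)))
  have hX0 := (h.isTangentField_flux0).const_smul (K ^ 2)
  have hX1 := h.isTangentField_flux1 hχ hd₀ hι
  have hX := hX1.add hX0
  have hineq : ∀ z ∈ openFluidRegion T φ, flowDeriv (v z.1 z.2) f z
      ≤ divField (fun z => flux1 χ d₀ φ v B p z + K ^ 2 • flux0 ς v B p z) z + C * M * f z := by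
    intro z hz
    have h1 := h.flowDeriv_density1_le hχ hC hC0 hM0 hP hM hd₀ hι hc₀ hK hz
    have h2 := h.flowDeriv_density0 hz
    have hd1 := (h.contDiffAt_density1 hχ hd₀ hι hz).differentiableAt one_ne_zero
    have hd2 : DifferentiableAt ℝ (density0 v B) z :=
      (h.contDiffAt_density0 (hsub z hz)).differentiableAt (by simp)
    have h3 : HasFDerivAt f _ z := hd1.hasFDerivAt.add
      ((hd2.hasFDerivAt.const_add 1).const_mul (K ^ 2))
    have h4 : flowDeriv (v z.1 z.2) f z = flowDeriv (v z.1 z.2) (density1 χ d₀ φ v B) z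
        + K ^ 2 * flowDeriv (v z.1 z.2) (density0 v B) z := by
      rw [flowDeriv, h3.fderiv, add_apply, smul_apply, smul_eq_mul]
      rfl
    rw [h4, h2, divField_add (hX1.differentiableAt hz) (hX0.differentiableAt hz),
      divField_const_smul _ (h.isTangentField_flux0.differentiableAt hz)]
    have hf0 : 0 ≤ f z := add_nonneg (h.density1_nonneg hχ d₀ (openFluidRegion_subset _ _ hz))
      (mul_nonneg (sq_nonneg _) (add_nonneg zero_le_one (density0_nonneg v B z)))
    have h5 := mul_le_mul_of_nonneg_right (mul_le_mul_of_nonneg_right hCle hM0) hf0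
    linarith
  have hmain := h.integral_le (a := C * M) (by positivity) hfc (fun z hz =>
    (h.contDiffAt_density1 hχ hd₀ hι hz).add (hd0s z (hsub z hz))) ⟨_, hfA⟩ hX.contDiffAt hX.tangent
    hineq ht
  -- By conservation of volume and energy the added integral is the same at all times, so it can be
  -- subtracted after the exponential estimate.
  have hsplit : ∀ s ∈ Icc 0 T, ∫ x in dom φ s, f (s, x)
      = energy1 χ d₀ φ v B s + K ^ 2 * (volume.real (dom φ t) + energy0 φ v B 0) := by
    intro s hs
    have hfin : IntegrableOn (fun _ : Space n => (1 : ℝ)) (dom φ s) :=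
      h.integrableOn_dom (f := fun _ => 1) (A := 1) continuousOn_const (fun _ _ => by simp) hs
    have hi0 := h.integrableOn_density0 hs
    have h1 : ∫ x in dom φ s, f (s, x) = (∫ x in dom φ s, density1 χ d₀ φ v B (s, x))
        + ∫ x in dom φ s, K ^ 2 * (1 + density0 v B (s, x)) :=
      integral_add (h.integrableOn_density1 hχ hd₀ hι hs) ((hfin.add hi0).const_mul (K ^ 2))
    have h2 : ∫ x in dom φ s, (1 + density0 v B (s, x))
        = (∫ _ in dom φ s, (1 : ℝ)) + ∫ x in dom φ s, density0 v B (s, x) := integral_add hfin hi0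
    rw [h1, ← h.energy1_eq hχ hd₀ hι hs, integral_const_mul, h2, ← energy0_eq,
      h.energy0_conserved hs, h.volume_conserved ht, ← h.volume_conserved hs]
    simp
  rw [hsplit t ht, hsplit 0 h0T] at hmain
  have hE1 : 0 ≤ energy1 χ d₀ φ v B 0 := by
    rw [h.energy1_eq hχ hd₀ hι h0T]
    exact setIntegral_nonneg (h.isOpen_dom 0).measurableSet fun x hx =>
      h.density1_nonneg hχ d₀ (z := (0, x)) ⟨h0T, hx⟩
  have hE0 : 0 ≤ energy0 φ v B 0 := by
    rw [energy0_eq]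
    exact integral_nonneg fun x => density0_nonneg v B (0, x)
  have hexp : 1 ≤ Real.exp (C * M * t) := Real.one_le_exp (by
    have := ht.1
    positivity)
  set W := K ^ 2 * (volume.real (dom φ t) + energy0 φ v B 0) with hW
  have hW0 : 0 ≤ W := mul_nonneg (sq_nonneg _) (add_nonneg measureReal_nonneg hE0)
  have h1 : W * (Real.exp (C * M * t) - 1) ≤ C * (W * (Real.exp (C * M * t) - 1)) :=
    le_mul_of_one_le_left (mul_nonneg hW0 (by linarith)) hC1
  have h2 : 0 ≤ Real.exp (C * M * t) * energy1 χ d₀ φ v B 0 := by positivity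
  -- The argument gives the factors `1` and `W`; nonnegativity of the initial energy and `C ≥ 1`
  -- permit the larger factors `2` and `C W`.
  calc energy1 χ d₀ φ v B t ≤ Real.exp (C * M * t) * energy1 χ d₀ φ v B 0
        + W * (Real.exp (C * M * t) - 1) := by linarith
    _ ≤ 2 * Real.exp (C * M * t) * energy1 χ d₀ φ v B 0
        + C * (W * (Real.exp (C * M * t) - 1)) := by linarith
    _ = _ := by rw [hW]; ring

end IsSmoothSolution

end MHD

/-- First-order energy estimate. The constant `C` depends only on the dimension, on the profile of
the cutoff function and on the lower bound `c₀` for `d₀ K`. -/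
theorem theorem1p1 (n : ℕ) (hn : n = 2 ∨ n = 3) (χ : ℝ → ℝ) (hχ : MHD.IsCutoff χ)
    (c₀ : ℝ) (hc₀ : 0 < c₀) :
    ∃ C : ℝ, 0 < C ∧
      ∀ (T ς M K d₀ : ℝ) (φ : ℝ → MHD.Space n → ℝ) (v B : ℝ → MHD.Space n → MHD.Space n)
        (p : ℝ → MHD.Space n → ℝ),
        MHD.IsSmoothSolution T ς φ v B p →
        (∀ t ∈ Set.Icc 0 T, ∀ x ∈ MHD.dom φ t,
          ‖gradient (MHD.totalPressure p B t) x‖ ≤ M ∧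
          MHD.tensorNorm (MHD.gradTensor (v t) x) ≤ M) →
        (∀ t ∈ Set.Icc 0 T, ∀ x ∈ frontier (MHD.dom φ t),
          ENNReal.ofReal (MHD.tensorNorm (MHD.secondFund φ t x)
              + MHD.tensorNorm (MHD.gradTensor (v t) x)) + (MHD.injRadius φ t)⁻¹
            ≤ ENNReal.ofReal K) →
        0 < d₀ →
        (∀ t ∈ Set.Icc 0 T, ENNReal.ofReal d₀ < MHD.injRadius φ t) →
        c₀ ≤ d₀ * K →
        ∀ t ∈ Set.Icc 0 T,
          MHD.energy1 χ d₀ φ v B t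
            ≤ 2 * Real.exp (C * M * t) * MHD.energy1 χ d₀ φ v B 0
              + C * K ^ 2 * (MeasureTheory.volume.real (MHD.dom φ t) + MHD.energy0 φ v B 0)
                * (Real.exp (C * M * t) - 1) := by
  obtain ⟨Cχ, hC0, hC⟩ := hχ.exists_abs_deriv_le
  -- Positive dimension makes the space unbounded, so that a nonempty bounded domain has a nonempty
  -- frontier.
  have : NeZero n := ⟨by omega⟩
  -- The cutoff profile enters only through the bound `Cχ` for its derivative. The maximum with `1`
  -- ensures positivity and the final absorption.
  refine ⟨max 1 ((3 * n * (n ^ 3 + 5 * n ^ 2) + 2 * n ^ 3 * (n * (Cχ + 4 + 4 * n))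
    + 2 * n ^ 3 * (n * ((Cχ + 4) / c₀))) * (4 * Real.pi * (5 + 2 * n))), lt_max_of_lt_left one_pos,
    fun T ς M K d₀ φ v B p h hMP _ hd₀ hι hK t ht => ?_⟩
  exact h.energy1_le hχ hC hC0 (fun s hs x hx => (hMP s hs x hx).1)
    (fun s hs x hx => (hMP s hs x hx).2) hd₀ hι hc₀ hK (le_max_left _ _) (le_max_right _ _) ht
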